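/- Let $\Bbbk$ be a field. All algebras are vector spaces over $\Bbbk$ with bilinear (not necessarily associative) operations, and a multilinear variety is a class of algebras defined by multilinear identities. The operad of a class of algebras has as its arity $n$ component the space of multilinear nonassociative polynomials in $x_1,\dots,x_n$ modulo the multilinear identities that hold on the class. Let $\mathrm{Var}$ be a multilinear variety of algebras with one multiplication, and denote its operad by $\mathrm{Var}$, too. Let $\mathrm{GD}$ be the binary quadratic operad of Gelfand–Dorfman algebras, i.e. of systems $(A,\circ,[\cdot,\cdot])$ with $[a,b]=-[b,a]$ and \[ [[a,b],c]+[[b,c],a]+[[c,a],b]=0,\qquad (a\circ b)\circ c-a\circ(b\circ c)=(b\circ a)\circ c-b\circ(a\circ c), \] \[ (a\circ b)\circ c=(a\circ c)\circ b,\qquad [a,b\circ c]-[c,b\circ a]+[b,a]\circ c-[b,c]\circ a-b\circ[a,c]=0 . \] Let $\mathrm{GD}^!$ be its Koszul dual operad, with $x_1\ast x_2$ and $x_1\star x_2$ the elements of $\mathrm{GD}^!(2)$ dual to $[x_1,x_2]$ and $x_1\circ x_2$ with respect to the basis $[x_1,x_2],\ x_1\circ x_2,\ x_2\circ x_1$ of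 $\mathrm{GD}(2)$. Let $\mathrm{Var}\circ\mathrm{GD}^!$ be the Manin white product, i.e. the suboperad of the Hadamard product $\mathrm{Var}\otimes\mathrm{GD}^!$ generated by $\mathrm{Var}(2)\otimes\mathrm{GD}^!(2)$. Every algebra over $\mathrm{Var}\circ\mathrm{GD}^!$ is considered as a system with the three operations \[ x_1\succ x_2=x_1x_2\otimes (x_1\star x_2),\qquad x_1\prec x_2=x_1x_2\otimes (x_2\star x_1),\qquad x_1\cdot x_2=x_1x_2\otimes (x_1\ast x_2), \] and these systems form the variety governed by $\mathrm{Var}\circ\mathrm{GD}^!$. For $A\in\mathrm{Var}$ and a derivation $d$ of $A$ let $A^{(d*)}$ be the space $A$ with the operations $x\succ y=d(x)y$, $x\prec y=xd(y)$ and the initial product $x\cdot y=xy$. A generalized derived identity of $\mathrm{Var}$ is a polynomial in $\succ,\prec,\cdot$ that vanishes identically on $A^{(d*)}$ for all $A\in\mathrm{Var}$ and all $d\in\mathrm{Der}(A)$. Let $D^*\mathrm{Var}$ be the operad of multilinear polynomials in $\succ,\prec,\cdot$ modulo the multilinear generalized derived identities of $\mathrm{Var}$. **Theorem.** (1) If a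 multilinear identity $f$ holds on the variety governed by the operad $\mathrm{Var}\circ\mathrm{GD}^!$, then $f$ is a generalized derived identity of $\mathrm{Var}$. (2) Conversely, every multilinear generalized derived identity of $\mathrm{Var}$ holds on all $(\mathrm{Var}\circ\mathrm{GD}^!)$-algebras. (3) Hence $D^*\mathrm{Var}=\mathrm{Var}\circ\mathrm{GD}^!$: there is an isomorphism of symmetric operads $D^*\mathrm{Var}\to\mathrm{Var}\circ\mathrm{GD}^!$ that sends $\succ,\prec,\cdot$ to the elements $\succ,\prec,\cdot$ above. -/

import Mathlib

open scoped TensorProduct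

universe u

namespace WhiteGD

noncomputable section

section Trees

/-- Non-associative monomials in variables from `S`, built with binary operations from `Ω`. -/
inductive NATree (Ω : Type u) (S : Type) : Type u
  | var : S → NATree Ω S
  | op : Ω → NATree Ω S → NATree Ω S → NATree Ω S

namespace NATree

variable {Ω : Type u} {S T U : Type}

open Classical in
/-- The number of occurrences of the variable `s`. -/
def occ (s : S) : NATree Ω S → ℕ
  | var x => if x = s then 1 else 0
  | op _ l r => l.occ s + r.occ s

/-- Simultaneous substitution of monomials for all variables. -/
def bind (g : S → NATree Ω T) : NATree Ω S → NATree Ω T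
  | var x => g x
  | op ω l r => op ω (l.bind g) (r.bind g)

/-- Renaming of variables. -/
def rename (e : S → T) (t : NATree Ω S) : NATree Ω T := t.bind fun x => var (e x)

open Classical in
/-- The substitution datum `x ↦ x` for `x ≠ s`, `s ↦ q`; the variables of `q` are kept apart from
the remaining old variables. -/
def plug (s : S) (q : NATree Ω T) (x : S) : NATree Ω ({x : S // x ≠ s} ⊕ T) :=
  if h : x = s then q.rename Sum.inr else var (Sum.inl ⟨x, h⟩)

/-- Substitution of `q` for the single variable `s`. -/
def subst (s : S) (t : NATree Ω S) (q : NATree Ω T) : NATree Ω ({x : S // x ≠ s} ⊕ T) :=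
  t.bind (plug s q)

theorem bind_bind (g : S → NATree Ω T) (h : T → NATree Ω U) (t : NATree Ω S) :
    (t.bind g).bind h = t.bind fun x => (g x).bind h := by
  induction t with
  | var x => rfl
  | op ω l r hl hr => simp [bind, hl, hr]

theorem bind_var (t : NATree Ω S) : t.bind var = t := by
  induction t with
  | var x => rfl
  | op ω l r hl hr => simp [bind, hl, hr]

open Classical in
theorem occ_rename (e : S → T) (he : Function.Injective e) (s : S) (t : NATree Ω S) :
    (t.rename e).occ (e s) = t.occ s := by
  induction t with
  | var x => simp [rename, bind, occ, he.eq_iff]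
  | op ω l r hl hr => simp_all [rename, bind, occ]

open Classical in
theorem occ_rename_of_notMem (e : S → T) (y : T) (hy : ∀ x, e x ≠ y) (t : NATree Ω S) :
    (t.rename e).occ y = 0 := by
  induction t with
  | var x => simp [rename, bind, occ, hy]
  | op ω l r hl hr => simp_all [rename, bind, occ]

open Classical in
theorem occ_subst_inl (s : S) (q : NATree Ω T) (t : NATree Ω S) (x : {x : S // x ≠ s}) :
    (t.subst s q).occ (Sum.inl x) = t.occ x.1 := by
  induction t with
  | var y =>
    by_cases h : y = s
    · subst h
      simp only [subst, bind, plug, dite_true, occ]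
      rw [occ_rename_of_notMem _ _ (by simp), if_neg (fun h => x.2 h.symm)]
    · simp [subst, bind, plug, h, occ, Subtype.ext_iff]
  | op ω l r hl hr => simp_all [subst, bind, occ]

open Classical in
theorem occ_subst_inr (s : S) (q : NATree Ω T) (t : NATree Ω S) (y : T) :
    (t.subst s q).occ (Sum.inr y) = t.occ s * q.occ y := by
  induction t with
  | var z =>
    by_cases h : z = s
    · subst h
      simp only [subst, bind, plug, dite_true, occ, if_true, one_mul]
      exact occ_rename _ Sum.inr_injective _ _
    · simp [subst, bind, plug, h, occ]
  | op ω l r hl hr => simp_all [subst, bind, occ, add_mul]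

end NATree

end Trees

/-- Multilinear monomials: every variable of `S` occurs exactly once. -/
def MTree (Ω : Type u) (S : Type) : Type u := {t : NATree Ω S // ∀ s, t.occ s = 1}

namespace MTree

variable {Ω : Type u} {S T : Type}

theorem ext' {p q : MTree Ω S} (h : p.1 = q.1) : p = q := Subtype.ext h

def rename (e : S ≃ T) (t : MTree Ω S) : MTree Ω T :=
  ⟨t.1.rename e, fun y => by
    rw [← e.apply_symm_apply y, NATree.occ_rename _ e.injective]; exact t.2 _⟩

def subst (s : S) (t : MTree Ω S) (q : MTree Ω T) : MTree Ω ({x : S // x ≠ s} ⊕ T) :=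
  ⟨t.1.subst s q.1, by
    rintro (x | y)
    · rw [NATree.occ_subst_inl]; exact t.2 _
    · rw [NATree.occ_subst_inr, t.2, q.2]⟩

/-- The one-variable monomial. -/
def unit : MTree Ω Unit := ⟨.var (), fun _ => by simp [NATree.occ]⟩

/-- The monomial `ω(x₀, x₁)`. -/
def bin (ω : Ω) : MTree Ω (Fin 2) :=
  ⟨.op ω (.var 0) (.var 1), fun s => by fin_cases s <;> simp [NATree.occ]⟩

end MTree

/-! ### Relabelling bijections used in the axioms of a symmetric operad -/

section Equivs

variable {S T U S' T' : Type}

def compEquiv (e : S ≃ S') (f : T ≃ T') (s : S) :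
    {x : S // x ≠ s} ⊕ T ≃ {x : S' // x ≠ e s} ⊕ T' :=
  Equiv.sumCongr (e.subtypeEquiv fun _ => e.injective.ne_iff.symm) f

def oneCompEquiv (T : Type) : T ≃ {x : Unit // x ≠ ()} ⊕ T where
  toFun := Sum.inr
  invFun := Sum.elim (fun x => (x.2 rfl).elim) id
  left_inv _ := rfl
  right_inv := by
    rintro (x | x)
    · exact (x.2 rfl).elim
    · rfl

open Classical in
def compOneEquiv (s : S) : S ≃ {x : S // x ≠ s} ⊕ Unit where
  toFun x := if h : x = s then Sum.inr () else Sum.inl ⟨x, h⟩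
  invFun := Sum.elim Subtype.val fun _ => s
  left_inv x := by by_cases h : x = s <;> simp [h]
  right_inv := by
    rintro (x | x)
    · simp [x.2]
    · simp

def seqEquiv (s : S) (t : T) (U : Type) :
    {x : S // x ≠ s} ⊕ ({y : T // y ≠ t} ⊕ U) ≃
      {z : {x : S // x ≠ s} ⊕ T // z ≠ Sum.inr t} ⊕ U where
  toFun
    | .inl x => .inl ⟨.inl x, by simp⟩
    | .inr (.inl y) => .inl ⟨.inr y.1, by simpa using y.2⟩
    | .inr (.inr u) => .inr u
  invFun
    | .inl ⟨.inl x, _⟩ => .inl x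
    | .inl ⟨.inr y, h⟩ => .inr (.inl ⟨y, by simpa using h⟩)
    | .inr u => .inr (.inr u)
  left_inv := by rintro (x | y | u) <;> rfl
  right_inv := by rintro (⟨x | y, h⟩ | u) <;> rfl

def parMap (s s' : S) (T U : Type) (h : s ≠ s') :
    {z : {x : S // x ≠ s'} ⊕ U // z ≠ Sum.inl ⟨s, h⟩} ⊕ T →
      {z : {x : S // x ≠ s} ⊕ T // z ≠ Sum.inl ⟨s', h.symm⟩} ⊕ U
  | .inl ⟨.inl x, hx⟩ =>
      .inl ⟨.inl ⟨x.1, fun e => hx (by simp [Subtype.ext_iff, e])⟩,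
        fun e => x.2 (by simpa [Subtype.ext_iff] using e)⟩
  | .inl ⟨.inr u, _⟩ => .inr u
  | .inr t => .inl ⟨.inr t, by simp⟩

def parEquiv (s s' : S) (T U : Type) (h : s ≠ s') :
    {z : {x : S // x ≠ s'} ⊕ U // z ≠ Sum.inl ⟨s, h⟩} ⊕ T ≃
      {z : {x : S // x ≠ s} ⊕ T // z ≠ Sum.inl ⟨s', h.symm⟩} ⊕ U where
  toFun := parMap s s' T U h
  invFun := parMap s' s U T h.symm
  left_inv := by rintro (⟨x | y, h⟩ | u) <;> rfl
  right_inv := by rintro (⟨x | y, h⟩ | u) <;> rfl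

end Equivs

/-! ### Symmetric operads of `k`-vector spaces (indexed by finite sets, with partial compositions) -/

structure SymmOperad (k : Type u) [Field k] where
  obj : ∀ (S : Type) [Finite S], Type u
  [acg : ∀ (S : Type) [Finite S], AddCommGroup (obj S)]
  [mod : ∀ (S : Type) [Finite S], Module k (obj S)]
  map : ∀ {S T : Type} [Finite S] [Finite T], S ≃ T → obj S →ₗ[k] obj T
  one : obj Unit
  /-- `comp s p q` is `p ∘ₛ q`. -/
  comp : ∀ {S T : Type} [Finite S] [Finite T] (s : S),
    obj S →ₗ[k] obj T →ₗ[k] obj ({x : S // x ≠ s} ⊕ T)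
  map_refl : ∀ {S : Type} [Finite S] (p : obj S), map (Equiv.refl S) p = p
  map_map : ∀ {S T U : Type} [Finite S] [Finite T] [Finite U] (e : S ≃ T) (f : T ≃ U) (p : obj S),
    map f (map e p) = map (e.trans f) p
  comp_map : ∀ {S T S' T' : Type} [Finite S] [Finite T] [Finite S'] [Finite T']
    (e : S ≃ S') (f : T ≃ T') (s : S) (p : obj S) (q : obj T),
    comp (e s) (map e p) (map f q) = map (compEquiv e f s) (comp s p q)
  one_comp : ∀ {T : Type} [Finite T] (q : obj T), comp () one q = map (oneCompEquiv T) q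
  comp_one : ∀ {S : Type} [Finite S] (s : S) (p : obj S), comp s p one = map (compOneEquiv s) p
  comp_seq : ∀ {S T U : Type} [Finite S] [Finite T] [Finite U] (s : S) (t : T)
    (p : obj S) (q : obj T) (r : obj U),
    comp (Sum.inr t) (comp s p q) r = map (seqEquiv s t U) (comp s p (comp t q r))
  comp_par : ∀ {S T U : Type} [Finite S] [Finite T] [Finite U] (s s' : S) (h : s ≠ s')
    (p : obj S) (q : obj T) (r : obj U),
    comp (Sum.inl ⟨s', h.symm⟩) (comp s p q) r =
      map (parEquiv s s' T U h) (comp (Sum.inl ⟨s, h⟩) (comp s' p r) q)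

attribute [instance] SymmOperad.acg SymmOperad.mod

/-- Isomorphisms of symmetric operads. -/
structure OperadIso {k : Type u} [Field k] (P Q : SymmOperad k) where
  equiv : ∀ (S : Type) [Finite S], P.obj S ≃ₗ[k] Q.obj S
  map' : ∀ {S T : Type} [Finite S] [Finite T] (e : S ≃ T) (p : P.obj S),
    equiv T (P.map e p) = Q.map e (equiv S p)
  one' : equiv Unit P.one = Q.one
  comp' : ∀ {S T : Type} [Finite S] [Finite T] (s : S) (p : P.obj S) (q : P.obj T),
    equiv _ (P.comp s p q) = Q.comp s (equiv S p) (equiv T q)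

open Classical in
/-- Algebras over a symmetric operad: morphisms from `P` to the endomorphism operad of `A`. -/
structure OperadAlgebra {k : Type u} [Field k] (P : SymmOperad k)
    (A : Type u) [AddCommGroup A] [Module k A] where
  act : ∀ {S : Type} [Finite S], P.obj S →ₗ[k] MultilinearMap k (fun _ : S => A) A
  act_map : ∀ {S T : Type} [Finite S] [Finite T] (e : S ≃ T) (p : P.obj S) (a : T → A),
    act (P.map e p) a = act p (a ∘ e)
  act_one : ∀ a : Unit → A, act P.one a = a ()
  act_comp : ∀ {S T : Type} [Finite S] [Finite T] (s : S) (p : P.obj S) (q : P.obj T)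
    (a : {x : S // x ≠ s} ⊕ T → A),
    act (P.comp s p q) a =
      act p fun x => if h : x = s then act q fun t => a (Sum.inr t) else a (Sum.inl ⟨x, h⟩)

/-! ### Hadamard product, suboperads, quotients -/

namespace SymmOperad

variable {k : Type u} [Field k]

/-- The Hadamard product: `(P ⊗ Q)(S) = P(S) ⊗ Q(S)` with componentwise structure. -/
def hadamard (P Q : SymmOperad k) : SymmOperad k where
  obj S _ := P.obj S ⊗[k] Q.obj S
  map e := TensorProduct.map (P.map e) (Q.map e)
  one := P.one ⊗ₜ Q.one
  comp s := TensorProduct.map₂ (P.comp s) (Q.comp s)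
  map_refl p := by
    induction p using TensorProduct.induction_on with
    | zero => simp
    | tmul x y => simp [P.map_refl, Q.map_refl]
    | add x y hx hy => simp [hx, hy]
  map_map e f p := by
    induction p using TensorProduct.induction_on with
    | zero => simp
    | tmul x y => simp [P.map_map, Q.map_map]
    | add x y hx hy => simp only [map_add, hx, hy]
  comp_map e f s p q := by
    induction p using TensorProduct.induction_on with
    | zero => simp
    | add x y hx hy => simp only [map_add, LinearMap.add_apply, hx, hy]
    | tmul x y =>
      induction q using TensorProduct.induction_on with
      | zero => simp
      | add x y hx hy => simp only [map_add, hx, hy]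
      | tmul z w => simp [P.comp_map, Q.comp_map]
  one_comp q := by
    induction q using TensorProduct.induction_on with
    | zero => simp
    | add x y hx hy => simp only [map_add, hx, hy]
    | tmul z w => simp [P.one_comp, Q.one_comp]
  comp_one s q := by
    induction q using TensorProduct.induction_on with
    | zero => simp
    | add x y hx hy => simp only [map_add, LinearMap.add_apply, hx, hy]
    | tmul z w => simp [P.comp_one, Q.comp_one]
  comp_seq s t p q r := by
    induction p using TensorProduct.induction_on with
    | zero => simp
    | add x y hx hy => simp only [map_add, LinearMap.add_apply, hx, hy]
    | tmul x y =>
      induction q using TensorProduct.induction_on with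
      | zero => simp
      | add x y hx hy => simp only [map_add, LinearMap.add_apply, hx, hy]
      | tmul z w =>
        induction r using TensorProduct.induction_on with
        | zero => simp
        | add x y hx hy => simp only [map_add, hx, hy]
        | tmul a b => simp [P.comp_seq, Q.comp_seq]
  comp_par s s' h p q r := by
    induction p using TensorProduct.induction_on with
    | zero => simp
    | add x y hx hy => simp only [map_add, LinearMap.add_apply, hx, hy]
    | tmul x y =>
      induction q using TensorProduct.induction_on with
      | zero => simp
      | add x y hx hy => simp only [map_add, LinearMap.add_apply, hx, hy]
      | tmul z w =>
        induction r using TensorProduct.induction_on with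
        | zero => simp
        | add x y hx hy => simp only [map_add, LinearMap.add_apply, hx, hy]
        | tmul a b => simp [P.comp_par s s' h, Q.comp_par s s' h]

/-- Suboperads. -/
structure Sub (P : SymmOperad k) where
  carrier : ∀ (S : Type) [Finite S], Submodule k (P.obj S)
  map_mem : ∀ {S T : Type} [Finite S] [Finite T] (e : S ≃ T) {p : P.obj S},
    p ∈ carrier S → P.map e p ∈ carrier T
  one_mem : P.one ∈ carrier Unit
  comp_mem : ∀ {S T : Type} [Finite S] [Finite T] (s : S) {p : P.obj S} {q : P.obj T},
    p ∈ carrier S → q ∈ carrier T → P.comp s p q ∈ carrier _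

/-- A suboperad is an operad. -/
def Sub.toOperad {P : SymmOperad k} (W : P.Sub) : SymmOperad k where
  obj S _ := W.carrier S
  map e := (P.map e).restrict fun _ h => W.map_mem e h
  one := ⟨P.one, W.one_mem⟩
  comp s := LinearMap.mk₂ k (fun p q => ⟨P.comp s p.1 q.1, W.comp_mem s p.2 q.2⟩)
    (fun _ _ _ => Subtype.ext (by simp)) (fun _ _ _ => Subtype.ext (by simp))
    (fun _ _ _ => Subtype.ext (by simp)) (fun _ _ _ => Subtype.ext (by simp))
  map_refl p := Subtype.ext (P.map_refl p.1)
  map_map e f p := Subtype.ext (P.map_map e f p.1)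
  comp_map e f s p q := Subtype.ext (P.comp_map e f s p.1 q.1)
  one_comp q := Subtype.ext (P.one_comp q.1)
  comp_one s p := Subtype.ext (P.comp_one s p.1)
  comp_seq s t p q r := Subtype.ext (P.comp_seq s t p.1 q.1 r.1)
  comp_par s s' h p q r := Subtype.ext (P.comp_par s s' h p.1 q.1 r.1)

/-- The suboperad generated by the binary part `P(2)`. -/
def binarySub (P : SymmOperad k) : P.Sub where
  carrier S _ := ⨅ (W : P.Sub) (_ : W.carrier (Fin 2) = ⊤), W.carrier S
  map_mem e p hp := by
    simp only [Submodule.mem_iInf] at hp ⊢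
    exact fun W hW => W.map_mem e (hp W hW)
  one_mem := by
    simp only [Submodule.mem_iInf]
    exact fun W _ => W.one_mem
  comp_mem s p q hp hq := by
    simp only [Submodule.mem_iInf] at hp hq ⊢
    exact fun W hW => W.comp_mem s (hp W hW) (hq W hW)

theorem mem_binarySub (P : SymmOperad k) (p : P.obj (Fin 2)) :
    p ∈ P.binarySub.carrier (Fin 2) := by
  simp only [binarySub, Submodule.mem_iInf]
  intro W hW
  simp [hW]

/-- The Manin white product `P ∘ Q` : the suboperad of the Hadamard product `P ⊗ Q` generated by
`P(2) ⊗ Q(2)`. -/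
def white (P Q : SymmOperad k) : SymmOperad k := (P.hadamard Q).binarySub.toOperad

/-- The binary element `p ⊗ q` of the white product. -/
def whiteGen (P Q : SymmOperad k) (p : P.obj (Fin 2)) (q : Q.obj (Fin 2)) :
    (white P Q).obj (Fin 2) :=
  ⟨p ⊗ₜ[k] q, mem_binarySub (P.hadamard Q) (p ⊗ₜ[k] q)⟩

/-- Operadic ideals. -/
structure OpIdeal (P : SymmOperad k) where
  carrier : ∀ (S : Type) [Finite S], Submodule k (P.obj S)
  map_mem : ∀ {S T : Type} [Finite S] [Finite T] (e : S ≃ T) {p : P.obj S},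
    p ∈ carrier S → P.map e p ∈ carrier T
  comp_mem_left : ∀ {S T : Type} [Finite S] [Finite T] (s : S) {p : P.obj S} (q : P.obj T),
    p ∈ carrier S → P.comp s p q ∈ carrier _
  comp_mem_right : ∀ {S T : Type} [Finite S] [Finite T] (s : S) (p : P.obj S) {q : P.obj T},
    q ∈ carrier T → P.comp s p q ∈ carrier _

/-- The quotient of an operad by an operadic ideal. -/
def OpIdeal.quotient {P : SymmOperad k} (J : P.OpIdeal) : SymmOperad k where
  obj S _ := P.obj S ⧸ J.carrier S
  map e := Submodule.mapQ _ _ (P.map e) fun _ h => J.map_mem e h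
  one := Submodule.Quotient.mk P.one
  comp {S T} _ _ s := Submodule.liftQ _
    (LinearMap.mk₂ k (fun p => Submodule.mapQ (J.carrier T) (J.carrier _) (P.comp s p)
        fun _ h => J.comp_mem_right s p h)
      (fun p p' q => by induction q using Submodule.Quotient.induction_on; simp)
      (fun c p q => by induction q using Submodule.Quotient.induction_on; simp)
      (fun p q q' => by simp) (fun c p q => by simp))
    (fun p hp => by
      rw [LinearMap.mem_ker]
      refine LinearMap.ext fun q => ?_
      induction q using Submodule.Quotient.induction_on with
      | H q =>
        simpa using J.comp_mem_left s q hp)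
  map_refl p := by
    induction p using Submodule.Quotient.induction_on
    simp [P.map_refl]
  map_map e f p := by
    induction p using Submodule.Quotient.induction_on
    simp [P.map_map]
  comp_map e f s p q := by
    induction p using Submodule.Quotient.induction_on
    induction q using Submodule.Quotient.induction_on
    simp [P.comp_map]
  one_comp q := by
    induction q using Submodule.Quotient.induction_on
    simp [P.one_comp]
  comp_one s p := by
    induction p using Submodule.Quotient.induction_on
    simp [P.comp_one]
  comp_seq s t p q r := by
    induction p using Submodule.Quotient.induction_on
    induction q using Submodule.Quotient.induction_on
    induction r using Submodule.Quotient.induction_on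
    simp [P.comp_seq]
  comp_par s s' h p q r := by
    induction p using Submodule.Quotient.induction_on
    induction q using Submodule.Quotient.induction_on
    induction r using Submodule.Quotient.induction_on
    simp [P.comp_par s s' h]

end SymmOperad

/-! ### Multilinear non-associative polynomials and the free operad -/

/-- Multilinear non-associative polynomials in the variables `S` with operations `Ω`. -/
abbrev MPoly (k : Type u) [Field k] (Ω : Type u) (S : Type) : Type u := MTree Ω S →₀ k

section Free

variable (k : Type u) [Field k] (Ω : Type u)

theorem MTree.rename_refl {S : Type} (t : MTree Ω S) : t.rename (Equiv.refl S) = t :=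
  MTree.ext' (NATree.bind_var t.1)

theorem MTree.rename_rename {S T U : Type} (e : S ≃ T) (f : T ≃ U) (t : MTree Ω S) :
    (t.rename e).rename f = t.rename (e.trans f) :=
  MTree.ext' (NATree.bind_bind _ _ _)

variable {Ω} in
theorem NATree.plug_self {S T : Type} (s : S) (q : NATree Ω T) :
    NATree.plug s q s = q.rename Sum.inr := by simp [NATree.plug]

variable {Ω} in
theorem NATree.plug_ne {S T : Type} (s : S) (q : NATree Ω T) (x : S) (h : x ≠ s) :
    NATree.plug s q x = .var (Sum.inl ⟨x, h⟩) := by simp [NATree.plug, h]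

theorem MTree.subst_rename {S T S' T' : Type} (e : S ≃ S') (f : T ≃ T') (s : S)
    (p : MTree Ω S) (q : MTree Ω T) :
    (p.rename e).subst (e s) (q.rename f) = (p.subst s q).rename (compEquiv e f s) := by
  apply MTree.ext'
  simp only [rename, subst, NATree.subst, NATree.rename, NATree.bind_bind]
  congr 1
  funext x
  by_cases h : x = s
  · subst h
    simp only [NATree.bind, NATree.plug_self, NATree.rename, NATree.bind_bind]
    rfl
  · simp only [NATree.bind]
    rw [NATree.plug_ne _ _ _ h, NATree.plug_ne _ _ _ (e.injective.ne h)]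
    rfl

theorem MTree.unit_subst {T : Type} (q : MTree Ω T) :
    (MTree.unit : MTree Ω Unit).subst () q = q.rename (oneCompEquiv T) :=
  MTree.ext' (NATree.plug_self () q.1)

theorem MTree.subst_unit {S : Type} (s : S) (p : MTree Ω S) :
    p.subst s MTree.unit = p.rename (compOneEquiv s) := by
  apply MTree.ext'
  simp only [rename, subst, NATree.subst, NATree.rename]
  congr 1
  funext x
  by_cases h : x = s
  · subst h
    simp [NATree.plug_self, NATree.rename, MTree.unit, NATree.bind, compOneEquiv]
  · simp [NATree.plug_ne _ _ _ h, compOneEquiv, h]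

theorem MTree.subst_seq {S T U : Type} (s : S) (t : T) (p : MTree Ω S) (q : MTree Ω T)
    (r : MTree Ω U) :
    (p.subst s q).subst (Sum.inr t) r = (p.subst s (q.subst t r)).rename (seqEquiv s t U) := by
  apply MTree.ext'
  simp only [rename, subst, NATree.subst, NATree.rename, NATree.bind_bind]
  congr 1
  funext x
  by_cases h : x = s
  · subst h
    simp only [NATree.plug_self, NATree.rename, NATree.bind_bind]
    congr 1
    funext y
    by_cases hy : y = t
    · subst hy
      simp only [NATree.bind, NATree.plug_self, NATree.rename, NATree.bind_bind]
      rfl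
    · simp only [NATree.bind]
      rw [NATree.plug_ne _ _ _ hy, NATree.plug_ne _ _ _ (by simpa using hy)]
      rfl
  · rw [NATree.plug_ne _ _ _ h, NATree.plug_ne _ _ _ h]
    simp only [NATree.bind]
    rw [NATree.plug_ne _ _ _ (by simp)]
    rfl

theorem MTree.subst_par {S T U : Type} (s s' : S) (h : s ≠ s') (p : MTree Ω S) (q : MTree Ω T)
    (r : MTree Ω U) :
    (p.subst s q).subst (Sum.inl ⟨s', h.symm⟩) r =
      ((p.subst s' r).subst (Sum.inl ⟨s, h⟩) q).rename (parEquiv s s' T U h) := by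
  apply MTree.ext'
  simp only [rename, subst, NATree.subst, NATree.rename, NATree.bind_bind]
  congr 1
  funext x
  by_cases hx : x = s
  · subst hx
    rw [NATree.plug_ne _ _ _ h]
    simp only [NATree.bind, NATree.plug_self, NATree.rename, NATree.bind_bind]
    congr 1
    funext y
    rw [NATree.plug_ne _ _ _ (by simp)]
    rfl
  · rw [NATree.plug_ne _ _ _ hx]
    by_cases hx' : x = s'
    · subst hx'
      simp only [NATree.bind, NATree.plug_self, NATree.rename, NATree.bind_bind]
      congr 1
      funext y
      rw [NATree.plug_ne _ _ _ (by simp)]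
      rfl
    · rw [NATree.plug_ne _ _ _ hx']
      simp only [NATree.bind]
      rw [NATree.plug_ne _ _ _ (by simpa [Subtype.ext_iff] using hx'),
        NATree.plug_ne _ _ _ (by simpa [Subtype.ext_iff] using hx)]
      rfl

/-- Partial composition of multilinear polynomials: the bilinear extension of substitution. -/
def MPoly.comp {S T : Type} (s : S) :
    MPoly k Ω S →ₗ[k] MPoly k Ω T →ₗ[k] MPoly k Ω ({x : S // x ≠ s} ⊕ T) :=
  Finsupp.lsum k fun p => LinearMap.toSpanSingleton k _ (Finsupp.lmapDomain k k fun q => p.subst s q)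

@[simp]
theorem MPoly.comp_single {S T : Type} (s : S) (p : MTree Ω S) (q : MTree Ω T) (a b : k) :
    MPoly.comp k Ω s (Finsupp.single p a) (Finsupp.single q b) =
      Finsupp.single (p.subst s q) (a * b) := by
  simp [MPoly.comp]

/-- The free symmetric operad on a set `Ω` of binary operations without symmetries (the magmatic
operad): its components are the spaces of multilinear non-associative polynomials. -/
@[reducible]
def freeOperad : SymmOperad k where
  obj S _ := MPoly k Ω S
  map e := Finsupp.lmapDomain k k (MTree.rename e)
  one := Finsupp.single MTree.unit 1
  comp s := MPoly.comp k Ω s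
  map_refl p := by
    induction p using Finsupp.induction_linear with
    | zero => simp
    | add x y hx hy => simp only [map_add, hx, hy]
    | single x a => simp [MTree.rename_refl]
  map_map e f p := by
    induction p using Finsupp.induction_linear with
    | zero => simp
    | add x y hx hy => simp only [map_add, hx, hy]
    | single x a => simp [MTree.rename_rename]
  comp_map e f s p q := by
    induction p using Finsupp.induction_linear with
    | zero => simp
    | add x y hx hy => simp only [map_add, LinearMap.add_apply, hx, hy]
    | single x a =>
      induction q using Finsupp.induction_linear with
      | zero => simp
      | add x y hx hy => simp only [map_add, hx, hy]
      | single y b => simp [MTree.subst_rename, -Finsupp.single_mul]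
  one_comp q := by
    induction q using Finsupp.induction_linear with
    | zero => simp
    | add x y hx hy => simp only [map_add, hx, hy]
    | single y b => simp [MTree.unit_subst]
  comp_one s p := by
    induction p using Finsupp.induction_linear with
    | zero => simp
    | add x y hx hy => simp only [map_add, LinearMap.add_apply, hx, hy]
    | single y b => simp [MTree.subst_unit]
  comp_seq s t p q r := by
    induction p using Finsupp.induction_linear with
    | zero => simp
    | add x y hx hy => simp only [map_add, LinearMap.add_apply, hx, hy]
    | single x a =>
      induction q using Finsupp.induction_linear with
      | zero => simp
      | add x y hx hy => simp only [map_add, LinearMap.add_apply, hx, hy]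
      | single y b =>
        induction r using Finsupp.induction_linear with
        | zero => simp
        | add x y hx hy => simp only [map_add, hx, hy]
        | single z c => simp [MTree.subst_seq, mul_assoc, -Finsupp.single_mul]
  comp_par s s' h p q r := by
    induction p using Finsupp.induction_linear with
    | zero => simp
    | add x y hx hy => simp only [map_add, LinearMap.add_apply, hx, hy]
    | single x a =>
      induction q using Finsupp.induction_linear with
      | zero => simp
      | add x y hx hy => simp only [map_add, LinearMap.add_apply, hx, hy]
      | single y b =>
        induction r using Finsupp.induction_linear with
        | zero => simp
        | add x y hx hy => simp only [map_add, LinearMap.add_apply, hx, hy]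
        | single z c => simp [MTree.subst_par Ω s s' h, mul_assoc, mul_comm b c, -Finsupp.single_mul]

end Free

/-! ### Algebras with a set of bilinear operations, multilinear identities -/

/-- A `k`-vector space with bilinear operations indexed by `Ω`. -/
structure OpAlg (k : Type u) [Field k] (Ω : Type u) where
  carrier : Type u
  [acg : AddCommGroup carrier]
  [mod : Module k carrier]
  op : Ω → carrier →ₗ[k] carrier →ₗ[k] carrier

attribute [instance] OpAlg.acg OpAlg.mod

namespace OpAlg

variable {k : Type u} [Field k] {Ω : Type u}

/-- The value of a monomial. -/
def evalTree (A : OpAlg k Ω) {S : Type} (a : S → A.carrier) : NATree Ω S → A.carrier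
  | .var x => a x
  | .op ω l r => A.op ω (A.evalTree a l) (A.evalTree a r)

/-- The value of a multilinear polynomial. -/
def eval (A : OpAlg k Ω) {S : Type} (a : S → A.carrier) : MPoly k Ω S →ₗ[k] A.carrier :=
  Finsupp.linearCombination k fun t => A.evalTree a t.1

/-- `f = 0` is an identity on `A`. -/
def Holds (A : OpAlg k Ω) {S : Type} (f : MPoly k Ω S) : Prop :=
  ∀ a : S → A.carrier, A.eval a f = 0

@[simp]
theorem eval_single (A : OpAlg k Ω) {S : Type} (a : S → A.carrier) (t : MTree Ω S) (c : k) :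
    A.eval a (Finsupp.single t c) = c • A.evalTree a t.1 := by
  simp [eval]

theorem evalTree_bind (A : OpAlg k Ω) {S T : Type} (g : S → NATree Ω T) (a : T → A.carrier)
    (t : NATree Ω S) :
    A.evalTree a (t.bind g) = A.evalTree (fun x => A.evalTree a (g x)) t := by
  induction t with
  | var x => rfl
  | op ω l r hl hr => simp [NATree.bind, evalTree, hl, hr]

open Classical in
theorem evalTree_congr (A : OpAlg k Ω) {S : Type} (s : S) (t : NATree Ω S) (h : t.occ s = 0)
    (a b : S → A.carrier) (hab : ∀ x, x ≠ s → a x = b x) : A.evalTree a t = A.evalTree b t := by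
  induction t with
  | var x =>
    apply hab
    intro hx
    simp [NATree.occ, hx] at h
  | op ω l r hl hr =>
    simp only [NATree.occ, Nat.add_eq_zero_iff] at h
    simp [evalTree, hl h.1, hr h.2]

/-- The value of a multilinear monomial is linear in each variable. -/
theorem exists_linear (A : OpAlg k Ω) {S : Type} (s : S) (t : NATree Ω S) (h : t.occ s = 1)
    (a : S → A.carrier) : ∃ L : A.carrier →ₗ[k] A.carrier, ∀ b : S → A.carrier,
      (∀ x, x ≠ s → b x = a x) → A.evalTree b t = L (b s) := by
  induction t with
  | var x =>
    have hx : x = s := by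
      by_contra hx
      simp [NATree.occ, hx] at h
    exact ⟨LinearMap.id, fun b _ => by simp [evalTree, hx]⟩
  | op ω l r hl hr =>
    simp only [NATree.occ] at h
    rcases Nat.eq_zero_or_pos (l.occ s) with h0 | h0
    · obtain ⟨L, hL⟩ := hr (by omega)
      exact ⟨(A.op ω (A.evalTree a l)).comp L, fun b hb => by
        simp [evalTree, hL b hb, A.evalTree_congr s l h0 b a hb]⟩
    · obtain ⟨L, hL⟩ := hl (by omega)
      exact ⟨((A.op ω).flip (A.evalTree a r)).comp L, fun b hb => by
        simp [evalTree, hL b hb, A.evalTree_congr s r (by omega) b a hb]⟩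

theorem eval_map (A : OpAlg k Ω) {S T : Type} (e : S ≃ T) (f : MPoly k Ω S) (a : T → A.carrier) :
    A.eval a (Finsupp.lmapDomain k k (MTree.rename e) f) = A.eval (fun x => a (e x)) f := by
  induction f using Finsupp.induction_linear with
  | zero => simp
  | add x y hx hy => simp only [map_add, hx, hy]
  | single t c =>
    rw [Finsupp.lmapDomain_apply, Finsupp.mapDomain_single, eval_single, eval_single]
    simp [MTree.rename, NATree.rename, evalTree_bind, evalTree]

open Classical in
theorem eval_comp (A : OpAlg k Ω) {S T : Type} (s : S) (f : MPoly k Ω S) (g : MPoly k Ω T)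
    (a : {x : S // x ≠ s} ⊕ T → A.carrier) :
    A.eval a (MPoly.comp k Ω s f g) =
      A.eval (fun x => if h : x = s then A.eval (fun t => a (Sum.inr t)) g
        else a (Sum.inl ⟨x, h⟩)) f := by
  induction f using Finsupp.induction_linear with
  | zero => simp
  | add x y hx hy => simp only [map_add, LinearMap.add_apply, hx, hy]
  | single t c =>
    obtain ⟨L, hL⟩ := A.exists_linear s t.1 (t.2 s)
      (fun x => if h : x = s then 0 else a (Sum.inl ⟨x, h⟩))
    rw [eval_single, hL _ (fun x hx => by simp [hx])]
    simp only [dite_true]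
    induction g using Finsupp.induction_linear with
    | zero => simp
    | add x y hx hy => simp only [map_add, smul_add, hx, hy]
    | single q b =>
      rw [MPoly.comp_single, eval_single, eval_single, map_smul, smul_smul]
      congr 1
      simp only [MTree.subst, NATree.subst, evalTree_bind]
      rw [hL _ (fun x hx => by simp [NATree.plug_ne _ _ _ hx, evalTree, hx])]
      simp [NATree.plug_self, NATree.rename, evalTree_bind, evalTree]

end OpAlg

section OperadOf

variable {k : Type u} [Field k] {Ω : Type u}

/-- The multilinear identities in the variables `S` that hold on all algebras of a class. -/
def identities (C : Set (OpAlg k Ω)) (S : Type) : Submodule k (MPoly k Ω S) where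
  carrier := {f | ∀ A ∈ C, A.Holds f}
  zero_mem' _ _ _ := map_zero _
  add_mem' {f g} hf hg A hA a := by rw [map_add, hf A hA a, hg A hA a, add_zero]
  smul_mem' c f hf A hA a := by rw [map_smul, hf A hA a, smul_zero]

/-- These identities form an operadic ideal. -/
def identityIdeal (C : Set (OpAlg k Ω)) : (freeOperad k Ω).OpIdeal where
  carrier S _ := identities C S
  map_mem e p hp A hA a := (A.eval_map e p a).trans (hp A hA _)
  comp_mem_left s p q hp A hA a := (A.eval_comp s p q a).trans (hp A hA _)
  comp_mem_right s p q hq A hA a := by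
    classical
    refine (A.eval_comp s p q a).trans ?_
    induction p using Finsupp.induction_linear with
    | zero => exact map_zero _
    | add x y hx hy => rw [map_add, hx, hy, add_zero]
    | single t c =>
      obtain ⟨L, hL⟩ := A.exists_linear s t.1 (t.2 s)
        (fun x => if h : x = s then 0 else a (Sum.inl ⟨x, h⟩))
      rw [OpAlg.eval_single, hL _ (fun x hx => by simp [hx])]
      simp only [dite_true]
      rw [hq A hA, map_zero, smul_zero]

/-- The operad of a class of algebras: multilinear polynomials modulo multilinear identities. -/
def operadOf (C : Set (OpAlg k Ω)) : SymmOperad k := (identityIdeal C).quotient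

/-- The binary element `ω(x₀, x₁)` of the operad of a class of algebras. -/
def operadOf.gen (C : Set (OpAlg k Ω)) (ω : Ω) : (operadOf C).obj (Fin 2) :=
  Submodule.Quotient.mk (Finsupp.single (MTree.bin ω) 1)

end OperadOf

/-! ### Binary quadratic operads and Koszul duality -/

section Quadratic

variable {k : Type u} [Field k]

/-- Let `E` be the space of binary generators, `τ` the action of `(12)` on it. The arity 3 part
of the free operad on `E` is identified with `Fin 3 → E ⊗ E`: the tensor `α ⊗ β` in position `i`
stands for `α(β(x_{i+1}, x_{i+2}), x_i)`, indices modulo 3. This is the action of `S₃` on it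
by renaming of variables. -/
def permAct {E : Type u} [AddCommGroup E] [Module k E] (τ : E →ₗ[k] E) (σ : Equiv.Perm (Fin 3)) :
    (Fin 3 → E ⊗[k] E) →ₗ[k] (Fin 3 → E ⊗[k] E) :=
  LinearMap.pi fun i =>
    (if Equiv.Perm.sign σ = 1 then LinearMap.id else LinearMap.lTensor E τ) ∘ₗ
      LinearMap.proj (σ⁻¹ i)

theorem permAct_permAct {E : Type u} [AddCommGroup E] [Module k E] (τ : E →ₗ[k] E)
    (hτ : ∀ e, τ (τ e) = e) (σ ρ : Equiv.Perm (Fin 3)) (r : Fin 3 → E ⊗[k] E) :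
    permAct τ σ (permAct τ ρ r) = permAct τ (σ * ρ) r := by
  have h2 : ∀ x : E ⊗[k] E, LinearMap.lTensor E τ (LinearMap.lTensor E τ x) = x := by
    intro x
    rw [← LinearMap.comp_apply, ← LinearMap.lTensor_comp,
      show τ ∘ₗ τ = LinearMap.id from LinearMap.ext hτ, LinearMap.lTensor_id, LinearMap.id_apply]
  funext i
  rcases Int.units_eq_one_or (Equiv.Perm.sign σ) with h | h <;>
  rcases Int.units_eq_one_or (Equiv.Perm.sign ρ) with h' | h' <;>
  simp [permAct, h, h', h2]

/-- The element `α(β(x_{σ 0}, x_{σ 1}), x_{σ 2})`. -/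
def quadMono {E : Type u} [AddCommGroup E] [Module k E] (τ : E →ₗ[k] E) (σ : Equiv.Perm (Fin 3))
    (α β : E) : Fin 3 → E ⊗[k] E :=
  permAct τ σ (Pi.single 2 (α ⊗ₜ β))

variable (k) in
/-- Data `(E, R)` of a binary quadratic operad: an `S₂`-module `E` of generators and an
`S₃`-submodule `R` of the arity 3 part of the free operad on `E`. -/
structure QuadData where
  E : Type u
  [acg : AddCommGroup E]
  [mod : Module k E]
  swap : E →ₗ[k] E
  swap_swap : ∀ e, swap (swap e) = e
  rel : Submodule k (Fin 3 → E ⊗[k] E)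
  rel_stable : ∀ σ, ∀ r ∈ rel, permAct swap σ r ∈ rel

attribute [instance] QuadData.acg QuadData.mod

/-- The pairing of the arity 3 parts of the free operads on `E* ⊗ sgn` and on `E`. In the
cyclic coordinates of `permAct` no signs show up: they are carried by the twisted action of `(12)`
on `E* ⊗ sgn`. -/
def quadPair {E : Type u} [AddCommGroup E] [Module k E]
    (φ : Fin 3 → Module.Dual k E ⊗[k] Module.Dual k E) (r : Fin 3 → E ⊗[k] E) : k :=
  ∑ i, TensorProduct.dualDistrib k E E (φ i) (r i)

/-- The pairing is equivariant up to the sign. -/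
theorem quadPair_permAct {E : Type u} [AddCommGroup E] [Module k E] (τ : E →ₗ[k] E)
    (hτ : ∀ e, τ (τ e) = e) (σ : Equiv.Perm (Fin 3))
    (φ : Fin 3 → Module.Dual k E ⊗[k] Module.Dual k E) (r : Fin 3 → E ⊗[k] E) :
    quadPair (permAct (-τ.dualMap) σ φ) (permAct τ σ r) =
      ((Equiv.Perm.sign σ : ℤ) : k) * quadPair φ r := by
  have h2 : ∀ (x : Module.Dual k E ⊗[k] Module.Dual k E) (y : E ⊗[k] E),
      TensorProduct.dualDistrib k E E (LinearMap.lTensor _ (-τ.dualMap) x)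
        (LinearMap.lTensor E τ y) = - TensorProduct.dualDistrib k E E x y := by
    intro x y
    induction x using TensorProduct.induction_on with
    | zero => simp
    | add x x' hx hx' => simp only [map_add, LinearMap.add_apply, hx, hx', neg_add]
    | tmul f g =>
      induction y using TensorProduct.induction_on with
      | zero => simp
      | add x x' hx hx' => simp only [map_add, hx, hx', neg_add]
      | tmul a b =>
        simp only [LinearMap.lTensor_tmul, TensorProduct.dualDistrib_apply, LinearMap.neg_apply,
          LinearMap.dualMap_apply, hτ, mul_neg]
  unfold quadPair
  rw [← Equiv.sum_comp σ, Finset.mul_sum]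
  refine Finset.sum_congr rfl fun i _ => ?_
  rcases Int.units_eq_one_or (Equiv.Perm.sign σ) with h | h
  · simp [permAct, h]
  · simpa [permAct, h] using h2 (φ i) (r i)

namespace QuadData

/-- The Koszul dual data: `E^∨ = E* ⊗ sgn` and the orthogonal complement of `R`. -/
@[reducible]
def dual (D : QuadData k) : QuadData k where
  E := Module.Dual k D.E
  swap := -D.swap.dualMap
  swap_swap φ := by
    ext e
    simp [D.swap_swap]
  rel :=
    { carrier := {φ | ∀ r ∈ D.rel, quadPair φ r = 0}
      zero_mem' := fun r _ => by simp [quadPair]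
      add_mem' := fun {φ ψ} hφ hψ r hr => by
        have h1 := hφ r hr
        have h2 := hψ r hr
        unfold quadPair at *
        simp [Finset.sum_add_distrib, h1, h2]
      smul_mem' := fun c φ hφ r hr => by
        have h1 := hφ r hr
        unfold quadPair at *
        simp [← Finset.mul_sum, h1] }
  rel_stable σ φ hφ r hr := by
    have h : permAct D.swap σ (permAct D.swap σ⁻¹ r) = r := by
      rw [permAct_permAct _ D.swap_swap]
      funext i
      simp [permAct]
    rw [← h, quadPair_permAct _ D.swap_swap, hφ _ (D.rel_stable _ _ hr), mul_zero]

/-- The value of `α ⊗ β ↦ α(β(x, y), z)` for a family `m` of bilinear operations. -/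
def quadEval {E A : Type u} [AddCommGroup E] [Module k E] [AddCommGroup A] [Module k A]
    (m : E →ₗ[k] A →ₗ[k] A →ₗ[k] A) (x y z : A) : E ⊗[k] E →ₗ[k] A :=
  TensorProduct.lift (LinearMap.mk₂ k (fun α β => m α (m β x y) z)
    (by simp) (by simp) (by simp) (by simp))

/-- The algebras over the quadratic operad with data `D`: the operations depend linearly and
equivariantly on the elements of `E`, and all relations hold. -/
def algebras (D : QuadData k) : Set (OpAlg k D.E) :=
  {A | ∃ m : D.E →ₗ[k] A.carrier →ₗ[k] A.carrier →ₗ[k] A.carrier,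
    (∀ e, A.op e = m e) ∧ (∀ e x y, m (D.swap e) x y = m e y x) ∧
    ∀ r ∈ D.rel, ∀ x : Fin 3 → A.carrier,
      ∑ i : Fin 3, quadEval m (x (i + 1)) (x (i + 2)) (x i) (r i) = 0}

/-- The binary quadratic operad `P(E, R)`. -/
def operad (D : QuadData k) : SymmOperad k := operadOf D.algebras

end QuadData

end Quadratic

/-! ### The operad of Gelfand–Dorfman algebras and its Koszul dual -/

section GD

variable (k : Type u) [Field k]

/-- `GD(2)` has the basis `μ = [x₀, x₁]`, `ν = x₀ ∘ x₁`, `ν' = x₁ ∘ x₀`; here a vector `e` stands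
for `e 0 • μ + e 1 • ν + e 2 • ν'`. -/
abbrev GDGens : Type u := Fin 3 → k

/-- The permutation action: `μ ↦ -μ`, `ν ↔ ν'`. -/
def gdSwap : GDGens k →ₗ[k] GDGens k :=
  LinearMap.pi ![-LinearMap.proj 0, LinearMap.proj 2, LinearMap.proj 1]

/-- The defining relations of degree 3 of GD-algebras in `a = x₀`, `b = x₁`, `c = x₂`. Note that
`a ∘ (b ∘ c) = ν'(ν(b, c), a)` and `[a, b ∘ c] = -μ(ν(b, c), a)`. -/
def gdRelations : Set (Fin 3 → GDGens k ⊗[k] GDGens k) :=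
  let μ : GDGens k := Pi.single 0 1
  let ν : GDGens k := Pi.single 1 1
  let ν' : GDGens k := Pi.single 2 1
  -- `M σ α β = α(β(x_{σ 0}, x_{σ 1}), x_{σ 2})`
  let M := quadMono (gdSwap k)
  let abc : Equiv.Perm (Fin 3) := 1
  let bac : Equiv.Perm (Fin 3) := Equiv.swap 0 1
  let acb : Equiv.Perm (Fin 3) := Equiv.swap 1 2
  let bca : Equiv.Perm (Fin 3) := finRotate 3
  let cab : Equiv.Perm (Fin 3) := (finRotate 3)⁻¹
  { -- `(a ∘ b) ∘ c - a ∘ (b ∘ c) = (b ∘ a) ∘ c - b ∘ (a ∘ c)`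
    M abc ν ν - M bca ν' ν - (M bac ν ν - M acb ν' ν),
    -- `(a ∘ b) ∘ c = (a ∘ c) ∘ b`
    M abc ν ν - M acb ν ν,
    -- `[[a, b], c] + [[b, c], a] + [[c, a], b] = 0`
    M abc μ μ + M bca μ μ + M cab μ μ,
    -- `[a, b ∘ c] - [c, b ∘ a] + [b, a] ∘ c - [b, c] ∘ a - b ∘ [a, c] = 0`
    -(M bca μ ν) + M bac μ ν + M bac ν μ - M bca ν μ - M acb ν' μ }

theorem gdSwap_gdSwap (e : GDGens k) : gdSwap k (gdSwap k e) = e := by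
  funext i
  fin_cases i <;> simp [gdSwap]

/-- The quadratic data of the operad `GD`; the relations span an `S₃`-submodule. -/
@[reducible]
def gdData : QuadData k where
  E := GDGens k
  swap := gdSwap k
  swap_swap := gdSwap_gdSwap k
  rel := Submodule.span k {r | ∃ σ, ∃ g ∈ gdRelations k, r = permAct (gdSwap k) σ g}
  rel_stable σ r hr := by
    induction hr using Submodule.span_induction with
    | mem r h =>
      obtain ⟨ρ, g, hg, rfl⟩ := h
      rw [permAct_permAct _ (gdSwap_gdSwap k)]
      exact Submodule.subset_span ⟨σ * ρ, g, hg, rfl⟩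
    | zero => rw [map_zero]; exact Submodule.zero_mem _
    | add x y _ _ hx hy => rw [map_add]; exact Submodule.add_mem _ hx hy
    | smul c x _ hx => rw [map_smul]; exact Submodule.smul_mem _ c hx

/-- The Koszul dual operad `GD^!`. -/
def gdDual : SymmOperad k := (gdData k).dual.operad

/-- The operation `x₀ ∗ x₁ = μ^∨`, dual to the bracket. -/
def gdDualAst : (gdDual k).obj (Fin 2) :=
  operadOf.gen (gdData k).dual.algebras (LinearMap.proj 0 : Module.Dual k (GDGens k))

/-- The operation `x₀ ⋆ x₁ = ν^∨`, dual to the Novikov product. -/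
def gdDualStar : (gdDual k).obj (Fin 2) :=
  operadOf.gen (gdData k).dual.algebras (LinearMap.proj 1 : Module.Dual k (GDGens k))

end GD

/-! ### Varieties of algebras, derivations, generalized derived identities -/

section Derived

variable {k : Type u} [Field k]

/-- The variety of algebras with one bilinear multiplication defined by a set `I` of multilinear
identities. -/
def variety (I : ∀ n : ℕ, Set (MPoly k PUnit.{u + 1} (Fin n))) : Set (OpAlg k PUnit.{u + 1}) :=
  {A | ∀ n, ∀ f ∈ I n, A.Holds f}

/-- Derivations of a non-associative algebra. -/
def IsDerivation (A : OpAlg k PUnit.{u + 1}) (d : A.carrier →ₗ[k] A.carrier) : Prop :=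
  ∀ x y, d (A.op PUnit.unit x y) = A.op PUnit.unit (d x) y + A.op PUnit.unit x (d y)

/-- Names of the operations `≻`, `≺` and `·`. -/
inductive DOp : Type u
  | succ
  | prec
  | dot

/-- The system `A^{(d*)}` : `x ≻ y = d(x) y`, `x ≺ y = x d(y)`, and the initial product. -/
def derivedAlg (A : OpAlg k PUnit.{u + 1}) (d : A.carrier →ₗ[k] A.carrier) : OpAlg k DOp.{u} where
  carrier := A.carrier
  op
    | .succ => (A.op PUnit.unit).comp d
    | .prec => (A.op PUnit.unit).compl₂ d
    | .dot => A.op PUnit.unit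

/-- The class of all systems `A^{(d*)}` with `A` in the variety and `d` a derivation of `A`. -/
def derivedClass (I : ∀ n : ℕ, Set (MPoly k PUnit.{u + 1} (Fin n))) : Set (OpAlg k DOp.{u}) :=
  {B | ∃ A ∈ variety I, ∃ d, IsDerivation A d ∧ B = derivedAlg A d}

/-- Multilinear generalized derived identities of the variety. -/
def IsGeneralizedDerivedIdentity (I : ∀ n : ℕ, Set (MPoly k PUnit.{u + 1} (Fin n))) {n : ℕ}
    (f : MPoly k DOp.{u} (Fin n)) : Prop :=
  ∀ A ∈ variety I, ∀ d, IsDerivation A d → (derivedAlg A d).Holds f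

/-- The operad `D*Var` of multilinear polynomials in `≻`, `≺`, `·` modulo the generalized derived
identities of `Var`. -/
def dStar (I : ∀ n : ℕ, Set (MPoly k PUnit.{u + 1} (Fin n))) : SymmOperad k :=
  operadOf (derivedClass I)

/-- The Manin white product `Var ∘ GD^!`. -/
def whiteGD (I : ∀ n : ℕ, Set (MPoly k PUnit.{u + 1} (Fin n))) : SymmOperad k :=
  (operadOf (variety I)).white (gdDual k)

/-- The operations of `Var ∘ GD^!`: `x₀ ≻ x₁ = x₀x₁ ⊗ x₀ ⋆ x₁`, `x₀ ≺ x₁ = x₀x₁ ⊗ x₁ ⋆ x₀`,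
`x₀ · x₁ = x₀x₁ ⊗ x₀ ∗ x₁`. -/
def whiteGDOp (I : ∀ n : ℕ, Set (MPoly k PUnit.{u + 1} (Fin n))) (ω : DOp.{u}) :
    (whiteGD I).obj (Fin 2) :=
  SymmOperad.whiteGen (operadOf (variety I)) (gdDual k) (operadOf.gen (variety I) PUnit.unit) <|
    match ω with
    | .succ => gdDualStar k
    | .prec => (gdDual k).map (Equiv.swap 0 1) (gdDualStar k)
    | .dot => gdDualAst k

/-- The bilinear operation defined by a binary element of an operad on an algebra over it. -/
def OperadAlgebra.binOp {P : SymmOperad k} {A : Type u} [AddCommGroup A] [Module k A]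
    (ρ : OperadAlgebra P A) (p : P.obj (Fin 2)) : A →ₗ[k] A →ₗ[k] A :=
  LinearMap.mk₂ k (fun x y => ρ.act p ![x, y])
    (fun x x' y => by simpa using (ρ.act p).cons_add ![y] x x')
    (fun c x y => by simpa using (ρ.act p).cons_smul ![y] c x)
    (fun x y y' => by
      have h := (ρ.act p).map_update_add ![x, 0] 1 y y'
      have e : ∀ z, Function.update ![x, 0] 1 z = ![x, z] := fun z => by
        funext i; fin_cases i <;> simp
      rwa [e, e, e] at h)
    (fun c x y => by
      have h := (ρ.act p).map_update_smul ![x, 0] 1 c y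
      have e : ∀ z, Function.update ![x, 0] 1 z = ![x, z] := fun z => by
        funext i; fin_cases i <;> simp
      rwa [e, e] at h)

/-- The system with operations `≻`, `≺`, `·` defined by an algebra over `Var ∘ GD^!`. -/
def OperadAlgebra.toOpAlg {I : ∀ n : ℕ, Set (MPoly k PUnit.{u + 1} (Fin n))} {A : Type u}
    [AddCommGroup A] [Module k A] (ρ : OperadAlgebra (whiteGD I) A) : OpAlg k DOp.{u} where
  carrier := A
  op ω := ρ.binOp (whiteGDOp I ω)

/-- The variety governed by the operad `Var ∘ GD^!`. -/
def whiteVariety (I : ∀ n : ℕ, Set (MPoly k PUnit.{u + 1} (Fin n))) : Set (OpAlg k DOp.{u}) :=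
  {B | ∃ (A : Type u) (_ : AddCommGroup A) (_ : Module k A) (ρ : OperadAlgebra (whiteGD I) A),
    B = ρ.toOpAlg}

end Derived

end

end WhiteGD

/-! Both operads are quotients of the free operad on `≻`, `≺`, `·`. The map `hadamardEval` sends a
monomial to its underlying product in `Var` tensored with its image in `GD^!`. In arity two this map
is onto (`range_hadamardEval_eq_top`), so by `whiteIso` everything reduces to showing that its
kernel consists of the generalized derived identities (`hadamardEval_eq_zero_iff`).

Expanding a monomial of `A^{(d*)}` by the Leibniz rule gives its underlying product evaluated at
iterated derivatives of the variables. The orders of these derivatives are recorded by `wordPoly`, a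
polynomial in `k[S]`, so that `f` determines an element `forgetTensor I (wordPolyMap k S) f` of
`Var(S) ⊗ k[S]`. If that element vanishes, `f` is a generalized derived identity. Conversely, in `A
⊗ R`, where `R = k[w_s][X_s]` and `d X_s = w_s X_s`, the n-th derivative of `X_s` is `w_s^n X_s`.
The weights therefore spell out the element, and an identity forces it to be zero.

It remains to replace `k[S]` by `GD^!(S)`. Over a field only the kernel of the second tensor factor
matters (`forgetTensor_eq_zero`), so the point is `dualMk_eq_zero_iff`: the identities of `GD^!` are
those of `d(x) y`, `x d(y)`, `x y` on commutative differential algebras. Commutative differential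
algebras are `GD^!`-algebras (`gdDualAlg_mem`), and the Euler derivation above gives one inclusion.

For the other inclusion, an arbitrary `GD^!`-algebra `B` is reached from a commutative differential
algebra. The multiplication operators of `B` generate a commutative algebra `Λ`. Symmetric
`Λ`-valued functions on words in `B` form a commutative algebra under convolution, the hull, and it
carries a derivation (`der_mul`). Over the hull, take polynomials in variables `X b` with `d (X b) =
L b`, where `L b` is the operator `b ⋆ -`. The map `lam` sends `g X_{b₀} ⋯ X_{bₙ}` to `g(b₁, …, bₙ)
b₀`. On balanced elements (coefficients of degree one less than the number of variables) it turns
`d(p) q` and `t p q` into `⋆` and `∗` of `B` (`lam_der_mul`, `lam_ast_mul`), where `t = ast` has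
degree one and `d t = 0`. The factors `t` come out as a power whose exponent is fixed by the degree,
so the value of a monomial is a linear function of its word polynomial. -/

namespace WhiteGD

noncomputable section

/-! ### Changing operations in monomials, and operadic induction on multilinear monomials. -/

namespace NATree

variable {Ω Ω' : Type u} {S T : Type}

/-- Change of operations: `ω(l, r)` is replaced by `ω'(l, r)` or `ω'(r, l)`, depending on the
Boolean mark. -/
def translate (f : Ω → Ω' × Bool) : NATree Ω S → NATree Ω' S
  | var x => var x
  | op ω l r =>
    match (f ω).2 with
    | false => op (f ω).1 (l.translate f) (r.translate f)
    | true => op (f ω).1 (r.translate f) (l.translate f)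

theorem translate_op_false {f : Ω → Ω' × Bool} {ω : Ω} (h : (f ω).2 = false) (l r : NATree Ω S) :
    (op ω l r).translate f = op (f ω).1 (l.translate f) (r.translate f) := by
  simp [translate, h]

theorem translate_op_true {f : Ω → Ω' × Bool} {ω : Ω} (h : (f ω).2 = true) (l r : NATree Ω S) :
    (op ω l r).translate f = op (f ω).1 (r.translate f) (l.translate f) := by
  simp [translate, h]

theorem translate_bind (f : Ω → Ω' × Bool) (g : S → NATree Ω T) (t : NATree Ω S) :
    (t.bind g).translate f = (t.translate f).bind fun x => (g x).translate f := by
  induction t with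
  | var x => rfl
  | op ω l r hl hr =>
    cases h : (f ω).2
    · rw [bind, translate_op_false h, translate_op_false h, bind, hl, hr]
    · rw [bind, translate_op_true h, translate_op_true h, bind, hl, hr]

theorem translate_rename (f : Ω → Ω' × Bool) (e : S → T) (t : NATree Ω S) :
    (t.rename e).translate f = (t.translate f).rename e :=
  translate_bind f _ t

theorem occ_translate (f : Ω → Ω' × Bool) (s : S) (t : NATree Ω S) :
    (t.translate f).occ s = t.occ s := by
  induction t with
  | var x => rfl
  | op ω l r hl hr =>
    cases h : (f ω).2
    · rw [translate_op_false h, occ, occ, hl, hr]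
    · rw [translate_op_true h, occ, occ, hl, hr, add_comm]

theorem translate_subst (f : Ω → Ω' × Bool) (s : S) (t : NATree Ω S) (q : NATree Ω T) :
    (t.subst s q).translate f = (t.translate f).subst s (q.translate f) := by
  rw [subst, subst, translate_bind]
  congr 1
  funext x
  by_cases h : x = s
  · subst h
    rw [plug_self, plug_self, translate_rename]
  · rw [plug_ne _ _ _ h, plug_ne _ _ _ h]
    rfl

/-- Allows a subtree of a multilinear monomial to be regarded as a multilinear monomial in exactly
the variables that it contains. -/
theorem exists_restrict (p : S → Prop) (t : NATree Ω S) (h : ∀ s, t.occ s ≠ 0 → p s) :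
    ∃ t' : NATree Ω {s // p s}, t'.rename Subtype.val = t := by
  induction t with
  | var x => exact ⟨var ⟨x, h x (by simp [occ])⟩, rfl⟩
  | op ω l r hl hr =>
    obtain ⟨l', hl'⟩ := hl fun s hs => h s (by rw [occ]; omega)
    obtain ⟨r', hr'⟩ := hr fun s hs => h s (by rw [occ]; omega)
    refine ⟨op ω l' r', ?_⟩
    rw [rename, bind, ← rename, ← rename, hl', hr']

theorem rename_rename {U : Type} (e : S → T) (f : T → U) (t : NATree Ω S) :
    (t.rename e).rename f = t.rename (f ∘ e) :=
  bind_bind _ _ _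

end NATree

namespace MTree

variable {Ω Ω' : Type u} {S T : Type}

/-- Change of operations in a multilinear monomial. -/
def translate (f : Ω → Ω' × Bool) (t : MTree Ω S) : MTree Ω' S :=
  ⟨t.1.translate f, fun s => by rw [NATree.occ_translate]; exact t.2 s⟩

theorem translate_rename (f : Ω → Ω' × Bool) (e : S ≃ T) (t : MTree Ω S) :
    (t.rename e).translate f = (t.translate f).rename e :=
  ext' (NATree.translate_rename f e t.1)

theorem translate_subst (f : Ω → Ω' × Bool) (s : S) (t : MTree Ω S) (q : MTree Ω T) :
    (t.subst s q).translate f = (t.translate f).subst s (q.translate f) :=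
  ext' (NATree.translate_subst f s t.1 q.1)

/-- The bijection between the leaves of `ω(l, r)` and those of the iterated partial composition. -/
theorem exists_node_equiv {p q : S → Prop} (hpq : ∀ s, ¬ (p s ∧ q s)) (hpq' : ∀ s, p s ∨ q s)
    (h : (1 : Fin 2) ≠ 0) :
    ∃ e : {x : {x : Fin 2 // x ≠ 0} ⊕ {s // p s} // x ≠ Sum.inl ⟨1, h⟩} ⊕ {s // q s} ≃ S,
      (∀ s hs, e (Sum.inl ⟨Sum.inr s, hs⟩) = s.1) ∧ ∀ s, e (Sum.inr s) = s.1 := by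
  have key : ∀ x : {x : Fin 2 // x ≠ 0}, x = ⟨1, h⟩ := by
    rintro ⟨x, hx⟩
    fin_cases x
    · exact (hx rfl).elim
    · rfl
  let g : {x : {x : Fin 2 // x ≠ 0} ⊕ {s // p s} // x ≠ Sum.inl ⟨1, h⟩} ⊕ {s // q s} → S :=
    fun x => match x with
      | .inl ⟨.inl x, hx⟩ => (hx (by rw [key x])).elim
      | .inl ⟨.inr s, _⟩ => s.1
      | .inr s => s.1
  refine ⟨Equiv.ofBijective g ⟨?_, ?_⟩, fun _ _ => rfl, fun _ => rfl⟩
  · rintro (⟨x | s, hx⟩ | s) (⟨y | t, hy⟩ | t) hst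
    · exact (hx (by rw [key x])).elim
    · exact (hx (by rw [key x])).elim
    · exact (hx (by rw [key x])).elim
    · exact (hy (by rw [key y])).elim
    · obtain rfl : s = t := Subtype.ext hst
      rfl
    · exact (hpq t.1 ⟨(show s.1 = t.1 from hst) ▸ s.2, t.2⟩).elim
    · exact (hy (by rw [key y])).elim
    · exact (hpq t.1 ⟨t.2, (show s.1 = t.1 from hst) ▸ s.2⟩).elim
    · obtain rfl : s = t := Subtype.ext hst
      rfl
  · intro s
    rcases hpq' s with hs | hs
    · exact ⟨.inl ⟨.inr ⟨s, hs⟩, by simp⟩, rfl⟩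
    · exact ⟨.inr ⟨s, hs⟩, rfl⟩

/-- Multilinear monomials are generated by the binary ones under the operations of an operad. -/
theorem induction_on {P : ∀ (S : Type) [Finite S], MTree Ω S → Prop}
    (hrename : ∀ (S T : Type) [Finite S] [Finite T] (e : S ≃ T) (t : MTree Ω S),
      P S t → P T (t.rename e))
    (hunit : P Unit unit) (hbin : ∀ ω, P (Fin 2) (bin ω))
    (hsubst : ∀ (S T : Type) [Finite S] [Finite T] (s : S) (t : MTree Ω S) (q : MTree Ω T),
      P S t → P T q → P _ (t.subst s q))
    (S : Type) [Finite S] (t : MTree Ω S) : P S t := by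
  -- Subtrees are not multilinear over `S`, so the recursion runs on a plain tree `v`, and `t`
  -- ranges over all multilinear monomials that become `v` after an injective renaming.
  have key : ∀ (V : Type) (v : NATree Ω V) (S : Type) [Finite S] (t : MTree Ω S) (e : S → V),
      Function.Injective e → t.1.rename e = v → P S t := by
    intro V v
    induction v with
    | var x =>
      rintro S _ ⟨t, ht⟩ e he h
      cases t with
      | op ω l r => simp [NATree.rename, NATree.bind] at h
      | var s =>
        have hs : ∀ y, s = y := fun y => by simpa [NATree.occ] using ht y
        let e' : Unit ≃ S := ⟨fun _ => s, fun _ => (), fun _ => rfl, hs⟩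
        exact hrename _ _ e' unit hunit
    | op ω l r hl hr =>
      rintro S _ ⟨t, ht⟩ e he h
      cases t with
      | var s => simp [NATree.rename, NATree.bind] at h
      | op ω' l' r' =>
        obtain ⟨rfl, h1, h2⟩ : ω' = ω ∧ l'.rename e = l ∧ r'.rename e = r := by
          simpa [NATree.rename, NATree.bind] using h
        have hlr : ∀ s, l'.occ s + r'.occ s = 1 := ht
        obtain ⟨l1, hl1⟩ := l'.exists_restrict (fun s => l'.occ s = 1) fun s hs => by
          have := hlr s; omega
        obtain ⟨r1, hr1⟩ := r'.exists_restrict (fun s => r'.occ s = 1) fun s hs => by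
          have := hlr s; omega
        let L : MTree Ω {s // l'.occ s = 1} := ⟨l1, fun s => by
          rw [← NATree.occ_rename Subtype.val Subtype.val_injective, hl1]; exact s.2⟩
        let R : MTree Ω {s // r'.occ s = 1} := ⟨r1, fun s => by
          rw [← NATree.occ_rename Subtype.val Subtype.val_injective, hr1]; exact s.2⟩
        have hL : P _ L := hl _ L (e ∘ Subtype.val) (he.comp Subtype.val_injective) (by
          rw [← NATree.rename_rename, hl1, h1])
        have hR : P _ R := hr _ R (e ∘ Subtype.val) (he.comp Subtype.val_injective) (by
          rw [← NATree.rename_rename, hr1, h2])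
        -- The monomial `ω(l', r')` is rebuilt as `(ω ∘₀ L) ∘₁ R`, up to the relabelling `ε`.
        obtain ⟨ε, hε1, hε2⟩ := exists_node_equiv (p := fun s => l'.occ s = 1)
          (q := fun s => r'.occ s = 1) (fun s hs => by have := hlr s; omega)
          (fun s => by have := hlr s; omega) one_ne_zero
        have hP := hrename _ _ ε _ (hsubst _ _ (Sum.inl ⟨1, one_ne_zero⟩) _ _
          (hsubst _ _ 0 _ _ (hbin ω') hL) hR)
        refine (congrArg (P S) (ext' ?_)).mpr hP
        change NATree.op ω' l' r' = _
        simp only [rename, subst, NATree.subst, bin, NATree.bind, NATree.rename]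
        congr 1
        · rw [NATree.plug_self, NATree.rename, NATree.bind_bind, NATree.bind_bind]
          refine hl1.symm.trans ?_
          change NATree.bind (fun x => .var x.1) l1 = NATree.bind _ l1
          congr 1
          funext x
          simp only [NATree.bind]
          rw [NATree.plug_ne _ _ _ (by simp)]
          simp only [NATree.bind]
          rw [hε1]
        · rw [NATree.plug_ne _ _ _ one_ne_zero, NATree.bind, NATree.plug_self, NATree.rename,
            NATree.bind_bind]
          refine hr1.symm.trans ?_
          change NATree.bind (fun x => .var x.1) r1 = NATree.bind _ r1
          congr 1
          funext x
          simp only [NATree.bind]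
          rw [hε2]
  exact key S t.1 S t id Function.injective_id (NATree.bind_var t.1)

end MTree

namespace OpAlg

variable {k : Type u} [Field k] {Ω Ω' : Type u}

/-- Restriction of operations along a change of operations. -/
@[reducible]
def pull (f : Ω → Ω' × Bool) (A : OpAlg k Ω') : OpAlg k Ω where
  carrier := A.carrier
  op ω := match (f ω).2 with
    | false => A.op (f ω).1
    | true => (A.op (f ω).1).flip

theorem evalTree_pull (f : Ω → Ω' × Bool) (A : OpAlg k Ω') {S : Type} (a : S → A.carrier)
    (t : NATree Ω S) : (A.pull f).evalTree a t = A.evalTree a (t.translate f) := by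
  induction t with
  | var x => rfl
  | op ω l r hl hr =>
    cases h : (f ω).2
    · rw [NATree.translate_op_false h, evalTree, evalTree, ← hl, ← hr]
      simp [pull, h]
    · rw [NATree.translate_op_true h, evalTree, evalTree, ← hl, ← hr]
      simp [pull, h]

end OpAlg

end

end WhiteGD

namespace WhiteGD

noncomputable section

/-! ### The operad of a class of algebras and the algebras over it. -/

section OperadOfClass

variable {k : Type u} [Field k] {Ω : Type u}

/-- The class of a multilinear polynomial in the operad of a class of algebras. -/
def operadOf.mk (C : Set (OpAlg k Ω)) (S : Type) [Finite S] :
    MPoly k Ω S →ₗ[k] (operadOf C).obj S :=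
  (identities C S).mkQ

namespace operadOf

variable (C : Set (OpAlg k Ω))

theorem mk_surjective (S : Type) [Finite S] : Function.Surjective (mk C S) :=
  Submodule.mkQ_surjective _

theorem mk_eq_zero_iff {S : Type} [Finite S] {f : MPoly k Ω S} :
    mk C S f = 0 ↔ f ∈ identities C S :=
  Submodule.Quotient.mk_eq_zero _

theorem map_mk {S T : Type} [Finite S] [Finite T] (e : S ≃ T) (f : MPoly k Ω S) :
    (operadOf C).map e (mk C S f) = mk C T (Finsupp.lmapDomain k k (MTree.rename e) f) :=
  rfl

theorem comp_mk {S T : Type} [Finite S] [Finite T] (s : S) (f : MPoly k Ω S) (g : MPoly k Ω T) :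
    (operadOf C).comp s (mk C S f) (mk C T g) = mk C _ (MPoly.comp k Ω s f g) :=
  rfl

theorem one_eq_mk : (operadOf C).one = mk C Unit (Finsupp.single MTree.unit 1) := rfl

theorem gen_eq_mk (ω : Ω) : gen C ω = mk C (Fin 2) (Finsupp.single (MTree.bin ω) 1) := rfl

end operadOf

/-- The multilinear map defined by a multilinear monomial. -/
def OpAlg.treeMap (A : OpAlg k Ω) {S : Type} (t : MTree Ω S) :
    MultilinearMap k (fun _ : S => A.carrier) A.carrier where
  toFun a := A.evalTree a t.1
  map_update_add' a s x y := by
    obtain ⟨L, hL⟩ := A.exists_linear s t.1 (by convert t.2 s) a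
    have h : ∀ z, A.evalTree (Function.update a s z) t.1 = L z := fun z => by
      rw [hL _ fun x hx => Function.update_of_ne hx _ _, Function.update_self]
    rw [h, h, h, map_add]
  map_update_smul' a s c x := by
    obtain ⟨L, hL⟩ := A.exists_linear s t.1 (by convert t.2 s) a
    have h : ∀ z, A.evalTree (Function.update a s z) t.1 = L z := fun z => by
      rw [hL _ fun x hx => Function.update_of_ne hx _ _, Function.update_self]
    rw [h, h, map_smul]

/-- The multilinear map defined by a multilinear polynomial. -/
def OpAlg.polyMap (A : OpAlg k Ω) (S : Type) :
    MPoly k Ω S →ₗ[k] MultilinearMap k (fun _ : S => A.carrier) A.carrier :=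
  Finsupp.linearCombination k A.treeMap

theorem OpAlg.polyMap_apply (A : OpAlg k Ω) {S : Type} (f : MPoly k Ω S) (a : S → A.carrier) :
    A.polyMap S f a = A.eval a f := by
  induction f using Finsupp.induction_linear with
  | zero => simp
  | add x y hx hy => simp only [map_add, _root_.add_apply, hx, hy]
  | single t c => simp [polyMap, treeMap]

/-- Algebras of a class are algebras over its operad. -/
def OpAlg.toOperadAlgebra {C : Set (OpAlg k Ω)} (A : OpAlg k Ω) (hA : A ∈ C) :
    OperadAlgebra (operadOf C) A.carrier where
  act {S} _ := (identities C S).liftQ (A.polyMap S) fun f hf => by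
    ext a
    rw [A.polyMap_apply]
    exact hf A hA a
  act_map {S T} _ _ e p a := by
    obtain ⟨f, rfl⟩ := operadOf.mk_surjective C S p
    rw [operadOf.map_mk]
    change A.polyMap T _ a = A.polyMap S f _
    rw [A.polyMap_apply, A.polyMap_apply, A.eval_map]
    rfl
  act_one a := by
    rw [operadOf.one_eq_mk]
    change A.polyMap Unit _ a = _
    rw [A.polyMap_apply, A.eval_single, one_smul]
    rfl
  act_comp {S T} _ _ s p q a := by
    obtain ⟨f, rfl⟩ := operadOf.mk_surjective C S p
    obtain ⟨g, rfl⟩ := operadOf.mk_surjective C T q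
    classical
    rw [operadOf.comp_mk]
    change A.polyMap _ _ a = A.polyMap _ _ fun x => if h : x = s then A.polyMap _ _ _ else _
    simp only [A.polyMap_apply, A.eval_comp]

theorem OpAlg.toOperadAlgebra_act_mk {C : Set (OpAlg k Ω)} (A : OpAlg k Ω) (hA : A ∈ C)
    {S : Type} [Finite S] (f : MPoly k Ω S) (a : S → A.carrier) :
    (A.toOperadAlgebra hA).act (operadOf.mk C S f) a = A.eval a f :=
  A.polyMap_apply f a

/-- The value of a polynomial on the system of operations given by an algebra over the operad
of a class. -/
theorem OperadAlgebra.eval_eq_act {C : Set (OpAlg k Ω)} {A : Type u} [AddCommGroup A] [Module k A]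
    (ρ : OperadAlgebra (operadOf C) A) {S : Type} [Finite S] (f : MPoly k Ω S) (a : S → A) :
    OpAlg.eval ⟨A, fun ω => ρ.binOp (operadOf.gen C ω)⟩ a f = ρ.act (operadOf.mk C S f) a := by
  classical
  let B : OpAlg k Ω := ⟨A, fun ω => ρ.binOp (operadOf.gen C ω)⟩
  -- Both sides are compatible with renaming, unit and partial composition, and they agree on the
  -- binary generators, so operadic induction applies.
  have key : ∀ (t : MTree Ω S) (a : S → A),
      B.evalTree a t.1 = ρ.act (operadOf.mk C S (Finsupp.single t 1)) a := by
    refine MTree.induction_on (P := fun S _ t => ∀ a : S → A,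
      B.evalTree a t.1 = ρ.act (operadOf.mk C S (Finsupp.single t 1)) a) ?_ ?_ ?_ ?_ S
    · intro S T _ _ e t ih a
      have h := B.eval_map e (Finsupp.single t 1) a
      rw [Finsupp.lmapDomain_apply, Finsupp.mapDomain_single, OpAlg.eval_single,
        OpAlg.eval_single, one_smul, one_smul, ih] at h
      rw [h]
      have h2 := ρ.act_map e (operadOf.mk C S (Finsupp.single t 1)) a
      rw [operadOf.map_mk, Finsupp.lmapDomain_apply, Finsupp.mapDomain_single] at h2
      exact h2.symm
    · intro a
      exact (ρ.act_one a).symm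
    · intro ω a
      have h : a = ![a 0, a 1] := by funext i; fin_cases i <;> rfl
      conv_rhs => rw [h]
      rfl
    · intro S T _ _ s t q iht ihq a
      have h := B.eval_comp s (Finsupp.single t 1) (Finsupp.single q 1) a
      rw [MPoly.comp_single, OpAlg.eval_single, OpAlg.eval_single, OpAlg.eval_single, mul_one,
        one_smul, one_smul, one_smul, iht, ihq] at h
      rw [h]
      have h2 := ρ.act_comp s (operadOf.mk C S (Finsupp.single t 1))
        (operadOf.mk C T (Finsupp.single q 1)) a
      rw [operadOf.comp_mk, MPoly.comp_single, mul_one] at h2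
      refine Eq.trans ?_ h2.symm
      congr! 3
  induction f using Finsupp.induction_linear with
  | zero => simp
  | add x y hx hy => simp only [map_add, _root_.add_apply, hx, hy]
  | single t c =>
    rw [OpAlg.eval_single]
    have h : Finsupp.single t c = c • Finsupp.single t (1 : k) := by simp
    rw [h, map_smul, map_smul, _root_.smul_apply]
    exact congrArg (c • ·) (key t a)

end OperadOfClass

/-! ### Transport of algebras along isomorphisms of operads. -/

section Iso

variable {k : Type u} [Field k]

/-- The inverse isomorphism. -/
def OperadIso.symm {P Q : SymmOperad k} (e : OperadIso P Q) : OperadIso Q P where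
  equiv S _ := (e.equiv S).symm
  map' {S T} _ _ f p := by
    rw [LinearEquiv.symm_apply_eq, e.map', LinearEquiv.apply_symm_apply]
  one' := by rw [LinearEquiv.symm_apply_eq, e.one']
  comp' s p q := by
    rw [LinearEquiv.symm_apply_eq, e.comp', LinearEquiv.apply_symm_apply,
      LinearEquiv.apply_symm_apply]

/-- Restriction of an algebra along an isomorphism of operads. -/
def OperadAlgebra.pull {P Q : SymmOperad k} (e : OperadIso P Q) {A : Type u} [AddCommGroup A]
    [Module k A] (ρ : OperadAlgebra Q A) : OperadAlgebra P A where
  act {S} _ := ρ.act ∘ₗ (e.equiv S).toLinearMap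
  act_map f p a := by
    simp only [LinearMap.comp_apply, LinearEquiv.coe_coe, e.map', ρ.act_map]
  act_one a := by
    simp only [LinearMap.comp_apply, LinearEquiv.coe_coe, e.one', ρ.act_one]
  act_comp s p q a := by
    simp only [LinearMap.comp_apply, LinearEquiv.coe_coe, e.comp', ρ.act_comp]

theorem OperadAlgebra.binOp_pull {P Q : SymmOperad k} (e : OperadIso P Q) {A : Type u}
    [AddCommGroup A] [Module k A] (ρ : OperadAlgebra Q A) (p : P.obj (Fin 2)) :
    (ρ.pull e).binOp p = ρ.binOp (e.equiv (Fin 2) p) :=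
  rfl

end Iso

/-! ### The white product as an image of a free operad. -/

section White

variable {k : Type u} [Field k] {Ω Ω₁ Ω₂ : Type u}
  (f : Ω → Ω₁ × Bool) (g : Ω → Ω₂ × Bool) (C₁ : Set (OpAlg k Ω₁)) (C₂ : Set (OpAlg k Ω₂))

/-- Pure tensors in a Hadamard product. -/
def SymmOperad.hadamardTmul {P Q : SymmOperad k} {S : Type} [Finite S] (p : P.obj S)
    (q : Q.obj S) : (P.hadamard Q).obj S :=
  p ⊗ₜ[k] q

theorem SymmOperad.hadamard_map_tmul {P Q : SymmOperad k} {S T : Type} [Finite S] [Finite T]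
    (e : S ≃ T) (p : P.obj S) (q : Q.obj S) :
    (P.hadamard Q).map e (hadamardTmul p q) = hadamardTmul (P.map e p) (Q.map e q) :=
  rfl

theorem SymmOperad.hadamard_comp_tmul {P Q : SymmOperad k} {S T : Type} [Finite S] [Finite T]
    (s : S) (p : P.obj S) (q : Q.obj S) (p' : P.obj T) (q' : Q.obj T) :
    (P.hadamard Q).comp s (hadamardTmul p q) (hadamardTmul p' q') =
      hadamardTmul (P.comp s p p') (Q.comp s q q') :=
  rfl

/-- The morphism from the free operad to a Hadamard product of operads of classes of algebras
which is defined by changes of operations on both factors. -/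
def hadamardEval (S : Type) [Finite S] :
    MPoly k Ω S →ₗ[k] ((operadOf C₁).hadamard (operadOf C₂)).obj S :=
  Finsupp.linearCombination k fun t => SymmOperad.hadamardTmul
    (operadOf.mk C₁ S (Finsupp.single (t.translate f) 1))
    (operadOf.mk C₂ S (Finsupp.single (t.translate g) 1))

theorem hadamardEval_single {S : Type} [Finite S] (t : MTree Ω S) (c : k) :
    hadamardEval f g C₁ C₂ S (Finsupp.single t c) =
      c • SymmOperad.hadamardTmul (operadOf.mk C₁ S (Finsupp.single (t.translate f) 1))
        (operadOf.mk C₂ S (Finsupp.single (t.translate g) 1)) :=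
  Finsupp.linearCombination_single ..

theorem hadamardEval_map {S T : Type} [Finite S] [Finite T] (e : S ≃ T) (p : MPoly k Ω S) :
    hadamardEval f g C₁ C₂ T (Finsupp.lmapDomain k k (MTree.rename e) p) =
      ((operadOf C₁).hadamard (operadOf C₂)).map e (hadamardEval f g C₁ C₂ S p) := by
  induction p using Finsupp.induction_linear with
  | zero => simp only [map_zero]
  | add x y hx hy => simp only [map_add, hx, hy]
  | single t c =>
    rw [Finsupp.lmapDomain_apply, Finsupp.mapDomain_single, hadamardEval_single,
      hadamardEval_single, LinearMap.map_smul, SymmOperad.hadamard_map_tmul, operadOf.map_mk,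
      operadOf.map_mk, Finsupp.lmapDomain_apply, Finsupp.mapDomain_single,
      Finsupp.lmapDomain_apply, Finsupp.mapDomain_single, MTree.translate_rename,
      MTree.translate_rename]

theorem hadamardEval_one :
    hadamardEval f g C₁ C₂ Unit (Finsupp.single MTree.unit 1) =
      ((operadOf C₁).hadamard (operadOf C₂)).one := by
  rw [hadamardEval_single, one_smul]
  rfl

theorem hadamardEval_comp {S T : Type} [Finite S] [Finite T] (s : S) (p : MPoly k Ω S)
    (q : MPoly k Ω T) :
    hadamardEval f g C₁ C₂ _ (MPoly.comp k Ω s p q) =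
      ((operadOf C₁).hadamard (operadOf C₂)).comp s (hadamardEval f g C₁ C₂ S p)
        (hadamardEval f g C₁ C₂ T q) := by
  induction p using Finsupp.induction_linear with
  | zero => simp only [map_zero, LinearMap.zero_apply]
  | add x y hx hy => simp only [map_add, LinearMap.add_apply, hx, hy]
  | single t c =>
    induction q using Finsupp.induction_linear with
    | zero => simp only [map_zero]
    | add x y hx hy => simp only [map_add, hx, hy]
    | single t' c' =>
      rw [MPoly.comp_single, hadamardEval_single, hadamardEval_single, hadamardEval_single,
        LinearMap.map_smul, LinearMap.map_smul, LinearMap.smul_apply, SymmOperad.hadamard_comp_tmul,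
        operadOf.comp_mk, operadOf.comp_mk, MPoly.comp_single, MPoly.comp_single,
        MTree.translate_subst, MTree.translate_subst, mul_one, smul_smul, mul_comm]

variable {f g C₁ C₂}

/-- Each multilinear monomial is built from binary ones by renaming and composition, and
`hadamardEval` respects both. -/
theorem hadamardEval_mem (S : Type) [Finite S] (p : MPoly k Ω S) :
    hadamardEval f g C₁ C₂ S p ∈
      ((operadOf C₁).hadamard (operadOf C₂)).binarySub.carrier S := by
  have key : ∀ t : MTree Ω S, hadamardEval f g C₁ C₂ S (Finsupp.single t 1) ∈
      ((operadOf C₁).hadamard (operadOf C₂)).binarySub.carrier S := by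
    refine MTree.induction_on (P := fun S _ t => hadamardEval f g C₁ C₂ S (Finsupp.single t 1) ∈
      ((operadOf C₁).hadamard (operadOf C₂)).binarySub.carrier S) ?_ ?_ ?_ ?_ S
    · intro S T _ _ e t ih
      have h := hadamardEval_map f g C₁ C₂ e (Finsupp.single t 1)
      rw [Finsupp.lmapDomain_apply, Finsupp.mapDomain_single] at h
      rw [h]
      exact SymmOperad.Sub.map_mem _ e ih
    · rw [hadamardEval_one]
      exact SymmOperad.Sub.one_mem _
    · exact fun ω => SymmOperad.mem_binarySub _ _
    · intro S T _ _ s t q iht ihq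
      have h := hadamardEval_comp f g C₁ C₂ s (Finsupp.single t 1) (Finsupp.single q 1)
      rw [MPoly.comp_single, mul_one] at h
      rw [h]
      exact SymmOperad.Sub.comp_mem _ s iht ihq
  induction p using Finsupp.induction_linear with
  | zero => rw [map_zero]; exact Submodule.zero_mem _
  | add x y hx hy => rw [map_add]; exact Submodule.add_mem _ hx hy
  | single t c =>
    rw [← mul_one c, ← smul_eq_mul, ← Finsupp.smul_single, map_smul]
    exact Submodule.smul_mem _ _ (key t)

/-- The image of `hadamardEval` is a suboperad. -/
def hadamardRange (f : Ω → Ω₁ × Bool) (g : Ω → Ω₂ × Bool) (C₁ : Set (OpAlg k Ω₁))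
    (C₂ : Set (OpAlg k Ω₂)) : ((operadOf C₁).hadamard (operadOf C₂)).Sub where
  carrier S _ := LinearMap.range (hadamardEval f g C₁ C₂ S)
  map_mem e := by
    rintro _ ⟨p, rfl⟩
    exact ⟨_, hadamardEval_map f g C₁ C₂ e p⟩
  one_mem := ⟨_, hadamardEval_one f g C₁ C₂⟩
  comp_mem s := by
    rintro _ _ ⟨p, rfl⟩ ⟨q, rfl⟩
    exact ⟨_, hadamardEval_comp f g C₁ C₂ s p q⟩

/-- The range is itself a suboperad with full arity-two component, hence it contains the smallest
such suboperad. -/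
theorem exists_hadamardEval_eq (h2 : LinearMap.range (hadamardEval f g C₁ C₂ (Fin 2)) = ⊤)
    {S : Type} [Finite S] {x : ((operadOf C₁).hadamard (operadOf C₂)).obj S}
    (hx : x ∈ ((operadOf C₁).hadamard (operadOf C₂)).binarySub.carrier S) :
    ∃ p, hadamardEval f g C₁ C₂ S p = x := by
  simp only [SymmOperad.binarySub, Submodule.mem_iInf] at hx
  exact hx (hadamardRange f g C₁ C₂) h2

/-- If the binary part of a Hadamard product is spanned by the images of the operations from `Ω`,
then its white product is the operad of every class of algebras with the identities
`ker (hadamardEval f g C₁ C₂)`. -/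
def whiteIso (D : Set (OpAlg k Ω))
    (h2 : LinearMap.range (hadamardEval f g C₁ C₂ (Fin 2)) = ⊤)
    (hker : ∀ (S : Type) [Finite S] (p : MPoly k Ω S),
      hadamardEval f g C₁ C₂ S p = 0 ↔ p ∈ identities D S) :
    OperadIso (operadOf D) ((operadOf C₁).white (operadOf C₂)) where
  equiv S _ := LinearEquiv.ofBijective
    ((identities D S).liftQ
      ((hadamardEval f g C₁ C₂ S).codRestrict _ (hadamardEval_mem S)) fun p hp => by
        rw [LinearMap.mem_ker]
        exact Subtype.ext ((hker S p).2 hp))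
    ⟨by
      rw [← LinearMap.ker_eq_bot, Submodule.ker_liftQ_eq_bot']
      ext p
      rw [← hker S p, LinearMap.mem_ker]
      exact ⟨fun h => Subtype.ext h, fun h => congrArg Subtype.val h⟩, by
      rintro ⟨x, hx⟩
      obtain ⟨p, rfl⟩ := exists_hadamardEval_eq h2 hx
      exact ⟨operadOf.mk D S p, rfl⟩⟩
  map' {S T} _ _ e p := by
    obtain ⟨p, rfl⟩ := operadOf.mk_surjective D S p
    exact Subtype.ext (hadamardEval_map f g C₁ C₂ e p)
  one' := Subtype.ext (hadamardEval_one f g C₁ C₂)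
  comp' {S T} _ _ s p q := by
    obtain ⟨p, rfl⟩ := operadOf.mk_surjective D S p
    obtain ⟨q, rfl⟩ := operadOf.mk_surjective D T q
    exact Subtype.ext (hadamardEval_comp f g C₁ C₂ s p q)

end White

end

end WhiteGD

set_option linter.unusedSimpArgs false

namespace WhiteGD

noncomputable section

/-! ### The orthogonal complement of the relations of `GD`, in coordinates. -/

section QuadPair

variable {k : Type u} [Field k] {E : Type u} [AddCommGroup E] [Module k E]

theorem quadPair_add (φ : Fin 3 → Module.Dual k E ⊗[k] Module.Dual k E) (r s : Fin 3 → E ⊗[k] E) :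
    quadPair φ (r + s) = quadPair φ r + quadPair φ s := by
  simp [quadPair, Finset.sum_add_distrib]

theorem quadPair_smul (φ : Fin 3 → Module.Dual k E ⊗[k] Module.Dual k E) (c : k)
    (r : Fin 3 → E ⊗[k] E) : quadPair φ (c • r) = c * quadPair φ r := by
  simp [quadPair, Finset.mul_sum]

theorem quadPair_neg (φ : Fin 3 → Module.Dual k E ⊗[k] Module.Dual k E) (r : Fin 3 → E ⊗[k] E) :
    quadPair φ (-r) = -quadPair φ r := by
  simp [quadPair]

theorem quadPair_sub (φ : Fin 3 → Module.Dual k E ⊗[k] Module.Dual k E) (r s : Fin 3 → E ⊗[k] E) :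
    quadPair φ (r - s) = quadPair φ r - quadPair φ s := by
  simp [quadPair]

theorem permAct_quadMono {τ : E →ₗ[k] E} (hτ : ∀ e, τ (τ e) = e) (σ ρ : Equiv.Perm (Fin 3))
    (α β : E) : permAct τ σ (quadMono τ ρ α β) = quadMono τ (σ * ρ) α β :=
  permAct_permAct τ hτ σ ρ _

/-- A permuted monomial lives in the single position `σ 2`, the index of its outer variable. An odd
`σ` reverses the cyclic order of the two inner variables, whence the twist of `β` by `τ`. -/
theorem quadPair_quadMono (φ : Fin 3 → Module.Dual k E ⊗[k] Module.Dual k E) (τ : E →ₗ[k] E)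
    (σ : Equiv.Perm (Fin 3)) (α β : E) :
    quadPair φ (quadMono τ σ α β) = TensorProduct.dualDistrib k E E (φ (σ 2))
      (α ⊗ₜ if Equiv.Perm.sign σ = 1 then β else τ β) := by
  unfold quadPair
  rw [Finset.sum_eq_single (σ 2)]
  · congr 1
    by_cases h : Equiv.Perm.sign σ = 1 <;> simp [quadMono, permAct, h]
  · intro i _ hi
    have h : (Equiv.symm σ) i ≠ 2 := fun h => hi (by rw [← h]; simp)
    have h' : quadMono τ σ α β i = 0 := by simp [quadMono, permAct, Pi.single_eq_of_ne h]
    rw [h', map_zero]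
  · simp

end QuadPair

section GDPair

variable {k : Type u} [Field k]

/-- The coordinates of an element of `E* ⊗ E*`. -/
def gdCoord (ψ : Module.Dual k (GDGens k) ⊗[k] Module.Dual k (GDGens k)) (a b : Fin 3) : k :=
  TensorProduct.dualDistrib k _ _ ψ (Pi.single a 1 ⊗ₜ Pi.single b 1)

/-- The dual basis of `GD(2)`. -/
abbrev gdProj (k : Type u) [Field k] (a : Fin 3) : Module.Dual k (GDGens k) := LinearMap.proj a

theorem gdSwap_zero : gdSwap k (Pi.single 0 1) = -Pi.single 0 1 := by
  funext i; fin_cases i <;> simp [gdSwap]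

theorem gdSwap_one : gdSwap k (Pi.single 1 1) = Pi.single 2 1 := by
  funext i; fin_cases i <;> simp [gdSwap]

theorem gdSwap_two : gdSwap k (Pi.single 2 1) = Pi.single 1 1 := by
  funext i; fin_cases i <;> simp [gdSwap]

theorem dual_swap_zero : (gdData k).dual.swap (gdProj k 0) = gdProj k 0 := by
  ext i; fin_cases i <;> simp [gdProj, gdSwap]

theorem dual_swap_one : (gdData k).dual.swap (gdProj k 1) = -gdProj k 2 := by
  ext i; fin_cases i <;> simp [gdProj, gdSwap]

theorem dual_eq_sum (f : Module.Dual k (GDGens k)) :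
    f = ∑ a, f (Pi.single a 1) • gdProj k a := by
  ext i
  fin_cases i <;> simp [gdProj, Fin.sum_univ_three]

theorem quadEval_eq_sum {A : Type u} [AddCommGroup A] [Module k A]
    (m : Module.Dual k (GDGens k) →ₗ[k] A →ₗ[k] A →ₗ[k] A) (x y z : A)
    (ψ : Module.Dual k (GDGens k) ⊗[k] Module.Dual k (GDGens k)) :
    QuadData.quadEval m x y z ψ =
      ∑ a, ∑ b, gdCoord ψ a b • m (gdProj k a) (m (gdProj k b) x y) z := by
  induction ψ using TensorProduct.induction_on with
  | zero => simp [gdCoord]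
  | add p q hp hq => simp only [map_add, hp, hq, gdCoord, LinearMap.add_apply, add_smul,
      Finset.sum_add_distrib]
  | tmul f g =>
    have h : QuadData.quadEval m x y z (f ⊗ₜ[k] g) = m f (m g x y) z := by
      simp [QuadData.quadEval]
    rw [h]
    conv_lhs => rw [dual_eq_sum f, dual_eq_sum g]
    simp only [map_sum, map_smul, LinearMap.sum_apply, LinearMap.smul_apply, Finset.smul_sum,
      gdCoord, TensorProduct.dualDistrib_apply, mul_smul]
    rw [Finset.sum_comm]
    simp only [smul_comm (g _) (f _)]

theorem quadPair_gd (φ : Fin 3 → Module.Dual k (GDGens k) ⊗[k] Module.Dual k (GDGens k))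
    (σ ρ : Equiv.Perm (Fin 3)) (α β : GDGens k) :
    quadPair φ (permAct (gdSwap k) σ (quadMono (gdSwap k) ρ α β)) =
      TensorProduct.dualDistrib k _ _ (φ ((σ * ρ) 2))
      (α ⊗ₜ if Equiv.Perm.sign (σ * ρ) = 1 then β else gdSwap k β) := by
  rw [permAct_quadMono (gdSwap_gdSwap k), quadPair_quadMono]

/-- The relations are spanned by the permuted generators and the pairing is linear, so orthogonality
is tested on finitely many elements. -/
theorem mem_dual_rel {φ : Fin 3 → Module.Dual k (GDGens k) ⊗[k] Module.Dual k (GDGens k)} :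
    φ ∈ (gdData k).dual.rel ↔ ∀ σ, ∀ g ∈ gdRelations k,
      quadPair φ (permAct (gdSwap k) σ g) = 0 := by
  constructor
  · exact fun h σ g hg => h _ (Submodule.subset_span ⟨σ, g, hg, rfl⟩)
  · intro h r hr
    induction hr using Submodule.span_induction with
    | mem r hr =>
      obtain ⟨σ, g, hg, rfl⟩ := hr
      exact h σ g hg
    | zero => simp [quadPair]
    | add x y _ _ hx hy => rw [quadPair_add, hx, hy, add_zero]
    | smul c x _ hx => rw [quadPair_smul, hx, mul_zero]

theorem gdCoord_eq (ψ : Module.Dual k (GDGens k) ⊗[k] Module.Dual k (GDGens k)) (a b : Fin 3) :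
    TensorProduct.dualDistrib k _ _ ψ (Pi.single a 1 ⊗ₜ Pi.single b 1) = gdCoord ψ a b :=
  rfl

theorem gdCoord_zero (a b : Fin 3) :
    gdCoord (0 : Module.Dual k (GDGens k) ⊗[k] Module.Dual k (GDGens k)) a b = 0 := by
  simp [gdCoord]

theorem gdCoord_add (ψ χ : Module.Dual k (GDGens k) ⊗[k] Module.Dual k (GDGens k)) (a b : Fin 3) :
    gdCoord (ψ + χ) a b = gdCoord ψ a b + gdCoord χ a b := by
  simp [gdCoord]

theorem gdCoord_neg (ψ : Module.Dual k (GDGens k) ⊗[k] Module.Dual k (GDGens k)) (a b : Fin 3) :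
    gdCoord (-ψ) a b = -gdCoord ψ a b := by
  have h : -ψ + ψ = 0 := by exact neg_add_cancel ψ
  rw [eq_neg_iff_add_eq_zero, ← gdCoord_add, h, gdCoord_zero]

theorem gdCoord_tmul (f g : Module.Dual k (GDGens k)) (a b : Fin 3) :
    gdCoord (f ⊗ₜ[k] g) a b = f (Pi.single a 1) * g (Pi.single b 1) := by
  simp [gdCoord]

theorem swap_zero_one_two : Equiv.swap 0 1 (2 : Fin 3) = 2 := by decide

theorem swap_one_two_zero : Equiv.swap 1 2 (0 : Fin 3) = 0 := by decide

theorem swap_zero_two_one : Equiv.swap 0 2 (1 : Fin 3) = 1 := by decide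

theorem perm_fin_three (σ : Equiv.Perm (Fin 3)) : σ = 1 ∨ σ = Equiv.swap 0 1 ∨
    σ = Equiv.swap 1 2 ∨ σ = Equiv.swap 0 2 ∨ σ = finRotate 3 ∨ σ = (finRotate 3)⁻¹ := by
  revert σ
  decide

/-- Read at `a, b, c`, the vector is `(a ∗ b) ∗ c - (b ∗ c) ∗ a`, which is associativity once `∗` is
known to commute. Here, as in the four lemmas that follow, membership is a check against four
relations and six permutations. -/
theorem assoc_mem_dual_rel : ![-(gdProj k 0 ⊗ₜ gdProj k 0), 0, gdProj k 0 ⊗ₜ gdProj k 0] ∈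
    (gdData k).dual.rel := by
  rw [mem_dual_rel]
  simp only [gdRelations, Set.mem_insert_iff, Set.mem_singleton_iff, forall_eq_or_imp, forall_eq,
    map_add, map_sub, map_neg, quadPair_add, quadPair_sub, quadPair_neg, quadPair_gd]
  intro σ
  rcases perm_fin_three σ with rfl | rfl | rfl | rfl | rfl | rfl <;>
  simp +decide [gdSwap_zero, gdSwap_one, TensorProduct.tmul_neg, gdCoord_eq, swap_zero_one_two,
    swap_one_two_zero, swap_zero_two_one, gdCoord_neg, gdCoord_add, gdCoord_zero, gdCoord_tmul]

/-- Encodes `(a ⋆ b) ∗ c = a ⋆ (b ∗ c)`: the third basis vector acts as `(x, y) ↦ -(y ⋆ x)`. -/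
theorem succ_mul_mem_dual_rel : ![gdProj k 2 ⊗ₜ gdProj k 0, 0, gdProj k 0 ⊗ₜ gdProj k 1] ∈
    (gdData k).dual.rel := by
  rw [mem_dual_rel]
  simp only [gdRelations, Set.mem_insert_iff, Set.mem_singleton_iff, forall_eq_or_imp, forall_eq,
    map_add, map_sub, map_neg, quadPair_add, quadPair_sub, quadPair_neg, quadPair_gd]
  intro σ
  rcases perm_fin_three σ with rfl | rfl | rfl | rfl | rfl | rfl <;>
  simp +decide [gdSwap_zero, gdSwap_one, TensorProduct.tmul_neg, gdCoord_eq, swap_zero_one_two,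
    swap_one_two_zero, swap_zero_two_one, gdCoord_neg, gdCoord_add, gdCoord_zero, gdCoord_tmul]

/-- Encodes `(a ∗ b) ⋆ c = (a ⋆ c) ∗ b + (b ⋆ c) ∗ a`, the Leibniz rule for `∗`. -/
theorem mul_succ_mem_dual_rel : ![-(gdProj k 0 ⊗ₜ gdProj k 1), gdProj k 0 ⊗ₜ gdProj k 2, gdProj k 1 ⊗ₜ gdProj k 0] ∈
    (gdData k).dual.rel := by
  rw [mem_dual_rel]
  simp only [gdRelations, Set.mem_insert_iff, Set.mem_singleton_iff, forall_eq_or_imp, forall_eq,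
    map_add, map_sub, map_neg, quadPair_add, quadPair_sub, quadPair_neg, quadPair_gd]
  intro σ
  rcases perm_fin_three σ with rfl | rfl | rfl | rfl | rfl | rfl <;>
  simp +decide [gdSwap_zero, gdSwap_one, TensorProduct.tmul_neg, gdCoord_eq, swap_zero_one_two,
    swap_one_two_zero, swap_zero_two_one, gdCoord_neg, gdCoord_add, gdCoord_zero, gdCoord_tmul]

/-- Encodes `a ⋆ (b ⋆ c) = b ⋆ (a ⋆ c)`. -/
theorem succ_left_comm_mem_dual_rel : ![gdProj k 2 ⊗ₜ gdProj k 1, gdProj k 2 ⊗ₜ gdProj k 2, 0] ∈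
    (gdData k).dual.rel := by
  rw [mem_dual_rel]
  simp only [gdRelations, Set.mem_insert_iff, Set.mem_singleton_iff, forall_eq_or_imp, forall_eq,
    map_add, map_sub, map_neg, quadPair_add, quadPair_sub, quadPair_neg, quadPair_gd]
  intro σ
  rcases perm_fin_three σ with rfl | rfl | rfl | rfl | rfl | rfl <;>
  simp +decide [gdSwap_zero, gdSwap_one, TensorProduct.tmul_neg, gdCoord_eq, swap_zero_one_two,
    swap_one_two_zero, swap_zero_two_one, gdCoord_neg, gdCoord_add, gdCoord_zero, gdCoord_tmul]

/-- Encodes the symmetry of `(a ⋆ b) ⋆ c - a ⋆ (b ⋆ c)` in `b` and `c`. -/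
theorem succ_right_symm_mem_dual_rel : ![gdProj k 2 ⊗ₜ gdProj k 1 + gdProj k 2 ⊗ₜ gdProj k 2, gdProj k 1 ⊗ₜ gdProj k 2, gdProj k 1 ⊗ₜ gdProj k 1] ∈
    (gdData k).dual.rel := by
  rw [mem_dual_rel]
  simp only [gdRelations, Set.mem_insert_iff, Set.mem_singleton_iff, forall_eq_or_imp, forall_eq,
    map_add, map_sub, map_neg, quadPair_add, quadPair_sub, quadPair_neg, quadPair_gd]
  intro σ
  rcases perm_fin_three σ with rfl | rfl | rfl | rfl | rfl | rfl <;>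
  simp +decide [gdSwap_zero, gdSwap_one, TensorProduct.tmul_neg, gdCoord_eq, swap_zero_one_two,
    swap_one_two_zero, swap_zero_two_one, gdCoord_neg, gdCoord_add, gdCoord_zero, gdCoord_tmul]

/-- The coordinates of the elements that are orthogonal to all relations of `GD`. -/
theorem gdCoord_of_mem_dual_rel
    {φ : Fin 3 → Module.Dual k (GDGens k) ⊗[k] Module.Dual k (GDGens k)}
    (h : φ ∈ (gdData k).dual.rel) :
    (gdCoord (φ 0) 0 0 + gdCoord (φ 1) 0 0 + gdCoord (φ 2) 0 0 = 0 ∧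
    gdCoord (φ 0) 0 1 + gdCoord (φ 0) 1 0 - gdCoord (φ 1) 2 0 - gdCoord (φ 2) 0 2 +
      gdCoord (φ 2) 1 0 = 0 ∧
    gdCoord (φ 1) 0 1 + gdCoord (φ 1) 1 0 - gdCoord (φ 2) 2 0 - gdCoord (φ 0) 0 2 +
      gdCoord (φ 0) 1 0 = 0 ∧
    gdCoord (φ 2) 0 1 + gdCoord (φ 2) 1 0 - gdCoord (φ 0) 2 0 - gdCoord (φ 1) 0 2 +
      gdCoord (φ 1) 1 0 = 0) ∧
    gdCoord (φ 0) 1 1 = gdCoord (φ 2) 1 2 ∧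
    gdCoord (φ 1) 1 1 = gdCoord (φ 0) 1 2 ∧
    gdCoord (φ 2) 1 1 = gdCoord (φ 1) 1 2 ∧
    gdCoord (φ 0) 1 1 - gdCoord (φ 0) 1 2 - gdCoord (φ 1) 2 1 + gdCoord (φ 2) 2 2 = 0 ∧
    gdCoord (φ 1) 1 1 - gdCoord (φ 1) 1 2 - gdCoord (φ 2) 2 1 + gdCoord (φ 0) 2 2 = 0 ∧
    gdCoord (φ 2) 1 1 - gdCoord (φ 2) 1 2 - gdCoord (φ 0) 2 1 + gdCoord (φ 1) 2 2 = 0 := by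
  rw [mem_dual_rel] at h
  simp only [gdRelations, Set.mem_insert_iff, Set.mem_singleton_iff, forall_eq_or_imp, forall_eq,
    map_add, map_sub, map_neg, quadPair_add, quadPair_sub, quadPair_neg, quadPair_gd] at h
  -- The identity and the two rotations suffice: they produce the Jacobi condition, repeated three
  -- times, and the other three relations in three positions each, which makes ten equations.
  have h1 := h 1
  have h4 := h (finRotate 3)
  have h5 := h (finRotate 3)⁻¹
  simp +decide [gdSwap_zero, gdSwap_one, TensorProduct.tmul_neg, gdCoord_eq,
    swap_zero_one_two, swap_one_two_zero, swap_zero_two_one] at h1 h4 h5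
  obtain ⟨a1, a2, a3, a4⟩ := h1
  obtain ⟨b1, b2, b3, b4⟩ := h4
  obtain ⟨c1, c2, c3, c4⟩ := h5
  refine ⟨⟨?_, ?_, ?_, ?_⟩, ?_, ?_, ?_, ?_, ?_, ?_⟩
  · linear_combination a3
  · linear_combination -a4
  · linear_combination -b4
  · linear_combination -c4
  · linear_combination b2
  · linear_combination c2
  · linear_combination a2
  · linear_combination b1
  · linear_combination c1
  · linear_combination a1

end GDPair

/-! ### `GD^!`-algebras: the commutative differential examples and the explicit identities. -/

section DualAlgebras

variable {k : Type u} [Field k]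

/-- The operations of the dual operad on a differential commutative algebra: the elements dual
to `[x₀, x₁]`, `x₀ ∘ x₁` and `x₁ ∘ x₀` act as `x y`, `d(x) y` and `-x d(y)`. -/
def gdDualMul {R : Type u} [CommRing R] [Algebra k R] (d : R →ₗ[k] R) :
    Module.Dual k (GDGens k) →ₗ[k] R →ₗ[k] R →ₗ[k] R :=
  LinearMap.smulRight (Module.Dual.eval k (GDGens k) (Pi.single 0 1)) (LinearMap.mul k R) +
    LinearMap.smulRight (Module.Dual.eval k (GDGens k) (Pi.single 1 1))
      ((LinearMap.mul k R).comp d) +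
    LinearMap.smulRight (Module.Dual.eval k (GDGens k) (Pi.single 2 1))
      ((LinearMap.mul k R).compl₂ (-d))

theorem gdDualMul_apply {R : Type u} [CommRing R] [Algebra k R] (d : R →ₗ[k] R)
    (f : Module.Dual k (GDGens k)) (x y : R) :
    gdDualMul d f x y = f (Pi.single 0 1) • (x * y) + f (Pi.single 1 1) • (d x * y) -
      f (Pi.single 2 1) • (x * d y) := by
  simp [gdDualMul, sub_eq_add_neg]

/-- A differential commutative algebra as a system with operations from `GD^!(2)`. -/
@[reducible]
def gdDualAlg {R : Type u} [CommRing R] [Algebra k R] (d : R →ₗ[k] R) :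
    OpAlg k (Module.Dual k (GDGens k)) where
  carrier := R
  op f := gdDualMul d f

/-- Expanded by the Leibniz rule, the value of an orthogonal element is a combination of ten
differential monomials in `x 0`, `x 1`, `x 2`: one of order zero, three of order one, six of order
two. Their coefficients are the ten expressions that vanish by `gdCoord_of_mem_dual_rel`. -/
theorem gdDualAlg_mem {R : Type u} [CommRing R] [Algebra k R] (d : R →ₗ[k] R)
    (hd : ∀ x y, d (x * y) = d x * y + x * d y) :
    gdDualAlg d ∈ (gdData k).dual.algebras := by
  refine ⟨gdDualMul d, fun _ => rfl, fun f (x : R) (y : R) => ?_, ?_⟩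
  · change gdDualMul d _ x y = gdDualMul d _ y x
    rw [gdDualMul_apply, gdDualMul_apply]
    simp only [LinearMap.neg_apply, LinearMap.dualMap_apply, gdSwap_zero, gdSwap_one, gdSwap_two,
      map_neg, neg_neg, mul_comm x, mul_comm (d x)]
    module
  · intro φ hφ (x : Fin 3 → R)
    obtain ⟨⟨h1, h2, h3, h4⟩, h5, h6, h7, h8, h9, h10⟩ := gdCoord_of_mem_dual_rel hφ
    change ∑ i : Fin 3, QuadData.quadEval (gdDualMul d) (x (i + 1)) (x (i + 2)) (x i) (φ i) = 0
    simp only [quadEval_eq_sum, gdDualMul_apply, Fin.sum_univ_three, gdProj]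
    have e0 : (0 : Fin 3) + 1 = 1 := rfl
    have e1 : (1 : Fin 3) + 1 = 2 := rfl
    have e2 : (2 : Fin 3) + 1 = 0 := rfl
    have e3 : (0 : Fin 3) + 2 = 2 := rfl
    have e4 : (1 : Fin 3) + 2 = 0 := rfl
    have e5 : (2 : Fin 3) + 2 = 1 := rfl
    simp only [e0, e1, e2, e3, e4, e5]
    simp +decide only [LinearMap.proj_apply, Pi.single_eq_same, Pi.single_apply, if_false, one_smul,
      zero_smul, add_zero, zero_add, sub_zero, zero_sub, map_neg, hd, if_true]
    simp only [Algebra.smul_def]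
    have H1 := congrArg (algebraMap k R) h1
    have H2 := congrArg (algebraMap k R) h2
    have H3 := congrArg (algebraMap k R) h3
    have H4 := congrArg (algebraMap k R) h4
    have H5 := congrArg (algebraMap k R) h5
    have H6 := congrArg (algebraMap k R) h6
    have H7 := congrArg (algebraMap k R) h7
    have H8 := congrArg (algebraMap k R) h8
    have H9 := congrArg (algebraMap k R) h9
    have H10 := congrArg (algebraMap k R) h10
    simp only [map_add, map_sub, map_zero] at H1 H2 H3 H4 H5 H6 H7 H8 H9 H10
    linear_combination x 0 * x 1 * x 2 * H1 +
      x 0 * d (x 1) * x 2 * H2 +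
      x 0 * x 1 * d (x 2) * H3 +
      d (x 0) * x 1 * x 2 * H4 +
      x 0 * d (d (x 1)) * x 2 * H5 +
      x 0 * x 1 * d (d (x 2)) * H6 +
      d (d (x 0)) * x 1 * x 2 * H7 +
      x 0 * d (x 1) * d (x 2) * H8 +
      d (x 0) * x 1 * d (x 2) * H9 +
      d (x 0) * d (x 1) * x 2 * H10

/-- The algebras over `GD^!`, in terms of `a ∗ b` and `a ⋆ b`, written as `mul a b` and
`succ a b`. -/
structure GDDualStructure (k : Type u) [Field k] (B : Type u) [AddCommGroup B] [Module k B] where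
  mul : B →ₗ[k] B →ₗ[k] B
  succ : B →ₗ[k] B →ₗ[k] B
  mul_comm : ∀ a b, mul a b = mul b a
  mul_assoc : ∀ a b c, mul (mul a b) c = mul a (mul b c)
  succ_mul : ∀ a b c, succ a (mul b c) = mul (succ a b) c
  mul_succ : ∀ a b c, succ (mul a b) c = mul (succ a c) b + mul (succ b c) a
  left_comm : ∀ a b c, succ a (succ b c) = succ b (succ a c)
  right_symm : ∀ a b c,
    succ (succ a b) c - succ a (succ b c) = succ (succ a c) b - succ a (succ c b)

theorem exists_gdDualStructure {A : OpAlg k (Module.Dual k (GDGens k))}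
    (hA : A ∈ (gdData k).dual.algebras) :
    ∃ D : GDDualStructure k A.carrier, D.mul = A.op (gdProj k 0) ∧ D.succ = A.op (gdProj k 1) := by
  obtain ⟨m, h1, h2, h3⟩ := hA
  have hs0 : ∀ x y, m (gdProj k 0) x y = m (gdProj k 0) y x := fun x y => by
    have h := h2 (gdProj k 0) x y
    rwa [dual_swap_zero] at h
  -- The minus sign is the sign twist in `E* ⊗ sgn`; the same twist makes the dual of the skew
  -- bracket commutative.
  have hs1 : ∀ x y, m (gdProj k 2) x y = -m (gdProj k 1) y x := fun x y => by
    have h := h2 (gdProj k 1) x y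
    rw [dual_swap_one, map_neg, LinearMap.neg_apply, LinearMap.neg_apply] at h
    rw [← h, neg_neg]
  rw [h1, h1]
  refine ⟨⟨m (gdProj k 0), m (gdProj k 1), hs0, ?_, ?_, ?_, ?_, ?_⟩, rfl, rfl⟩
  · intro a b c
    have h := h3 _ assoc_mem_dual_rel ![a, b, c]
    simp [Fin.sum_univ_three, QuadData.quadEval] at h
    rw [hs0 a (m (gdProj k 0) b c), ← sub_eq_zero, ← h]
    abel
  · intro a b c
    have h := h3 _ succ_mul_mem_dual_rel ![a, b, c]
    simp [Fin.sum_univ_three, QuadData.quadEval, hs1] at h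
    rw [← sub_eq_zero, ← neg_eq_zero, ← h]
    abel
  · intro a b c
    have h := h3 _ mul_succ_mem_dual_rel ![a, b, c]
    simp [Fin.sum_univ_three, QuadData.quadEval, hs1] at h
    rw [← sub_eq_zero, ← h]
    abel
  · intro a b c
    have h := h3 _ succ_left_comm_mem_dual_rel ![a, b, c]
    simp [Fin.sum_univ_three, QuadData.quadEval, hs1] at h
    rw [← sub_eq_zero, ← neg_eq_zero, ← h]
    abel
  · intro a b c
    have h := h3 _ succ_right_symm_mem_dual_rel ![a, b, c]
    simp [Fin.sum_univ_three, QuadData.quadEval, hs1] at h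
    rw [← sub_eq_zero, ← h]
    abel

end DualAlgebras

end

end WhiteGD

namespace WhiteGD

noncomputable section

/-! ### Leibniz expansions of monomials with derivations. -/

namespace NATree

variable {Ω Ω' : Type u} {S : Type}

/-- The list of the variables of a monomial. -/
def leaves : NATree Ω S → List S
  | var x => [x]
  | op _ l r => l.leaves ++ r.leaves

open Classical in
theorem count_leaves (s : S) (t : NATree Ω S) : t.leaves.count s = t.occ s := by
  induction t with
  | var x => simp [leaves, occ, List.count_singleton]
  | op ω l r hl hr => simp [leaves, occ, hl, hr]

theorem leaves_translate {f : Ω → Ω' × Bool} (hf : ∀ ω, (f ω).2 = false) (t : NATree Ω S) :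
    (t.translate f).leaves = t.leaves := by
  induction t with
  | var x => rfl
  | op ω l r hl hr => rw [translate_op_false (hf ω), leaves, leaves, hl, hr]

/-- The number of the operations `≻` and `≺` in a monomial. -/
def deg : NATree DOp.{u} S → ℕ
  | var _ => 0
  | op .succ l r => l.deg + r.deg + 1
  | op .prec l r => l.deg + r.deg + 1
  | op .dot l r => l.deg + r.deg

/-- The sum of `F w` over all words `w` that describe the terms of the expansion of a monomial by
the Leibniz rule: each operation `≻` or `≺` contributes a variable on which `d` acts. -/
def wordSum {M : Type*} [AddCommMonoid M] : NATree DOp.{u} S → (List S → M) → M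
  | var _, F => F []
  | op .succ l r, F =>
    (l.leaves.map fun s => l.wordSum fun w => r.wordSum fun w' => F (s :: (w ++ w'))).sum
  | op .prec l r, F =>
    (r.leaves.map fun s => l.wordSum fun w => r.wordSum fun w' => F (s :: (w ++ w'))).sum
  | op .dot l r, F => l.wordSum fun w => r.wordSum fun w' => F (w ++ w')

section WordSum

variable {M N : Type*} [AddCommMonoid M] [AddCommMonoid N]

theorem map_wordSum (φ : M →+ N) (t : NATree DOp.{u} S) (F : List S → M) :
    φ (t.wordSum F) = t.wordSum fun w => φ (F w) := by
  induction t generalizing F with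
  | var x => rfl
  | op ω l r hl hr =>
    cases ω <;> simp only [wordSum, map_list_sum, List.map_map, Function.comp_def, hl, hr]

/-- Only words of length `t.deg` with letters among the leaves occur in the expansion. The constant
length is what later pins down the powers of the balancing factor. -/
theorem wordSum_congr (t : NATree DOp.{u} S) {F G : List S → M}
    (h : ∀ w : List S, w.length = t.deg → (∀ s ∈ w, s ∈ t.leaves) → F w = G w) :
    t.wordSum F = t.wordSum G := by
  induction t generalizing F G with
  | var x => exact h [] rfl (by simp)
  | op ω l r hl hr =>
    have key : ∀ (F G : List S → M), (∀ w w', w.length = l.deg → w'.length = r.deg →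
        (∀ s ∈ w, s ∈ l.leaves) → (∀ s ∈ w', s ∈ r.leaves) → F (w ++ w') = G (w ++ w')) →
        (l.wordSum fun w => r.wordSum fun w' => F (w ++ w')) =
          l.wordSum fun w => r.wordSum fun w' => G (w ++ w') := fun F G h' =>
      hl fun w h1 h2 => hr fun w' h3 h4 => h' w w' h1 h3 h2 h4
    cases ω with
    | succ =>
      refine congrArg List.sum (List.map_congr_left fun s hs => ?_)
      refine key (fun w => F (s :: w)) (fun w => G (s :: w)) fun w w' h1 h2 h3 h4 => h _ ?_ ?_
      · simp [h1, h2, deg]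
      · intro x hx
        simp only [List.mem_cons, List.mem_append] at hx
        rw [leaves, List.mem_append]
        rcases hx with rfl | hx | hx
        exacts [Or.inl hs, Or.inl (h3 x hx), Or.inr (h4 x hx)]
    | prec =>
      refine congrArg List.sum (List.map_congr_left fun s hs => ?_)
      refine key (fun w => F (s :: w)) (fun w => G (s :: w)) fun w w' h1 h2 h3 h4 => h _ ?_ ?_
      · simp [h1, h2, deg]
      · intro x hx
        simp only [List.mem_cons, List.mem_append] at hx
        rw [leaves, List.mem_append]
        rcases hx with rfl | hx | hx
        exacts [Or.inr hs, Or.inl (h3 x hx), Or.inr (h4 x hx)]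
    | dot =>
      refine key F G fun w w' h1 h2 h3 h4 => h _ ?_ ?_
      · simp [h1, h2, deg]
      · intro x hx
        simp only [List.mem_append] at hx
        rw [leaves, List.mem_append]
        rcases hx with hx | hx
        exacts [Or.inl (h3 x hx), Or.inr (h4 x hx)]

theorem wordSum_zero (t : NATree DOp.{u} S) : (t.wordSum fun _ => (0 : M)) = 0 :=
  (map_wordSum (0 : M →+ M) t fun _ => 0).symm

theorem wordSum_add (t : NATree DOp.{u} S) (F G : List S → M) :
    (t.wordSum fun w => F w + G w) = t.wordSum F + t.wordSum G := by
  induction t generalizing F G with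
  | var x => rfl
  | op ω l r hl hr => cases ω <;> simp only [wordSum, hl, hr, List.sum_map_add]

theorem wordSum_list_sum {ι : Type*} (t : NATree DOp.{u} S) (L : List ι) (F : ι → List S → M) :
    (L.map fun i => t.wordSum (F i)).sum = t.wordSum fun w => (L.map fun i => F i w).sum := by
  induction L with
  | nil => simp [wordSum_zero]
  | cons i L ih => simp [wordSum_add, ih]

theorem wordSum_bilinear {k M N P : Type*} [CommSemiring k] [AddCommMonoid M] [AddCommMonoid N]
    [AddCommMonoid P] [Module k M] [Module k N] [Module k P] (B : M →ₗ[k] N →ₗ[k] P)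
    (l r : NATree DOp.{u} S) (F : List S → M) (G : List S → N) :
    B (l.wordSum F) (r.wordSum G) = l.wordSum fun w => r.wordSum fun w' => B (F w) (G w') := by
  have h1 := map_wordSum (B.flip (r.wordSum G)).toAddMonoidHom l F
  refine h1.trans (wordSum_congr l fun w _ _ => ?_)
  exact map_wordSum (B (F w)).toAddMonoidHom r G

end WordSum

end NATree

theorem MTree.nodup_leaves {Ω : Type u} {S : Type} (t : MTree Ω S) : t.1.leaves.Nodup := by
  classical
  rw [List.nodup_iff_count_le_one]
  intro s
  exact ((NATree.count_leaves s t.1).trans (t.2 s)).le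

namespace OpAlg

variable {k : Type u} [Field k] {Ω : Type u} {S : Type}

theorem evalTree_congr_leaves (A : OpAlg k Ω) {t : NATree Ω S} {a b : S → A.carrier}
    (h : ∀ s ∈ t.leaves, a s = b s) : A.evalTree a t = A.evalTree b t := by
  induction t with
  | var x => exact h x (by simp [NATree.leaves])
  | op ω l r hl hr =>
    rw [evalTree, evalTree, hl fun s hs => h s (List.mem_append_left _ hs),
      hr fun s hs => h s (List.mem_append_right _ hs)]

open Classical in
/-- The Leibniz rule for the values of multilinear monomials. -/
theorem derivation_evalTree (A : OpAlg k Ω) {d : A.carrier → A.carrier}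
    (hd : ∀ ω x y, d (A.op ω x y) = A.op ω (d x) y + A.op ω x (d y)) {t : NATree Ω S}
    (ht : t.leaves.Nodup) (a : S → A.carrier) :
    d (A.evalTree a t) =
      (t.leaves.map fun s => A.evalTree (Function.update a s (d (a s))) t).sum := by
  induction t with
  | var x => simp [evalTree, NATree.leaves]
  | op ω l r hl hr =>
    rw [NATree.leaves, List.nodup_append'] at ht
    obtain ⟨h1, h2, h3⟩ := ht
    rw [evalTree, hd, hl h1, hr h2, NATree.leaves, List.map_append, List.sum_append]
    -- A variable of one subtree does not occur in the other, so differentiating it leaves the other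
    -- factor unchanged.
    have e1 : ∀ s ∈ l.leaves, A.evalTree (Function.update a s (d (a s))) r = A.evalTree a r :=
      fun s hs => A.evalTree_congr_leaves fun x hx =>
        Function.update_of_ne (fun h : x = s => h3 hs (h ▸ hx)) _ _
    have e2 : ∀ s ∈ r.leaves, A.evalTree (Function.update a s (d (a s))) l = A.evalTree a l :=
      fun s hs => A.evalTree_congr_leaves fun x hx =>
        Function.update_of_ne (fun h : x = s => h3 hx (h ▸ hs)) _ _
    congr 1
    · rw [← LinearMap.flip_apply, map_list_sum, List.map_map]
      refine congrArg List.sum (List.map_congr_left fun s hs => ?_)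
      simp [evalTree, e1 s hs]
    · rw [map_list_sum, List.map_map]
      refine congrArg List.sum (List.map_congr_left fun s hs => ?_)
      simp [evalTree, e2 s hs]

end OpAlg

/-- The change of operations that replaces `≻`, `≺` and `·` by the multiplication. -/
def forgetOp (_ : DOp.{u}) : PUnit.{u + 1} × Bool := (PUnit.unit, false)

section Polar

variable {k : Type u} [Field k] {S : Type} (A : OpAlg k PUnit.{u + 1})

/-- The value of a monomial in which the derivation is replaced by a different one at each
occurrence of `≻` or `≺`. -/
def polarEval (a : S → A.carrier) :
    NATree DOp.{u} S → List (A.carrier →ₗ[k] A.carrier) → A.carrier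
  | .var x, _ => a x
  -- The head of `ds` belongs to the root, the next `l.deg` entries to the left subtree and the rest
  -- to the right one. The default `0` is not used when `ds` has length `deg`.
  | .op .succ l r, ds => A.op PUnit.unit (ds.headD 0 (polarEval a l (ds.tail.take l.deg)))
      (polarEval a r (ds.tail.drop l.deg))
  | .op .prec l r, ds => A.op PUnit.unit (polarEval a l (ds.tail.take l.deg))
      (ds.headD 0 (polarEval a r (ds.tail.drop l.deg)))
  | .op .dot l r, ds => A.op PUnit.unit (polarEval a l (ds.take l.deg))
      (polarEval a r (ds.drop l.deg))

open Classical in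
/-- Simultaneous application of linear maps to the values of variables. -/
def applyAll {V : Type*} [AddCommMonoid V] [Module k V] (a : S → V) :
    List (S × (V →ₗ[k] V)) → S → V
  | [], s => a s
  | p :: l, s => if s = p.1 then p.2 (applyAll a l s) else applyAll a l s

variable {V : Type*} [AddCommMonoid V] [Module k V]

open Classical in
theorem applyAll_cons (a : S → V) (s : S) (d : V →ₗ[k] V) (l : List (S × (V →ₗ[k] V))) :
    applyAll a ((s, d) :: l) = Function.update (applyAll a l) s (d (applyAll a l s)) := by
  funext x
  by_cases h : x = s
  · subst h
    simp [applyAll]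
  · simp [applyAll, h]

theorem applyAll_append_of_notMem_right (a : S → V) (l l' : List (S × (V →ₗ[k] V))) (s : S)
    (h : s ∉ l'.map Prod.fst) : applyAll a (l ++ l') s = applyAll a l s := by
  induction l with
  | nil =>
    induction l' with
    | nil => rfl
    | cons p l' ih =>
      simp only [List.map_cons, List.mem_cons, not_or] at h
      simp only [List.nil_append, applyAll, if_neg h.1] at ih ⊢
      exact ih h.2
  | cons p l ih => rw [List.cons_append, applyAll, applyAll, ih]

theorem applyAll_append_of_notMem_left (a : S → V) (l l' : List (S × (V →ₗ[k] V))) (s : S)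
    (h : s ∉ l.map Prod.fst) : applyAll a (l ++ l') s = applyAll a l' s := by
  induction l with
  | nil => rfl
  | cons p l ih =>
    simp only [List.map_cons, List.mem_cons, not_or] at h
    rw [List.cons_append, applyAll, if_neg h.1, ih h.2]

theorem mem_of_mem_map_fst_zip {W : Type*} {w : List S} {ds : List W} {s : S}
    (h : s ∈ (w.zip ds).map Prod.fst) : s ∈ w := by
  obtain ⟨p, hp, rfl⟩ := List.mem_map.1 h
  exact (List.of_mem_zip hp).1

/-- The value of an operation at two expansions with disjoint sets of variables. -/
theorem evalTree_applyAll_op (a : S → A.carrier) {l r : NATree PUnit.{u + 1} S}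
    (hlr : l.leaves.Disjoint r.leaves)
    {us vs : List (A.carrier →ₗ[k] A.carrier)} {w w' : List S} (hw : w.length = us.length)
    (h1 : ∀ s ∈ w, s ∈ l.leaves) (h2 : ∀ s ∈ w', s ∈ r.leaves) :
    A.evalTree (applyAll a ((w ++ w').zip (us ++ vs))) (.op PUnit.unit l r) =
      A.op PUnit.unit (A.evalTree (applyAll a (w.zip us)) l)
        (A.evalTree (applyAll a (w'.zip vs)) r) := by
  rw [OpAlg.evalTree, List.zip_append hw]
  congr 1
  · congr 1
    exact A.evalTree_congr_leaves fun s hs => applyAll_append_of_notMem_right _ _ _ _ fun h =>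
      hlr hs (h2 s (mem_of_mem_map_fst_zip h))
  · exact A.evalTree_congr_leaves fun s hs => applyAll_append_of_notMem_left _ _ _ _ fun h =>
      hlr (h1 s (mem_of_mem_map_fst_zip h)) hs

theorem evalTree_applyAll_op_left (a : S → A.carrier) {l r : NATree PUnit.{u + 1} S}
    (hlr : l.leaves.Disjoint r.leaves)
    {us vs : List (A.carrier →ₗ[k] A.carrier)} {w w' : List S} (hw : w.length = us.length)
    (h1 : ∀ s ∈ w, s ∈ l.leaves) (h2 : ∀ s ∈ w', s ∈ r.leaves) {x : S} (hx : x ∈ l.leaves)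
    (d : A.carrier →ₗ[k] A.carrier) :
    A.evalTree (applyAll a ((x :: (w ++ w')).zip (d :: (us ++ vs)))) (.op PUnit.unit l r) =
      A.op PUnit.unit (A.evalTree (applyAll a ((x, d) :: w.zip us)) l)
        (A.evalTree (applyAll a (w'.zip vs)) r) :=
  evalTree_applyAll_op A a (us := d :: us) (w := x :: w) hlr (by simp [hw])
    (by simpa using ⟨hx, h1⟩) h2

/-- The head of the word concerns the right factor although the left letters come next in the list;
it passes over them because the two sets of leaves are disjoint. -/
theorem evalTree_applyAll_op_right (a : S → A.carrier) {l r : NATree PUnit.{u + 1} S}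
    (hlr : l.leaves.Disjoint r.leaves)
    {us vs : List (A.carrier →ₗ[k] A.carrier)} {w w' : List S} (hw : w.length = us.length)
    (h1 : ∀ s ∈ w, s ∈ l.leaves) (h2 : ∀ s ∈ w', s ∈ r.leaves) {x : S} (hx : x ∈ r.leaves)
    (d : A.carrier →ₗ[k] A.carrier) :
    A.evalTree (applyAll a ((x :: (w ++ w')).zip (d :: (us ++ vs)))) (.op PUnit.unit l r) =
      A.op PUnit.unit (A.evalTree (applyAll a (w.zip us)) l)
        (A.evalTree (applyAll a ((x, d) :: w'.zip vs)) r) := by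
  classical
  rw [OpAlg.evalTree, List.zip_cons_cons, applyAll_cons, applyAll_cons, List.zip_append hw]
  have e : ∀ s ∈ r.leaves, applyAll a (w.zip us ++ w'.zip vs) s = applyAll a (w'.zip vs) s :=
    fun s hs => applyAll_append_of_notMem_left _ _ _ _ fun h =>
      hlr (h1 s (mem_of_mem_map_fst_zip h)) hs
  congr 1
  · congr 1
    refine A.evalTree_congr_leaves fun s hs => ?_
    rw [Function.update_of_ne (fun h : s = x => hlr hs (h ▸ hx))]
    exact applyAll_append_of_notMem_right _ _ _ _ fun h =>
      hlr hs (h2 s (mem_of_mem_map_fst_zip h))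
  · refine A.evalTree_congr_leaves fun s hs => ?_
    rw [e x hx]
    by_cases h : s = x
    · subst h
      simp
    · rw [Function.update_of_ne h, Function.update_of_ne h, e s hs]

/-- The new derivation acts after the maps already applied, so it is recorded at the head of the
list, where `wordSum` puts the letter contributed by the root. -/
theorem derivation_evalTree_applyAll {A : OpAlg k PUnit.{u + 1}} {d : A.carrier →ₗ[k] A.carrier}
    (hd : IsDerivation A d)
    {t : NATree PUnit.{u + 1} S} (ht : t.leaves.Nodup) (a : S → A.carrier)
    (l : List (S × (A.carrier →ₗ[k] A.carrier))) :
    d (A.evalTree (applyAll a l) t) =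
      (t.leaves.map fun s => A.evalTree (applyAll a ((s, d) :: l)) t).sum := by
  classical
  rw [A.derivation_evalTree (fun _ => hd) ht]
  simp only [applyAll_cons]

/-- The expansion of a monomial by the Leibniz rule. -/
theorem polarEval_eq_wordSum (a : S → A.carrier) (t : NATree DOp.{u} S) (ht : t.leaves.Nodup)
    (ds : List (A.carrier →ₗ[k] A.carrier)) (hds : ∀ d ∈ ds, IsDerivation A d)
    (hlen : ds.length = t.deg) :
    polarEval A a t ds =
      t.wordSum fun w => A.evalTree (applyAll a (w.zip ds)) (t.translate forgetOp) := by
  induction t generalizing ds with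
  | var x => simp [polarEval, NATree.wordSum, NATree.translate, applyAll, OpAlg.evalTree]
  | op ω l r hl hr =>
    rw [NATree.leaves, List.nodup_append'] at ht
    obtain ⟨ht1, ht2, ht3⟩ := ht
    have hL : (l.translate forgetOp).leaves = l.leaves := NATree.leaves_translate (fun _ => rfl) l
    have hR : (r.translate forgetOp).leaves = r.leaves := NATree.leaves_translate (fun _ => rfl) r
    have hlr : (l.translate forgetOp).leaves.Disjoint (r.translate forgetOp).leaves := by
      rwa [hL, hR]
    cases ω with
    | succ =>
      obtain _ | ⟨d, ds⟩ := ds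
      · simp [NATree.deg] at hlen
      obtain ⟨us, vs, rfl, hus⟩ : ∃ us vs, ds = us ++ vs ∧ us.length = l.deg :=
        ⟨ds.take l.deg, ds.drop l.deg, (List.take_append_drop _ _).symm, by
          simp [NATree.deg] at hlen; simp; omega⟩
      have hvs : vs.length = r.deg := by
        simp [NATree.deg] at hlen; omega
      have hd := hds d (by simp)
      simp only [polarEval, List.headD_cons, List.tail_cons, ← hus, List.take_left,
        List.drop_left]
      rw [hl ht1 us (fun e he => hds e (by simp [he])) hus,
        hr ht2 vs (fun e he => hds e (by simp [he])) hvs]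
      -- The derivation at the root is moved inside the expansion of `l`; the Leibniz rule then
      -- supplies the sum over the leaves `s` of `l`.
      have h1 := NATree.map_wordSum d.toAddMonoidHom l fun w =>
        A.evalTree (applyAll a (w.zip us)) (l.translate forgetOp)
      simp only [LinearMap.toAddMonoidHom_coe, derivation_evalTree_applyAll hd (hL ▸ ht1),
        hL] at h1
      rw [h1, ← NATree.wordSum_list_sum, ← LinearMap.flip_apply (A.op PUnit.unit), map_list_sum,
        List.map_map, NATree.wordSum]
      refine congrArg List.sum (List.map_congr_left fun s hs => ?_)
      rw [Function.comp_apply, LinearMap.flip_apply, NATree.wordSum_bilinear]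
      refine NATree.wordSum_congr l fun w hw1 hw2 => ?_
      refine NATree.wordSum_congr r fun w' hw1' hw2' => ?_
      exact (evalTree_applyAll_op_left A a hlr (hw1.trans hus.symm) (hL ▸ hw2) (hR ▸ hw2')
        (hL ▸ hs) d).symm
    | prec =>
      obtain _ | ⟨d, ds⟩ := ds
      · simp [NATree.deg] at hlen
      obtain ⟨us, vs, rfl, hus⟩ : ∃ us vs, ds = us ++ vs ∧ us.length = l.deg :=
        ⟨ds.take l.deg, ds.drop l.deg, (List.take_append_drop _ _).symm, by
          simp [NATree.deg] at hlen; simp; omega⟩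
      have hvs : vs.length = r.deg := by
        simp [NATree.deg] at hlen; omega
      have hd := hds d (by simp)
      simp only [polarEval, List.headD_cons, List.tail_cons, ← hus, List.take_left,
        List.drop_left]
      rw [hl ht1 us (fun e he => hds e (by simp [he])) hus,
        hr ht2 vs (fun e he => hds e (by simp [he])) hvs]
      have h1 := NATree.map_wordSum d.toAddMonoidHom r fun w =>
        A.evalTree (applyAll a (w.zip vs)) (r.translate forgetOp)
      simp only [LinearMap.toAddMonoidHom_coe, derivation_evalTree_applyAll hd (hR ▸ ht2),
        hR] at h1
      rw [h1, ← NATree.wordSum_list_sum, map_list_sum, List.map_map, NATree.wordSum]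
      refine congrArg List.sum (List.map_congr_left fun s hs => ?_)
      rw [Function.comp_apply, NATree.wordSum_bilinear]
      refine NATree.wordSum_congr l fun w hw1 hw2 => ?_
      refine NATree.wordSum_congr r fun w' hw1' hw2' => ?_
      exact (evalTree_applyAll_op_right A a hlr (hw1.trans hus.symm) (hL ▸ hw2) (hR ▸ hw2')
        (hR ▸ hs) d).symm
    | dot =>
      obtain ⟨us, vs, rfl, hus⟩ : ∃ us vs, ds = us ++ vs ∧ us.length = l.deg :=
        ⟨ds.take l.deg, ds.drop l.deg, (List.take_append_drop _ _).symm, by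
          simp [NATree.deg] at hlen; simp; omega⟩
      have hvs : vs.length = r.deg := by
        simp [NATree.deg] at hlen; omega
      simp only [polarEval, ← hus, List.take_left, List.drop_left]
      rw [hl ht1 us (fun e he => hds e (by simp [he])) hus,
        hr ht2 vs (fun e he => hds e (by simp [he])) hvs, NATree.wordSum_bilinear,
        NATree.wordSum]
      refine NATree.wordSum_congr l fun w hw1 hw2 => ?_
      refine NATree.wordSum_congr r fun w' hw1' hw2' => ?_
      exact (evalTree_applyAll_op A a hlr (hw1.trans hus.symm) (hL ▸ hw2) (hR ▸ hw2')).symm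

end Polar
end
end WhiteGD

namespace WhiteGD

noncomputable section

/-! ### The convolution algebra of functions on words -/

/-- Functions on words; the product is the convolution with respect to concatenation. -/
def WordFun (Λ B : Type u) : Type u := List B → Λ

namespace WordFun

variable {Λ B : Type u} [CommRing Λ]

instance : AddCommGroup (WordFun Λ B) := inferInstanceAs (AddCommGroup (List B → Λ))

@[simp] theorem zero_apply (l : List B) : (0 : WordFun Λ B) l = 0 := rfl
@[simp] theorem add_apply (g h : WordFun Λ B) (l : List B) : (g + h) l = g l + h l := rfl

omit [CommRing Λ] in
@[ext] theorem ext {g h : WordFun Λ B} (e : ∀ l, g l = h l) : g = h := funext e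

/-- The left derivative of a function on words. -/
def shift (b : B) (g : WordFun Λ B) : WordFun Λ B := fun l => g (b :: l)

omit [CommRing Λ] in
@[simp] theorem shift_apply (b : B) (g : WordFun Λ B) (l : List B) : shift b g l = g (b :: l) := rfl

/-- The convolution product. -/
def conv : WordFun Λ B → WordFun Λ B → List B → Λ
  | g, h, [] => g [] * h []
  | g, h, b :: l => g [] * h (b :: l) + conv (shift b g) h l

theorem conv_add_left (g g' h : WordFun Λ B) (l : List B) :
    conv (g + g') h l = conv g h l + conv g' h l := by
  induction l generalizing g g' with
  | nil => simp [conv, add_mul]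
  | cons b l ih =>
    have e : shift b (g + g') = shift b g + shift b g' := rfl
    simp only [conv, e, ih, add_apply]
    ring

theorem conv_add_right (g h h' : WordFun Λ B) (l : List B) :
    conv g (h + h') l = conv g h l + conv g h' l := by
  induction l generalizing g with
  | nil => simp [conv, mul_add]
  | cons b l ih =>
    simp only [conv, ih, add_apply]
    ring

/-- Multiplication of all values by a scalar. -/
def scale (c : Λ) (g : WordFun Λ B) : WordFun Λ B := fun l => c * g l

@[simp] theorem scale_apply (c : Λ) (g : WordFun Λ B) (l : List B) : scale c g l = c * g l := rfl

theorem conv_scale_left (c : Λ) (g h : WordFun Λ B) (l : List B) :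
    conv (scale c g) h l = c * conv g h l := by
  induction l generalizing g with
  | nil => simp [conv, mul_assoc]
  | cons b l ih =>
    have e : shift b (scale c g) = scale c (shift b g) := rfl
    simp only [conv, e, ih, scale_apply]
    ring

theorem conv_scale_right (c : Λ) (g h : WordFun Λ B) (l : List B) :
    conv g (scale c h) l = c * conv g h l := by
  induction l generalizing g with
  | nil => simp only [conv, scale_apply]; ring
  | cons b l ih =>
    simp only [conv, ih, scale_apply]
    ring

theorem conv_assoc (g h m : WordFun Λ B) (l : List B) :
    conv (conv g h) m l = conv g (conv h m) l := by
  induction l generalizing g h with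
  | nil => simp [conv, mul_assoc]
  | cons b l ih =>
    have e : conv (shift b (conv g h)) m l =
        g [] * conv (shift b h) m l + conv (conv (shift b g) h) m l :=
      (conv_add_left (scale (g []) (shift b h)) (conv (shift b g) h) m l).trans
        (by rw [conv_scale_left])
    simp only [conv, e, ih]
    ring

open Classical in
/-- The function concentrated on the empty word. -/
def const (c : Λ) : WordFun Λ B
  | [] => c
  | _ :: _ => 0

theorem conv_zero_left (h : WordFun Λ B) (l : List B) : conv (0 : WordFun Λ B) h l = 0 := by
  simpa using conv_add_left (0 : WordFun Λ B) 0 h l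

theorem conv_zero_right (g : WordFun Λ B) (l : List B) : conv g (0 : WordFun Λ B) l = 0 := by
  simpa using conv_add_right g (0 : WordFun Λ B) 0 l

theorem conv_const_left (c : Λ) (h : WordFun Λ B) (l : List B) :
    conv (const c) h l = c * h l := by
  cases l with
  | nil => rfl
  | cons b l =>
    have e : shift b (const c : WordFun Λ B) = 0 := rfl
    simp [conv, e, conv_zero_left, const]

theorem conv_const_right (c : Λ) (g : WordFun Λ B) (l : List B) :
    conv g (const c) l = g l * c := by
  induction l generalizing g with
  | nil => rfl
  | cons b l ih => simp [conv, ih, const]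

instance : Ring (WordFun Λ B) :=
  { (inferInstance : AddCommGroup (WordFun Λ B)) with
    mul := conv
    one := const 1
    mul_assoc := fun g h m => funext (conv_assoc g h m)
    one_mul := fun g => funext fun l => (conv_const_left 1 g l).trans (one_mul _)
    mul_one := fun g => funext fun l => (conv_const_right 1 g l).trans (mul_one _)
    left_distrib := fun g h m => funext (conv_add_right g h m)
    right_distrib := fun g h m => funext (conv_add_left g h m)
    zero_mul := fun g => funext (conv_zero_left g)
    mul_zero := fun g => funext (conv_zero_right g) }

theorem mul_nil (g h : WordFun Λ B) : (g * h) [] = g [] * h [] := rfl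

theorem mul_cons (g h : WordFun Λ B) (b : B) (l : List B) :
    (g * h) (b :: l) = g [] * h (b :: l) + (shift b g * h) l := rfl

theorem one_apply (l : List B) : (1 : WordFun Λ B) l = const 1 l := rfl

theorem const_mul_apply (c : Λ) (h : WordFun Λ B) (l : List B) : ((const c : WordFun Λ B) * h) l = c * h l :=
  conv_const_left c h l

theorem mul_apply (g h : WordFun Λ B) (l : List B) :
    (g * h) l = ∑ p ∈ Finset.HasAntidiagonal.antidiagonal l.length, g (l.take p.1) * h (l.drop p.1) := by
  induction l generalizing g with
  | nil => simp [mul_nil]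
  | cons b l ih => simp [mul_cons, ih, Finset.Nat.sum_antidiagonal_succ]

variable {k : Type u} [Field k] [Algebra k Λ]

instance : Module k (WordFun Λ B) := inferInstanceAs (Module k (List B → Λ))

@[simp] theorem smul_apply (c : k) (g : WordFun Λ B) (l : List B) : (c • g) l = c • g l := rfl

instance : Algebra k (WordFun Λ B) :=
  Algebra.ofModule
    (fun c g h => funext fun l => by
      have e : c • g = scale (algebraMap k Λ c) g := funext fun l => Algebra.smul_def c (g l)
      rw [e, smul_apply, Algebra.smul_def]
      exact conv_scale_left _ g h l)
    (fun c g h => funext fun l => by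
      have e : c • h = scale (algebraMap k Λ c) h := funext fun l => Algebra.smul_def c (h l)
      rw [e, smul_apply, Algebra.smul_def]
      exact conv_scale_right _ g h l)

theorem algebraMap_apply (c : k) (l : List B) :
    algebraMap k (WordFun Λ B) c l = const (algebraMap k Λ c) l := by
  rw [Algebra.algebraMap_eq_smul_one]
  cases l with
  | nil => simp [one_apply, const, Algebra.smul_def]
  | cons b l => simp [one_apply, const]

/-- Functions that vanish on the words of length different from `n`. -/
def IsHomog (n : ℕ) (g : WordFun Λ B) : Prop := ∀ l : List B, l.length ≠ n → g l = 0

/-- When the left factor is homogeneous, only one cut of the word contributes to the convolution. -/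
theorem mul_append {n : ℕ} {g : WordFun Λ B} (hg : IsHomog n g) (h : WordFun Λ B) (l l' : List B)
    (hl : l.length = n) : (g * h) (l ++ l') = g l * h l' := by
  rw [mul_apply, Finset.sum_eq_single (n, l'.length)]
  · simp [← hl]
  · intro p hp hne
    rw [Finset.HasAntidiagonal.mem_antidiagonal, List.length_append, hl] at hp
    rw [hg, zero_mul]
    rw [List.length_take, List.length_append, hl]
    intro e
    exact hne (Prod.ext (by grind) (by grind))
  · simp [hl]

theorem IsHomog.mul {m n : ℕ} {g h : WordFun Λ B} (hg : IsHomog m g) (hh : IsHomog n h) :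
    IsHomog (m + n) (g * h) := by
  intro l hl
  rw [mul_apply]
  refine Finset.sum_eq_zero fun p hp => ?_
  rw [Finset.HasAntidiagonal.mem_antidiagonal] at hp
  by_cases e : (l.take p.1).length = m
  · rw [hh (l.drop p.1), mul_zero]
    simp only [List.length_take, List.length_drop] at e ⊢
    omega
  · rw [hg _ e, zero_mul]

open Classical in
/-- The homogeneous components of a function on words. -/
def homogPart (n : ℕ) (g : WordFun Λ B) : WordFun Λ B := fun l => if l.length = n then g l else 0

theorem homogPart_apply_of_length {n : ℕ} (g : WordFun Λ B) {l : List B} (h : l.length = n) :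
    homogPart n g l = g l := if_pos h

theorem isHomog_homogPart (n : ℕ) (g : WordFun Λ B) : IsHomog n (homogPart n g) :=
  fun _ h => if_neg h

/-- Functions on words may have infinitely many homogeneous components, but a value at one word
involves finitely many. This replaces a decomposition into a finite sum. -/
theorem mul_apply_eq_sum_homogPart (g h : WordFun Λ B) (l : List B) :
    (g * h) l =
      ∑ p ∈ Finset.HasAntidiagonal.antidiagonal l.length, (homogPart p.1 g * homogPart p.2 h) l := by
  rw [mul_apply]
  refine Finset.sum_congr rfl fun p hp => ?_
  rw [Finset.HasAntidiagonal.mem_antidiagonal] at hp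
  conv_rhs => rw [← List.take_append_drop p.1 l]
  rw [mul_append (isHomog_homogPart p.1 g) _ _ _ (by simp; omega),
    homogPart_apply_of_length _ (by simp; omega), homogPart_apply_of_length _ (by simp; omega)]

end WordFun

/-! ### The hull of an algebra over the dual operad -/

/-- A commutative algebra `Λ` of operators on `B` that contains the multiplications by the elements
of `B`, as they arise from algebras over the operad `GD^!`. -/
structure HullData (k Λ B : Type u) [Field k] [CommRing Λ] [Algebra k Λ] [AddCommGroup B]
    [Module k B] [Module Λ B] [IsScalarTower k Λ B] where
  L : B →ₗ[k] Λ
  M : B →ₗ[k] Λ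
  faithful : ∀ φ ψ : Λ, (∀ x : B, φ • x = ψ • x) → φ = ψ
  -- For `φ = L a` this is the right symmetry of `⋆`. With `δ_x(φ) = L (φ • x) - φ * L x` it reads
  -- `δ_x(φ) • b = δ_b(φ) • x`.
  symm : ∀ (φ : Λ) (x b : B), L (φ • x) • b - φ • L x • b = L (φ • b) • x - φ • L b • x
  M_comm : ∀ a b : B, M a • b = M b • a
  L_M : ∀ a b : B, L (M a • b) = M a * L b + M b * L a

/-- All ways to remove a letter from a word. -/
def removals {B : Type u} : List B → List (B × List B)
  | [] => []
  | b :: l => (b, l) :: (removals l).map fun p => (p.1, b :: p.2)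

theorem length_of_mem_removals {B : Type u} {l : List B} {p : B × List B} (h : p ∈ removals l) :
    p.2.length + 1 = l.length := by
  induction l generalizing p with
  | nil => simp [removals] at h
  | cons b l ih =>
    simp only [removals, List.mem_cons, List.mem_map] at h
    rcases h with rfl | ⟨q, hq, rfl⟩
    · rfl
    · simpa using ih hq

theorem removals_append {B : Type u} (l l' : List B) :
    removals (l ++ l') = (removals l).map (fun p => (p.1, p.2 ++ l')) ++
      (removals l').map fun p => (p.1, l ++ p.2) := by
  induction l with
  | nil => simp [removals]
  | cons b l ih => simp [removals, ih, Function.comp_def]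

namespace HullData

open WordFun

variable {k Λ B : Type u} [Field k] [CommRing Λ] [Algebra k Λ] [AddCommGroup B]
  [Module k B] [Module Λ B] [IsScalarTower k Λ B]

variable (Λ) in
/-- The value of an element of the hull of degree `n` at `n + 1` letters. -/
def pair (g : WordFun Λ B) : List B → B
  | [] => 0
  | b :: l => g l • b

/-- Symmetric functions on words that are also symmetric in the letters and the argument. -/
structure IsSymm (g : WordFun Λ B) : Prop where
  perm : ∀ l l' : List B, l.Perm l' → g l = g l'
  link : ∀ (b c : B) (l : List B), g (b :: l) • c = g (c :: l) • b

theorem IsSymm.shift {g : WordFun Λ B} (hg : IsSymm g) (b : B) : IsSymm (shift b g) where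
  perm l l' h := hg.perm _ _ (h.cons b)
  link c d l := by
    simp only [shift_apply]
    rw [hg.perm _ _ (List.Perm.swap c b l), hg.perm _ _ (List.Perm.swap d b l), hg.link]

/-- `perm` permutes the letters of the function and `link` exchanges one of them with the argument;
together they give all permutations of the whole word. -/
theorem IsSymm.pair_perm {g : WordFun Λ B} (hg : IsSymm g) {l l' : List B} (h : l.Perm l') :
    pair Λ g l = pair Λ g l' := by
  induction h with
  | nil => rfl
  | cons x h _ => rw [pair, pair, hg.perm _ _ h]
  | swap x y l => exact hg.link _ _ _
  | trans _ _ h1 h2 => exact h1.trans h2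

theorem IsSymm.homogPart {g : WordFun Λ B} (hg : IsSymm g) (n : ℕ) : IsSymm (homogPart n g) where
  perm l l' h := by simp only [WordFun.homogPart, h.length_eq, hg.perm _ _ h]
  link b c l := by
    simp only [WordFun.homogPart, List.length_cons]
    split_ifs
    · exact hg.link b c l
    · simp

variable (H : HullData k Λ B)
include H

/-- Tested on an arbitrary `x`: `link` for `h` brings `c` into the argument, `link` for `g` trades
it for `b`, and `link` for `h` puts `b` back. This uses that `Λ` is commutative and acts faithfully.
-/
theorem exchange {g h : WordFun Λ B} (hg : IsSymm g) (hh : IsSymm h) (b c : B) (l l' : List B) :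
    g (b :: l) * h (c :: l') = g (c :: l) * h (b :: l') := by
  refine H.faithful _ _ fun x => ?_
  rw [mul_smul, mul_smul, hh.link c x, hh.link b x, smul_comm, hg.link b c, smul_comm]

/-- The only case that is not covered by the symmetry of one factor is a transposition across the
cut, which is `exchange`. -/
theorem take_drop_perm {g h : WordFun Λ B} (hg : IsSymm g) (hh : IsSymm h) {l l' : List B}
    (hl : l.Perm l') (n : ℕ) : g (l.take n) * h (l.drop n) = g (l'.take n) * h (l'.drop n) := by
  induction hl generalizing g n with
  | nil => rfl
  | cons x hp ih =>
    cases n with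
    | zero => simp [hh.perm _ _ (hp.cons x)]
    | succ n => exact ih (hg.shift x) n
  | swap x y l =>
    match n with
    | 0 => simp [hh.perm _ _ (List.Perm.swap x y l)]
    | 1 => exact H.exchange hg hh _ _ _ _
    | n + 2 => simp [hg.perm _ _ (List.Perm.swap x y (l.take n))]
  | trans _ _ h1 h2 => exact (h1 hg n).trans (h2 hg n)

/-- Interchanging the factors amounts to swapping the two blocks of the word at each cut, a
permutation of its letters. -/
theorem mul_comm_apply {g h : WordFun Λ B} (hg : IsSymm g) (hh : IsSymm h) : g * h = h * g := by
  ext l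
  rw [mul_apply, mul_apply, ← Finset.Nat.sum_antidiagonal_swap]
  refine Finset.sum_congr rfl fun p hp => ?_
  rw [Finset.HasAntidiagonal.mem_antidiagonal] at hp
  have h1 : (l.take p.1 ++ l.drop p.1).Perm (l.drop p.1 ++ l.take p.1) := List.perm_append_comm
  rw [List.take_append_drop] at h1
  simp only [Prod.fst_swap, Prod.snd_swap]
  rw [H.take_drop_perm hg hh h1, mul_comm (h _)]
  rw [List.take_left' (by simp; omega), List.drop_left' (by simp; omega)]

theorem IsSymm.mul {g h : WordFun Λ B} (hg : IsSymm g) (hh : IsSymm h) : IsSymm (g * h) where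
  perm l l' e := by
    rw [WordFun.mul_apply, WordFun.mul_apply, e.length_eq]
    exact Finset.sum_congr rfl fun p _ => H.take_drop_perm hg hh e p.1
  link b c l := by
    simp only [WordFun.mul_apply, List.length_cons, Finset.sum_smul]
    refine Finset.sum_congr rfl fun p hp => ?_
    rcases p with ⟨_ | i, j⟩
    · simp only [List.take_zero, List.drop_zero, mul_smul, hh.link b c l]
    · simp only [List.take_succ_cons, List.drop_succ_cons]
      rw [mul_comm, mul_smul, hg.link b c, ← mul_smul, mul_comm]

omit H in
theorem isSymm_const (c : Λ) : IsSymm (const c : WordFun Λ B) where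
  perm l l' e := by
    cases l with
    | nil => rw [List.nil_perm.1 e]
    | cons b l =>
      cases l' with
      | nil => simp at e
      | cons => rfl
  link b c l := by simp [const]

omit H in
theorem IsSymm.add {g h : WordFun Λ B} (hg : IsSymm g) (hh : IsSymm h) : IsSymm (g + h) where
  perm l l' e := by simp [hg.perm _ _ e, hh.perm _ _ e]
  link b c l := by simp [add_smul, hg.link b c, hh.link b c]

/-- The hull: the commutative algebra of symmetric functions. -/
def hullSubalgebra : Subalgebra k (WordFun Λ B) where
  carrier := {g | IsSymm g}
  mul_mem' := IsSymm.mul H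
  add_mem' := IsSymm.add
  algebraMap_mem' c := by
    have e : algebraMap k (WordFun Λ B) c = const (algebraMap k Λ c) := funext (algebraMap_apply c)
    rw [Set.mem_ofPred_eq, e]
    exact isSymm_const _

/-- The hull as a type. -/
def Hull : Type u := H.hullSubalgebra

instance : CommRing H.Hull :=
  { (inferInstance : Ring H.hullSubalgebra) with
    mul_comm := fun g h => Subtype.ext (H.mul_comm_apply g.2 h.2) }

instance : Algebra k H.Hull := inferInstanceAs (Algebra k H.hullSubalgebra)

/-! #### The derivation of the hull -/

omit H in
/-- The sum over all ways to remove a letter `x` from a word, with the factor `L x`. -/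
def removalSum (L : B → Λ) (g : WordFun Λ B) (l : List B) : Λ :=
  ((removals l).map fun p => g p.2 * L p.1).sum

omit H [AddCommGroup B] [Module Λ B] in
theorem removalSum_cons (L : B → Λ) (g : WordFun Λ B) (b : B) (l : List B) :
    removalSum L g (b :: l) = g l * L b + removalSum L (shift b g) l := by
  simp [removalSum, removals, Function.comp_def]

omit H in
theorem removalSum_perm (L : B → Λ) {g : WordFun Λ B} (hg : IsSymm g) {l l' : List B}
    (h : l.Perm l') : removalSum L g l = removalSum L g l' := by
  induction h generalizing g with
  | nil => rfl
  | cons x h ih => rw [removalSum_cons, removalSum_cons, hg.perm _ _ h, ih (hg.shift x)]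
  | swap x y l =>
    have e : shift y (shift x g) = shift x (shift y g) :=
      funext fun l => hg.perm _ _ (List.Perm.swap _ _ _)
    simp only [removalSum_cons, e, shift_apply]
    ring
  | trans _ _ h1 h2 => exact (h1 hg).trans (h2 hg)

/-- The derivation of the hull, on functions. -/
def der (g : WordFun Λ B) : WordFun Λ B := fun l => H.L (pair Λ g l) - removalSum H.L g l

/-- The formula is dictated by `lam_der_mul`: the derivation also acts on the variables by `X b ↦ L
b`, and the subtracted sum cancels those terms, so that only `L` of the value of `g` remains. -/
theorem der_apply (g : WordFun Λ B) (l : List B) :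
    H.der g l = H.L (pair Λ g l) - removalSum H.L g l := rfl

theorem der_nil (g : WordFun Λ B) : H.der g [] = 0 := by
  simp [der, pair, removalSum, removals]

theorem der_cons (g : WordFun Λ B) (b : B) (l : List B) :
    H.der g (b :: l) = H.L (g l • b) - g l * H.L b - removalSum H.L (shift b g) l := by
  rw [der_apply, removalSum_cons, pair]
  ring

/-- Symmetry in the letters is inherited from `pair` and `removalSum`. For `link`, the first letter
contributes exactly an instance of `H.symm`, and the remaining removals are handled by `link` for
`g`. -/
theorem isSymm_der {g : WordFun Λ B} (hg : IsSymm g) : IsSymm (H.der g) where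
  perm l l' h := by
    rw [der_apply, der_apply, hg.pair_perm h, removalSum_perm _ hg h]
  link b c l := by
    have h1 : ∀ {g : WordFun Λ B}, IsSymm g → removalSum H.L (shift b g) l • c =
        removalSum H.L (shift c g) l • b := by
      intro g hg
      induction l generalizing g with
      | nil => simp [removalSum, removals]
      | cons x l ih =>
        have e : ∀ y, shift x (shift y g) = shift y (shift x g) :=
          fun y => funext fun l => hg.perm _ _ (List.Perm.swap _ _ _)
        rw [removalSum_cons, removalSum_cons, add_smul, add_smul, e, e, ih (hg.shift x)]
        simp only [shift_apply]
        rw [mul_comm, mul_smul, hg.link b c, ← mul_smul, mul_comm]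
    have h2 := (H.symm (g l) c b).symm
    rw [der_cons, der_cons, sub_smul, sub_smul, sub_smul, sub_smul, h1 hg, mul_smul, mul_smul, h2]

/-- This says that `δ_b(φ) = L (φ • b) - φ * L b` is a derivation in `φ`. From `symm`, `δ_{ψb}(φ) •
x = δ_x(φ) • ψ • b = ψ • δ_b(φ) • x`, and faithfulness removes `x`. -/
theorem L_mul_smul (φ ψ : Λ) (b : B) :
    H.L ((φ * ψ) • b) + φ * ψ * H.L b = ψ * H.L (φ • b) + φ * H.L (ψ • b) := by
  refine H.faithful _ _ fun x => ?_
  have h1 := H.symm φ x (ψ • b)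
  have h2 := congrArg (ψ • ·) (H.symm φ x b)
  simp only [smul_sub] at h2
  simp only [add_smul, mul_smul]
  have e1 : H.L (φ • x) • ψ • b = ψ • H.L (φ • x) • b := smul_comm _ _ _
  have e2 : φ • H.L x • ψ • b = ψ • φ • H.L x • b := by
    rw [smul_comm (H.L x) ψ, smul_comm φ ψ]
  have e3 : ψ • φ • H.L b • x = φ • ψ • H.L b • x := smul_comm _ _ _
  rw [e1, e2] at h1
  rw [e3] at h2
  have h3 := h1.symm.trans h2
  rw [sub_eq_sub_iff_add_eq_add] at h3
  simpa only [mul_smul, add_comm] using h3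

omit H in
-- The three terms correspond to the removed letter lying in `l`, being `z`, or lying in `l'`. In
-- the first case `z` moves into the left factor to restore its length `m`, and in the other two the
-- cut stays in place.
theorem removalSum_mul_append (L : B → Λ) {m : ℕ} {g h : WordFun Λ B} (hg : IsHomog m g)
    (z : B) {l l' : List B} (hl : l.length = m) (hs : IsSymm g) :
    removalSum L (g * h) (l ++ z :: l') =
      removalSum L (shift z g) l * h l' + g l * h l' * L z + g l * removalSum L (shift z h) l' := by
  have e1 : (removals l).map (fun p => (g * h) (p.2 ++ z :: l') * L p.1) =
      (removals l).map (fun p => shift z g p.2 * L p.1 * h l') := by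
    refine List.map_congr_left fun p hp => ?_
    have h1 := length_of_mem_removals hp
    have h2 := mul_append hg h (p.2 ++ [z]) l' (by simp; omega)
    rw [List.append_assoc] at h2
    rw [show z :: l' = [z] ++ l' from rfl, h2, shift_apply,
      hs.perm _ _ (List.perm_append_singleton z p.2)]
    ring
  have e2 : (removals l').map (fun p => (g * h) (l ++ z :: p.2) * L p.1) =
      (removals l').map (fun p => g l * (shift z h p.2 * L p.1)) := by
    refine List.map_congr_left fun p hp => ?_
    rw [mul_append hg h l _ hl, shift_apply]
    ring
  rw [removalSum, removals_append, List.map_append, List.sum_append, List.map_map, List.map_map,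
    removals, List.map_cons, List.sum_cons, List.map_map]
  simp only [Function.comp_def]
  rw [e1, e2, List.sum_map_mul_right, List.sum_map_mul_left, mul_append hg h l l' hl]
  simp only [removalSum]
  ring

omit H [AddCommGroup B] [Module Λ B] in
theorem isHomog_removalSum (L : B → Λ) {n : ℕ} {g : WordFun Λ B} (hg : IsHomog n g) :
    IsHomog (n + 1) (removalSum L g) := by
  intro l hl
  refine List.sum_eq_zero fun x hx => ?_
  obtain ⟨p, hp, rfl⟩ := List.mem_map.1 hx
  have := length_of_mem_removals hp
  rw [hg _ (by omega), zero_mul]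

theorem isHomog_der {n : ℕ} {g : WordFun Λ B} (hg : IsHomog n g) : IsHomog (n + 1) (H.der g) := by
  intro l hl
  rw [der_apply, isHomog_removalSum H.L hg l hl, sub_zero]
  cases l with
  | nil => simp [pair]
  | cons b l => rw [pair, hg l (by simpa using hl), zero_smul, map_zero]

/-- A word of the relevant length is cut as `l₁`, one letter `z`, `l₂`. By symmetry `z` can serve as
the extra letter of either factor. The removals in `l₁` and `l₂` then match, and the terms at `z`
are `L_mul_smul`. -/
theorem der_mul_homog {m n : ℕ} {g h : WordFun Λ B} (hg : IsHomog m g)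
    (hh : IsHomog n h) (sg : IsSymm g) (sh : IsSymm h) :
    H.der (g * h) = H.der g * h + g * H.der h := by
  ext l
  by_cases hl : l.length = m + n + 1
  · obtain ⟨l₁, z, l₂, rfl, h1, h2⟩ : ∃ l₁ z l₂, l = l₁ ++ z :: l₂ ∧ l₁.length = m ∧
        l₂.length = n := by
      refine ⟨l.take m, l[m]'(by omega), l.drop (m + 1), ?_, by simp; omega, by simp; omega⟩
      rw [← List.drop_eq_getElem_cons, List.take_append_drop]
    have e1 : (H.der g * h) (l₁ ++ z :: l₂) = H.der g (z :: l₁) * h l₂ := by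
      have := mul_append (H.isHomog_der hg) h (l₁ ++ [z]) l₂ (by simp [h1])
      rw [List.append_assoc] at this
      exact this.trans (by rw [(H.isSymm_der sg).perm _ _ (List.perm_append_singleton z l₁)])
    have e2 : (g * H.der h) (l₁ ++ z :: l₂) = g l₁ * H.der h (z :: l₂) := mul_append hg _ _ _ h1
    have e3 : pair Λ (g * h) (l₁ ++ z :: l₂) = (g l₁ * h l₂) • z := by
      rw [(IsSymm.mul H sg sh).pair_perm List.perm_middle, pair, mul_append hg h _ _ h1]
    rw [WordFun.add_apply, e1, e2, der_cons, der_cons, der_apply, e3,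
      removalSum_mul_append H.L hg z h1 sg]
    linear_combination H.L_mul_smul (g l₁) (h l₂) z
  · rw [H.isHomog_der (hg.mul hh) l hl, WordFun.add_apply, (H.isHomog_der hg).mul hh l (by omega),
      hg.mul (H.isHomog_der hh) l (by omega), add_zero]

omit H in
theorem pair_add (g h : WordFun Λ B) (l : List B) : pair Λ (g + h) l = pair Λ g l + pair Λ h l := by
  cases l <;> simp [pair, add_smul]

omit H in
theorem pair_smul (c : k) (g : WordFun Λ B) (l : List B) : pair Λ (c • g) l = c • pair Λ g l := by
  cases l <;> simp [pair]

/-- The derivation of the hull as a linear map on functions. -/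
def derLinear : WordFun Λ B →ₗ[k] WordFun Λ B where
  toFun := H.der
  map_add' g h := by
    ext l
    simp [der_apply, pair_add, removalSum, add_mul, List.sum_map_add]
    ring
  map_smul' c g := by
    ext l
    simp [der_apply, pair_smul, removalSum, List.smul_sum, smul_sub, Function.comp_def]

/-- The derivation looks only at words shorter by one letter. This locality lets `g * h` be replaced
by a finite sum of homogeneous products in `der_mul`. -/
theorem der_congr {g h : WordFun Λ B} {l : List B}
    (e : ∀ l' : List B, l'.length + 1 = l.length → g l' = h l') : H.der g l = H.der h l := by
  rw [der_apply, der_apply, removalSum, removalSum]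
  congr 2
  · cases l with
    | nil => rfl
    | cons b l => rw [pair, pair, e l rfl]
  · exact List.map_congr_left fun p hp => by rw [e _ (length_of_mem_removals hp)]

theorem homogPart_der_zero (g : WordFun Λ B) : homogPart 0 (H.der g) = 0 := by
  ext l
  cases l with
  | nil => exact (homogPart_apply_of_length (l := []) _ rfl).trans (H.der_nil g)
  | cons b l => exact isHomog_homogPart _ _ _ (by simp)

theorem homogPart_der_succ (n : ℕ) (g : WordFun Λ B) :
    homogPart (n + 1) (H.der g) = H.der (homogPart n g) := by
  ext l
  by_cases hl : l.length = n + 1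
  · rw [homogPart_apply_of_length _ hl]
    exact H.der_congr fun l' h => (homogPart_apply_of_length g (by omega)).symm
  · rw [isHomog_homogPart _ _ _ hl, H.isHomog_der (isHomog_homogPart _ _) l hl]

/-- At a word of length `n + 1` only the homogeneous components of total degree `n` matter. The
homogeneous Leibniz rule is summed over them, and the boundary terms of the two degree shifts vanish
because the derivative has no component of degree zero. -/
theorem der_mul {g h : WordFun Λ B} (sg : IsSymm g) (sh : IsSymm h) :
    H.der (g * h) = H.der g * h + g * H.der h := by
  ext l
  rcases Nat.eq_zero_or_pos l.length with hl | hl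
  · rw [List.length_eq_zero_iff.1 hl]
    simp [mul_nil, der_nil]
  obtain ⟨n, hn⟩ : ∃ n, l.length = n + 1 := ⟨l.length - 1, by omega⟩
  have e : H.der (g * h) l =
      H.derLinear (∑ p ∈ Finset.HasAntidiagonal.antidiagonal n,
        homogPart p.1 g * homogPart p.2 h) l := by
    refine H.der_congr fun l' hl' => ?_
    obtain rfl : l'.length = n := by omega
    rw [mul_apply_eq_sum_homogPart]
    exact (Finset.sum_apply l' _ _).symm
  have e1 : H.derLinear (∑ p ∈ Finset.HasAntidiagonal.antidiagonal n,
        homogPart p.1 g * homogPart p.2 h) l =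
      ∑ p ∈ Finset.HasAntidiagonal.antidiagonal n,
        H.der (homogPart p.1 g * homogPart p.2 h) l := by
    rw [map_sum]
    exact Finset.sum_apply l _ _
  rw [e, e1, WordFun.add_apply, mul_apply_eq_sum_homogPart (H.der g), mul_apply_eq_sum_homogPart g, hn,
    Finset.Nat.sum_antidiagonal_succ, Finset.Nat.sum_antidiagonal_succ', homogPart_der_zero,
    homogPart_der_zero]
  simp only [zero_mul, mul_zero, WordFun.zero_apply, zero_add, homogPart_der_succ,
    ← Finset.sum_add_distrib]
  refine Finset.sum_congr rfl fun p _ => ?_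
  rw [H.der_mul_homog (isHomog_homogPart _ _) (isHomog_homogPart _ _) (sg.homogPart _)
    (sh.homogPart _), WordFun.add_apply]

/-- The derivation of the hull. -/
def hullDer : Derivation k H.Hull H.Hull where
  toLinearMap := H.derLinear.restrict (p := H.hullSubalgebra.toSubmodule)
    (q := H.hullSubalgebra.toSubmodule) fun _ h => H.isSymm_der h
  map_one_eq_zero' := by
    refine Subtype.ext (WordFun.ext fun l => ?_)
    -- The Leibniz rule at `1 * 1` gives `d 1 = d 1 + d 1`.
    have h := H.der_mul (isSymm_const (1 : Λ)) (isSymm_const 1)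
    have e : (const 1 : WordFun Λ B) = 1 := rfl
    rw [e, mul_one, one_mul, mul_one, left_eq_add] at h
    exact congrArg (fun g : WordFun Λ B => g l) h
  leibniz' g h := by
    refine Subtype.ext ?_
    have e := H.der_mul g.2 h.2
    rw [H.mul_comm_apply (H.isSymm_der g.2) h.2, add_comm] at e
    exact e

end HullData
end
end WhiteGD

namespace WhiteGD

noncomputable section

/-! ### The operators of multiplication on an algebra over the dual operad -/

namespace GDDualStructure

variable {k B : Type u} [Field k] [AddCommGroup B] [Module k B] (D : GDDualStructure k B)

/-- The operators of multiplication. -/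
def multipliers : Set (Module.End k B) := Set.range D.succ ∪ Set.range D.mul

/-- Two operators `⋆` commute by `left_comm`, two operators `∗` by associativity and commutativity,
and a mixed pair by `succ_mul`. -/
theorem multipliers_comm : ∀ φ ∈ D.multipliers, ∀ ψ ∈ D.multipliers, φ * ψ = ψ * φ := by
  have h : ∀ a b, D.succ a * D.mul b = D.mul b * D.succ a := fun a b => LinearMap.ext fun x => by
    simp only [Module.End.mul_apply]
    rw [D.mul_comm b x, D.succ_mul, D.mul_comm]
  rintro _ (⟨a, rfl⟩ | ⟨a, rfl⟩) _ (⟨b, rfl⟩ | ⟨b, rfl⟩)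
  · exact LinearMap.ext fun x => D.left_comm a b x
  · exact h a b
  · exact (h b a).symm
  · refine LinearMap.ext fun x => ?_
    simp only [Module.End.mul_apply]
    rw [← D.mul_assoc, D.mul_comm a b, D.mul_assoc]

/-- The commutative algebra generated by the operators of multiplication. -/
def Multiplier : Type u := Algebra.adjoin k D.multipliers

instance : CommRing D.Multiplier := Algebra.adjoinCommRingOfComm k D.multipliers_comm

instance : Algebra k D.Multiplier := inferInstanceAs (Algebra k (Algebra.adjoin k D.multipliers))

instance : Module D.Multiplier B := inferInstanceAs (Module (Algebra.adjoin k D.multipliers) B)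

instance : IsScalarTower k D.Multiplier B :=
  inferInstanceAs (IsScalarTower k (Algebra.adjoin k D.multipliers) B)

/-- Multiplication by the elements of the algebra. -/
def toMultiplier (m : B →ₗ[k] B →ₗ[k] B) (hm : ∀ b, m b ∈ D.multipliers) : B →ₗ[k] D.Multiplier :=
  LinearMap.codRestrict (Algebra.adjoin k D.multipliers).toSubmodule m
    fun b => Algebra.subset_adjoin (hm b)

/-- The hull data of an algebra over the dual operad. -/
def hullData : HullData k D.Multiplier B where
  L := D.toMultiplier D.succ fun b => Or.inl ⟨b, rfl⟩
  M := D.toMultiplier D.mul fun b => Or.inr ⟨b, rfl⟩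
  faithful φ ψ h := Subtype.ext (LinearMap.ext h)
  symm := by
    -- The symmetry holds for the generators by `right_symm` and `mul_succ` with `succ_mul`; it then
    -- spreads to the generated algebra because that algebra is commutative and contains every
    -- `D.succ y`.
    suffices h : ∀ φ ∈ Algebra.adjoin k D.multipliers, ∀ x b : B,
        D.succ (φ x) b - φ (D.succ x b) = D.succ (φ b) x - φ (D.succ b x) from
      fun φ => h φ.1 φ.2
    intro φ hφ
    induction hφ using Algebra.adjoin_induction with
    | mem φ h =>
      intro x b
      obtain ⟨a, rfl⟩ | ⟨a, rfl⟩ := h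
      · exact D.right_symm a x b
      · rw [D.mul_succ, D.mul_succ, D.mul_comm a (D.succ x b), D.mul_comm a (D.succ b x),
          add_sub_cancel_right, add_sub_cancel_right, ← D.succ_mul, ← D.succ_mul, D.mul_comm]
    | algebraMap c =>
      intro x b
      simp [Module.algebraMap_end_apply]
    | add φ ψ _ _ h1 h2 =>
      intro x b
      have e1 := h1 x b
      have e2 := h2 x b
      simp only [LinearMap.add_apply, map_add]
      linear_combination (norm := abel) e1 + e2
    | mul φ ψ hφ hψ h1 h2 =>
      intro x b
      have hc : ∀ y z, φ (D.succ y z) = D.succ y (φ z) ∧ ψ (D.succ y z) = D.succ y (ψ z) ∧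
          φ (ψ z) = ψ (φ z) := by
        intro y z
        let _ : CommRing (Algebra.adjoin k D.multipliers) :=
          Algebra.adjoinCommRingOfComm k D.multipliers_comm
        have hs : D.succ y ∈ Algebra.adjoin k D.multipliers :=
          Algebra.subset_adjoin (Or.inl ⟨y, rfl⟩)
        have e : ∀ (u v : Algebra.adjoin k D.multipliers), u.1 (v.1 z) = v.1 (u.1 z) :=
          fun u v => congrArg (fun w : Algebra.adjoin k D.multipliers => w.1 z) (_root_.mul_comm u v)
        exact ⟨e ⟨φ, hφ⟩ ⟨_, hs⟩, e ⟨ψ, hψ⟩ ⟨_, hs⟩, e ⟨φ, hφ⟩ ⟨ψ, hψ⟩⟩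
      simp only [Module.End.mul_apply]
      -- For `φ ψ` the symmetry of `φ` is used at `(ψ x, b)` and at `(ψ b, x)`, and those of `ψ` and
      -- `φ` at `(x, b)` after applying the other operator. Commutation matches the cross terms,
      -- which then cancel.
      have e1 := h1 (ψ x) b
      have e2 := congrArg φ (h2 x b)
      have e3 := congrArg ψ (h1 x b)
      simp only [map_sub] at e2 e3
      have e4 := h1 (ψ b) x
      have e5 := (hc (φ b) x).2.1
      have e6 := (hc (φ x) b).2.1
      have e7 := (hc b x).2.1
      have e8 := (hc x b).2.1
      have e9 := (hc 0 (D.succ b x)).2.2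
      have e10 := (hc 0 (D.succ x b)).2.2
      rw [← e5, ← e7] at e1
      rw [← e6, ← e8] at e4
      rw [← e9, ← e10] at e3
      linear_combination (norm := abel) e1 + e2 - e3 - e4
  M_comm := D.mul_comm
  L_M a b := Subtype.ext (LinearMap.ext fun x => by
    refine (D.mul_succ a b x).trans ?_
    rw [D.mul_comm (D.succ a x), D.mul_comm (D.succ b x), add_comm]
    rfl)

end GDDualStructure

/-! ### Polynomials with coefficients in a differential ring -/

section Poly

/-- The product of variables over a word. -/
def wordMonomial (A : Type*) [CommSemiring A] {S : Type*} (w : List S) : MvPolynomial S A :=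
  (w.map MvPolynomial.X).prod

section

variable {A : Type*} [CommSemiring A] {S : Type*}

theorem wordMonomial_append (w w' : List S) :
    wordMonomial A (w ++ w') = wordMonomial A w * wordMonomial A w' := by
  simp [wordMonomial]

theorem wordMonomial_cons (s : S) (w : List S) :
    wordMonomial A (s :: w) = MvPolynomial.X s * wordMonomial A w := by
  simp [wordMonomial]

open Classical in
theorem wordMonomial_eq (w : List S) :
    wordMonomial A w = MvPolynomial.monomial (Multiset.toFinsupp (w : Multiset S)) 1 := by
  induction w with
  | nil => simp [wordMonomial]
  | cons s w ih =>
    rw [wordMonomial_cons, ih, MvPolynomial.X, MvPolynomial.monomial_mul, one_mul,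
      ← Multiset.cons_coe, ← Multiset.singleton_add, map_add, Multiset.toFinsupp_singleton]

open Classical in
theorem C_mul_wordMonomial (c : A) (w : List S) :
    MvPolynomial.C c * wordMonomial A w =
      MvPolynomial.monomial (Multiset.toFinsupp (w : Multiset S)) c := by
  rw [wordMonomial_eq, MvPolynomial.C_mul_monomial, mul_one]

end

variable {k : Type u} [Field k] {A : Type u} [CommRing A] [Algebra k A] {S : Type u}

/-- The coefficientwise extension of a linear map. -/
def coeffMap (d : A →ₗ[k] A) : MvPolynomial S A →ₗ[k] MvPolynomial S A :=
  (AddMonoidAlgebra.coeffLinearEquiv k).symm.toLinearMap ∘ₗ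
    Finsupp.mapRange.linearMap d ∘ₗ (AddMonoidAlgebra.coeffLinearEquiv k).toLinearMap

theorem coeffMap_monomial (d : A →ₗ[k] A) (m : S →₀ ℕ) (c : A) :
    coeffMap d (MvPolynomial.monomial m c) = MvPolynomial.monomial m (d c) := by
  refine AddMonoidAlgebra.coeff_injective ?_
  exact Finsupp.mapRange_single (hf := map_zero d)

/-- The derivation of a polynomial ring that extends a derivation of the ring of coefficients. -/
def coeffDer (d : Derivation k A A) : Derivation k (MvPolynomial S A) (MvPolynomial S A) where
  toLinearMap := coeffMap d.toLinearMap
  map_one_eq_zero' := by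
    rw [MvPolynomial.one_def, coeffMap_monomial]
    simp
  leibniz' p q := by
    induction p using MvPolynomial.induction_on' with
    | add p p' hp hp' =>
      simp only [add_mul, map_add, hp, hp', smul_eq_mul]
      ring
    | monomial m a =>
      induction q using MvPolynomial.induction_on' with
      | add p p' hp hp' =>
        simp only [mul_add, map_add, hp, hp', smul_eq_mul]
        ring
      | monomial n b =>
        simp only [MvPolynomial.monomial_mul, coeffMap_monomial, smul_eq_mul]
        rw [add_comm n m, ← map_add]
        congr 1
        simp

theorem coeffDer_monomial (d : Derivation k A A) (m : S →₀ ℕ) (c : A) :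
    coeffDer d (MvPolynomial.monomial m c) = MvPolynomial.monomial m (d c) :=
  coeffMap_monomial _ _ _

/-- The derivation of a polynomial ring with given values at coefficients and variables. -/
def polyDer (d : Derivation k A A) (f : S → A) :
    Derivation k (MvPolynomial S A) (MvPolynomial S A) :=
  coeffDer d + (MvPolynomial.mkDerivation A fun s => MvPolynomial.C (f s)).restrictScalars k

theorem polyDer_C (d : Derivation k A A) (f : S → A) (c : A) :
    polyDer d f (MvPolynomial.C c) = MvPolynomial.C (d c) := by
  have h : MvPolynomial.mkDerivation A (fun s => MvPolynomial.C (f s) : S → MvPolynomial S A)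
      (MvPolynomial.C c) = 0 := MvPolynomial.derivation_C _ c
  simp only [polyDer, Derivation.add_apply, Derivation.restrictScalars_apply, h, add_zero]
  exact coeffDer_monomial d 0 c

theorem polyDer_X (d : Derivation k A A) (f : S → A) (s : S) :
    polyDer d f (MvPolynomial.X s) = MvPolynomial.C (f s) := by
  simp only [polyDer, Derivation.add_apply, Derivation.restrictScalars_apply,
    MvPolynomial.mkDerivation_X]
  rw [MvPolynomial.X, coeffDer_monomial]
  simp

/-- The Leibniz rule removes the letters one by one, with the same enumeration `removals` that
enters the derivation of the hull. -/
theorem polyDer_wordMonomial (d : Derivation k A A) (f : S → A) (w : List S) :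
    polyDer d f (wordMonomial A w) =
      ((removals w).map fun p => MvPolynomial.C (f p.1) * wordMonomial A p.2).sum := by
  induction w with
  | nil => simp [wordMonomial, removals]
  | cons s w ih =>
    rw [wordMonomial_cons, Derivation.leibniz, polyDer_X, ih, removals, List.map_cons,
      List.sum_cons, List.map_map, smul_eq_mul, smul_eq_mul, ← List.sum_map_mul_left, add_comm,
      mul_comm]
    refine congrArg (_ + ·) (congrArg List.sum (List.map_congr_left fun p _ => ?_))
    rw [Function.comp_apply, wordMonomial_cons]
    ring

end Poly

/-! ### The map from differential polynomials to the algebra -/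

namespace HullData

open WordFun

variable {k Λ B : Type u} [Field k] [CommRing Λ] [Algebra k Λ] [AddCommGroup B]
  [Module k B] [Module Λ B] [IsScalarTower k Λ B] (H : HullData k Λ B)

/-- The element of degree `0` of the hull that is the derivative of a variable. -/
def ell (b : B) : H.Hull := ⟨const (H.L b), isSymm_const _⟩

/-- The function that defines the element of degree `1` which represents the commutative
multiplication. -/
def astFun : WordFun Λ B
  | [b] => H.M b
  | _ => 0

theorem isHomog_astFun : IsHomog 1 H.astFun := by
  intro l hl
  match l with
  | [] => rfl
  | [b] => simp at hl
  | _ :: _ :: _ => rfl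

theorem isSymm_astFun : IsSymm H.astFun where
  perm l l' h := by
    by_cases hl : l.length = 1
    · obtain ⟨b, rfl⟩ := List.length_eq_one_iff.1 hl
      rw [List.singleton_perm.1 h]
    · rw [H.isHomog_astFun l hl, H.isHomog_astFun l' (h.length_eq ▸ hl)]
  link b c l := by
    cases l with
    | nil => exact H.M_comm b c
    | cons x l => simp [astFun]

/-- The element of degree `1` of the hull that represents the commutative multiplication. -/
def ast : H.Hull := ⟨H.astFun, H.isSymm_astFun⟩

/-- Only words of two letters need checking, and there vanishing is `L_M`, the Leibniz rule for `∗`.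
Thus `ast` is a constant of the derivation and can serve as the weight `t`. -/
theorem hullDer_ast : H.hullDer H.ast = 0 := by
  refine Subtype.ext (WordFun.ext fun l => ?_)
  change H.der H.astFun l = 0
  by_cases hl : l.length = 2
  · obtain ⟨b, c, rfl⟩ := List.length_eq_two.1 hl
    have h := H.L_M c b
    simp only [der_cons, astFun, removalSum, removals, List.map_cons, List.map_nil, List.sum_cons,
      List.sum_nil, shift_apply, h]
    ring
  · exact H.isHomog_der H.isHomog_astFun l hl

/-- Polynomials over the hull in variables indexed by `B`. -/
abbrev HullPoly : Type u := MvPolynomial B H.Hull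

/-- The derivation of the polynomial ring over the hull. -/
def dHull : Derivation k H.HullPoly H.HullPoly := polyDer H.hullDer H.ell

/-- The value of an element of the hull at the letters of a multiset. -/
def pairLinear (m : B →₀ ℕ) : H.Hull →ₗ[k] B where
  toFun g := pair Λ g.1 (Finsupp.toMultiset m).toList
  map_add' g h := pair_add g.1 h.1 _
  map_smul' c g := pair_smul c g.1 _

/-- The map that replaces a polynomial by its value in the algebra. -/
def lam : H.HullPoly →ₗ[k] B :=
  (Finsupp.lsum k H.pairLinear : ((B →₀ ℕ) →₀ H.Hull) →ₗ[k] B) ∘ₗ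
    (AddMonoidAlgebra.coeffLinearEquiv k).toLinearMap

/-- `lam` orders the multiset of variables arbitrarily; the symmetry of `g` makes the order
immaterial. -/
theorem lam_word (g : H.Hull) (w : List B) :
    H.lam (MvPolynomial.C g * wordMonomial H.Hull w) = pair Λ g.1 w := by
  classical
  rw [C_mul_wordMonomial]
  refine (Finsupp.lsum_single k H.pairLinear _ g).trans ?_
  refine IsSymm.pair_perm (Λ := Λ) (g := g.1) g.2 ?_
  rw [← Multiset.coe_eq_coe, Multiset.coe_toList]
  simp

theorem ast_mul_append (g : WordFun Λ B) (b : B) (l : List B) :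
    (H.astFun * g) (b :: l) = H.M b * g l :=
  mul_append H.isHomog_astFun g [b] l rfl

/-- The polynomials whose coefficients have degrees that match the degrees of monomials. -/
def balanced : Submodule k H.HullPoly :=
  Submodule.span k {u | ∃ (g : H.Hull) (w : List B) (n : ℕ), IsHomog n g.1 ∧ w.length = n + 1 ∧
    u = MvPolynomial.C g * wordMonomial H.Hull w}

theorem mem_balanced {g : H.Hull} {w : List B} {n : ℕ} (hg : IsHomog n g.1)
    (hw : w.length = n + 1) : MvPolynomial.C g * wordMonomial H.Hull w ∈ H.balanced :=
  Submodule.subset_span ⟨g, w, n, hg, hw, rfl⟩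

/-- Both properties are bilinear, so they are checked on spanning elements. The length `n + 1`
guarantees a first letter to serve as the argument. -/
theorem balanced_bilinear (F : H.HullPoly →ₗ[k] H.HullPoly →ₗ[k] H.HullPoly)
    (G : B →ₗ[k] B →ₗ[k] B)
    (h : ∀ (g h : H.Hull) (v w : List B) (b c : B) (m n : ℕ), IsHomog m g.1 → IsHomog n h.1 →
      v.length = m → w.length = n →
      F (MvPolynomial.C g * wordMonomial H.Hull (b :: v))
          (MvPolynomial.C h * wordMonomial H.Hull (c :: w)) ∈ H.balanced ∧
        H.lam (F (MvPolynomial.C g * wordMonomial H.Hull (b :: v))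
          (MvPolynomial.C h * wordMonomial H.Hull (c :: w))) = G (g.1 v • b) (h.1 w • c))
    {p q : H.HullPoly} (hp : p ∈ H.balanced) (hq : q ∈ H.balanced) :
    F p q ∈ H.balanced ∧ H.lam (F p q) = G (H.lam p) (H.lam q) := by
  induction hp using Submodule.span_induction with
  | zero => simp
  | add p p' _ _ hp hp' =>
    simp only [map_add, LinearMap.add_apply, hp.2, hp'.2, and_true]
    exact Submodule.add_mem _ hp.1 hp'.1
  | smul a p _ hp =>
    simp only [map_smul, LinearMap.smul_apply, hp.2, and_true]
    exact Submodule.smul_mem _ _ hp.1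
  | mem p hp =>
    induction hq using Submodule.span_induction with
    | zero => simp
    | add p p' _ _ hp hp' =>
      simp only [map_add, hp.2, hp'.2, and_true]
      exact Submodule.add_mem _ hp.1 hp'.1
    | smul a p _ hp =>
      simp only [map_smul, hp.2, and_true]
      exact Submodule.smul_mem _ _ hp.1
    | mem q hq =>
      obtain ⟨g, _ | ⟨b, v⟩, m, hg, hv, rfl⟩ := hp
      · simp at hv
      obtain ⟨h', _ | ⟨c, w⟩, n, hh, hw, rfl⟩ := hq
      · simp at hw
      rw [lam_word, lam_word]
      exact h g h' v w b c m n hg hh (by simpa using hv) (by simpa using hw)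

/-- A product of balanced elements lacks one degree in its coefficient, which `ast` supplies.
Evaluated with `c` as the argument, `ast` absorbs `b` and the coefficients absorb their own words.
-/
theorem lam_ast_mul {p q : H.HullPoly} (hp : p ∈ H.balanced) (hq : q ∈ H.balanced) :
    MvPolynomial.C H.ast * (p * q) ∈ H.balanced ∧
      H.lam (MvPolynomial.C H.ast * (p * q)) = H.M (H.lam p) • H.lam q := by
  refine H.balanced_bilinear
    ((LinearMap.mul k H.HullPoly).compr₂ (LinearMap.mulLeft k (MvPolynomial.C H.ast)))
    ((Algebra.lsmul k k B).toLinearMap ∘ₗ H.M) ?_ hp hq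
  intro g h v w b c m n hg hh hv hw
  have e : MvPolynomial.C H.ast * (MvPolynomial.C g * wordMonomial H.Hull (b :: v) *
      (MvPolynomial.C h * wordMonomial H.Hull (c :: w))) =
      MvPolynomial.C (H.ast * (g * h)) * wordMonomial H.Hull (b :: v ++ c :: w) := by
    rw [wordMonomial_append, map_mul, map_mul]
    ring
  have hgh := IsHomog.mul hg hh
  simp only [LinearMap.compr₂_apply, LinearMap.mul_apply', LinearMap.mulLeft_apply, e]
  refine ⟨H.mem_balanced (n := 1 + (m + n)) (H.isHomog_astFun.mul hgh) (by simp; omega), ?_⟩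
  rw [lam_word, IsSymm.pair_perm (H.ast * (g * h)).2 List.perm_middle, pair]
  have e1 : (H.ast * (g * h)).1 (b :: v ++ w) = H.M b * (g.1 v * h.1 w) :=
    (H.ast_mul_append (g.1 * h.1) b (v ++ w)).trans
      (by rw [mul_append hg _ _ _ hv])
  rw [e1]
  simp only [LinearMap.comp_apply, AlgHom.toLinearMap_apply, Algebra.lsmul_coe]
  rw [H.M_comm (g.1 v • b), mul_smul, mul_smul, ← smul_comm (g.1 v), H.M_comm b]
  exact smul_comm _ _ _

/-- Differentiation either raises the degree of the coefficient by one or removes one variable, so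
it makes up for the missing degree of a product. After evaluation the removed variables contribute
exactly the sum subtracted in `der`, and `L` of the value of `p` is left. -/
theorem lam_der_mul {p q : H.HullPoly} (hp : p ∈ H.balanced) (hq : q ∈ H.balanced) :
    H.dHull p * q ∈ H.balanced ∧ H.lam (H.dHull p * q) = H.L (H.lam p) • H.lam q := by
  refine H.balanced_bilinear ((LinearMap.mul k H.HullPoly) ∘ₗ H.dHull.toLinearMap)
    ((Algebra.lsmul k k B).toLinearMap ∘ₗ H.L) ?_ hp hq
  intro g h v w b c m n hg hh hv hw
  have e : H.dHull (MvPolynomial.C g * wordMonomial H.Hull (b :: v)) *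
      (MvPolynomial.C h * wordMonomial H.Hull (c :: w)) =
      MvPolynomial.C (H.hullDer g * h) * wordMonomial H.Hull (b :: v ++ c :: w) +
      ((removals (b :: v)).map fun p => MvPolynomial.C (g * (H.ell p.1 * h)) *
        wordMonomial H.Hull (p.2 ++ c :: w)).sum := by
    rw [Derivation.leibniz, dHull, polyDer_C, polyDer_wordMonomial, smul_eq_mul, smul_eq_mul,
      add_mul, add_comm]
    congr 1
    · rw [wordMonomial_append, map_mul]
      ring
    · rw [← List.sum_map_mul_left, ← List.sum_map_mul_right]
      refine congrArg List.sum (List.map_congr_left fun p _ => ?_)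
      rw [wordMonomial_append, map_mul, map_mul]
      ring
  change H.dHull (MvPolynomial.C g * wordMonomial H.Hull (b :: v)) *
      (MvPolynomial.C h * wordMonomial H.Hull (c :: w)) ∈ H.balanced ∧
    H.lam (H.dHull (MvPolynomial.C g * wordMonomial H.Hull (b :: v)) *
      (MvPolynomial.C h * wordMonomial H.Hull (c :: w))) = H.L (g.1 v • b) • h.1 w • c
  rw [e]
  have hD : IsHomog (m + 1) (H.hullDer g).1 := H.isHomog_der hg
  have hℓ : ∀ x : B, IsHomog n (H.ell x * h).1 := by
    intro x l hl
    refine (const_mul_apply _ _ _).trans ?_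
    rw [hh l hl, mul_zero]
  refine ⟨Submodule.add_mem _ (H.mem_balanced (n := m + 1 + n) (hD.mul hh) (by simp; omega))
    (list_sum_mem ?_), ?_⟩
  · intro x hx
    obtain ⟨p, hp, rfl⟩ := List.mem_map.1 hx
    have := length_of_mem_removals hp
    refine H.mem_balanced (n := m + n) (IsHomog.mul hg (hℓ p.1)) ?_
    simp only [List.length_cons, List.length_append] at this ⊢
    omega
  · rw [map_add, map_list_sum, List.map_map, lam_word,
      IsSymm.pair_perm (H.hullDer g * h).2 List.perm_middle, pair]
    have e1 : (H.hullDer g * h).1 (b :: v ++ w) = H.der g.1 (b :: v) * h.1 w :=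
      mul_append hD _ _ _ (by simp [hv])
    have e2 : (removals (b :: v)).map (H.lam ∘ fun p => MvPolynomial.C (g * (H.ell p.1 * h)) *
        wordMonomial H.Hull (p.2 ++ c :: w)) =
        (removals (b :: v)).map fun p => (g.1 p.2 * H.L p.1) • (h.1 w • c) := by
      refine List.map_congr_left fun p hp => ?_
      have := length_of_mem_removals hp
      have e3 : (g * (H.ell p.1 * h)).1 (p.2 ++ w) = g.1 p.2 * (H.L p.1 * h.1 w) :=
        (mul_append hg _ _ _ (by simpa [hv] using this)).trans
          (congrArg _ (const_mul_apply _ _ _))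
      rw [Function.comp_apply, lam_word,
        IsSymm.pair_perm (g * (H.ell p.1 * h)).2 List.perm_middle, pair, e3, ← mul_assoc, mul_smul]
    rw [e1, e2, mul_smul, H.der_apply, pair, removalSum, sub_smul, List.sum_smul, List.map_map]
    exact sub_add_cancel _ _

end HullData
end
end WhiteGD

namespace WhiteGD

noncomputable section

/-! ### Values of derived monomials -/

section DerivedValues

variable {k : Type u} [Field k] {S : Type}

open NATree

/-- A tree has one operation fewer than leaves, so the truncated subtraction in `leaves.length - 1 -
deg`, the number of operations `·`, is exact. -/
theorem NATree.deg_lt_length_leaves (t : NATree DOp.{u} S) : t.deg < t.leaves.length := by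
  induction t with
  | var x => simp [deg, leaves]
  | op ω l r hl hr => cases ω <;> simp [deg, leaves] <;> omega

theorem evalTree_derivedAlg_eq_polarEval (A : OpAlg k PUnit.{u + 1})
    (d : A.carrier →ₗ[k] A.carrier) (a : S → A.carrier) (t : NATree DOp.{u} S) :
    (derivedAlg A d).evalTree a t = polarEval A a t (List.replicate t.deg d) := by
  induction t with
  | var x => rfl
  | op ω l r hl hr =>
    cases ω with
    | succ =>
      simp only [polarEval, deg, List.replicate_succ, List.headD_cons, List.tail_cons,
        List.take_replicate, List.drop_replicate, Nat.add_sub_cancel_left]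
      rw [min_eq_left (by omega), ← hl, ← hr]
      rfl
    | prec =>
      simp only [polarEval, deg, List.replicate_succ, List.headD_cons, List.tail_cons,
        List.take_replicate, List.drop_replicate, Nat.add_sub_cancel_left]
      rw [min_eq_left (by omega), ← hl, ← hr]
      rfl
    | dot =>
      simp only [polarEval, deg, List.take_replicate, List.drop_replicate, Nat.add_sub_cancel_left]
      rw [min_eq_left (by omega), ← hl, ← hr]
      rfl

open Classical in
theorem applyAll_zip_replicate {V : Type*} [AddCommMonoid V] [Module k V] (a : S → V)
    (d : V →ₗ[k] V) (w : List S) (n : ℕ) (hn : w.length = n) (s : S) :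
    applyAll a (w.zip (List.replicate n d)) s = (d ^ w.count s) (a s) := by
  induction w generalizing n with
  | nil => simp [applyAll]
  | cons x w ih =>
    obtain _ | n := n
    · simp at hn
    rw [List.replicate_succ, List.zip_cons_cons, applyAll, ih n (by simpa using hn)]
    by_cases h : s = x
    · subst h
      rw [if_pos rfl, List.count_cons_self, pow_succ']
      rfl
    · rw [if_neg h, List.count_cons_of_ne (Ne.symm h)]

open Classical in
/-- The expansion of the value of a derived monomial by the Leibniz rule. -/
theorem evalTree_derivedAlg (A : OpAlg k PUnit.{u + 1}) {d : A.carrier →ₗ[k] A.carrier}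
    (hd : IsDerivation A d) (a : S → A.carrier) {t : NATree DOp.{u} S} (ht : t.leaves.Nodup) :
    (derivedAlg A d).evalTree a t =
      t.wordSum fun w => A.evalTree (fun s => (d ^ w.count s) (a s)) (t.translate forgetOp) := by
  rw [evalTree_derivedAlg_eq_polarEval, polarEval_eq_wordSum A a t ht _
    (fun e he => by rw [List.eq_of_mem_replicate he]; exact hd) (by simp)]
  refine wordSum_congr t fun w hw _ => ?_
  congr 1
  funext s
  exact applyAll_zip_replicate a d w _ hw s

/-- A commutative algebra as a non-associative algebra. -/
@[reducible]
def mulAlg (k R : Type u) [Field k] [CommRing R] [Algebra k R] : OpAlg k PUnit.{u + 1} where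
  carrier := R
  op _ := LinearMap.mul k R

theorem evalTree_mulAlg {R : Type u} [CommRing R] [Algebra k R] (a : S → R)
    (t : NATree PUnit.{u + 1} S) : (mulAlg k R).evalTree a t = (t.leaves.map a).prod := by
  induction t with
  | var x => simp [OpAlg.evalTree, leaves]
  | op ω l r hl hr =>
    rw [OpAlg.evalTree, hl, hr, leaves, List.map_append, List.prod_append]
    rfl

/-- The value of a derived monomial in a differential commutative algebra. -/
def derValue {R : Type u} [CommRing R] [Algebra k R] (d : R →ₗ[k] R) (x : S → R)
    (t : NATree DOp.{u} S) : R :=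
  (derivedAlg (mulAlg k R) d).evalTree x t

theorem isDerivation_mulAlg {R : Type u} [CommRing R] [Algebra k R] (d : Derivation k R R) :
    IsDerivation (mulAlg k R) d.toLinearMap := by
  intro x y
  refine (d.leibniz x y).trans ?_
  rw [smul_eq_mul, smul_eq_mul, add_comm, mul_comm y]
  rfl

end DerivedValues

/-- The polynomial that collects the orders of derivatives in the expansion of a monomial. -/
def wordPoly (k : Type u) [Field k] {S : Type} (t : NATree DOp.{u} S) : MvPolynomial S k :=
  t.wordSum fun w => wordMonomial k w

/-- The linear extension of `wordPoly`. -/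
def wordPolyMap (k : Type u) [Field k] (S : Type) : MPoly k DOp.{u} S →ₗ[k] MvPolynomial S k :=
  Finsupp.linearCombination k fun t => wordPoly k t.1

theorem MTree.coe_leaves_eq {Ω : Type u} {S : Type} [Fintype S] (t : MTree Ω S) :
    (t.1.leaves : Multiset S) = Finset.univ.val := by
  classical
  refine (Multiset.Nodup.ext (Multiset.coe_nodup.2 t.nodup_leaves) Finset.univ.nodup).2 fun s => ?_
  have h := NATree.count_leaves s t.1
  rw [t.2 s] at h
  simp only [Multiset.mem_coe, Finset.mem_univ_val, iff_true]
  rw [← List.count_pos_iff, h]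
  exact one_pos

/-! ### Values in commutative differential algebras as linear functions of word polynomials. -/

section Substitution

variable {k : Type u} [Field k] {S : Type} [Fintype S]

/-- The linear map that sends a monomial in the variables `S` to a power of `t` times the product of
the corresponding derivatives of the elements `x s`; the exponent of `t` is complementary to the
degree. -/
def substDer {R : Type u} [CommRing R] [Algebra k R] (d : R →ₗ[k] R) (x : S → R) (t : R) :
    MvPolynomial S k →ₗ[k] R :=
  (MvPolynomial.basisMonomials S k).constr k fun m =>
    t ^ (Fintype.card S - 1 - Multiset.card (Finsupp.toMultiset m)) * ∏ s, (d ^ m s) (x s)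

open Classical in
theorem substDer_wordMonomial {R : Type u} [CommRing R] [Algebra k R] (d : R →ₗ[k] R) (x : S → R)
    (t : R) (w : List S) :
    substDer d x t (wordMonomial k w) =
      t ^ (Fintype.card S - 1 - w.length) * ∏ s, (d ^ w.count s) (x s) := by
  have h := (MvPolynomial.basisMonomials S k).constr_basis k
    (fun m => t ^ (Fintype.card S - 1 - Multiset.card (Finsupp.toMultiset m)) *
      ∏ s, (d ^ m s) (x s)) (Multiset.toFinsupp (w : Multiset S))
  rw [MvPolynomial.coe_basisMonomials] at h
  rw [wordMonomial_eq, substDer, h]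
  simp

open Classical in
theorem substDer_wordPoly {R : Type u} [CommRing R] [Algebra k R] (d : Derivation k R R)
    (x : S → R) (t : R) (T : MTree DOp.{u} S) :
    substDer d.toLinearMap x t (wordPoly k T.1) =
      t ^ (Fintype.card S - 1 - T.1.deg) *
        derValue d.toLinearMap x T.1 := by
  rw [derValue, evalTree_derivedAlg _ (isDerivation_mulAlg d) _ T.nodup_leaves]
  have h1 := NATree.map_wordSum (substDer d.toLinearMap x t).toAddMonoidHom T.1
    fun w => wordMonomial k w
  have h2 := NATree.map_wordSum (AddMonoidHom.mulLeft (t ^ (Fintype.card S - 1 - T.1.deg))) T.1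
    fun w => (mulAlg k R).evalTree (fun s => (d.toLinearMap ^ w.count s) (x s))
      (T.1.translate forgetOp)
  refine h1.trans (Eq.trans ?_ h2.symm)
  refine NATree.wordSum_congr _ fun w hw _ => ?_
  refine (substDer_wordMonomial _ _ _ _).trans ?_
  -- All words of one tree have length `deg`, so a single power of `t` factors out.
  rw [hw]
  refine congrArg (t ^ (Fintype.card S - 1 - T.1.deg) * ·) ?_
  rw [evalTree_mulAlg, NATree.leaves_translate fun _ => rfl, ← Multiset.prod_coe,
    ← Multiset.map_coe, T.coe_leaves_eq]
  rfl

/-- The value of a monomial in which the product `·` is replaced by the product with an additional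
factor `t`. -/
def weightedValue {R : Type u} [CommRing R] [Algebra k R] (d : R →ₗ[k] R) (x : S → R) (t : R) :
    NATree DOp.{u} S → R
  | .var s => x s
  | .op .succ l r => d (weightedValue d x t l) * weightedValue d x t r
  | .op .prec l r => d (weightedValue d x t r) * weightedValue d x t l
  | .op .dot l r => t * (weightedValue d x t l * weightedValue d x t r)

omit [Fintype S] in
-- Since `d t = 0`, powers of `t` pass through the derivation, and one factor is collected at each
-- operation `·`.
theorem weightedValue_eq {R : Type u} [CommRing R] [Algebra k R] (d : Derivation k R R) (x : S → R)
    {t : R} (ht : d t = 0) (T : NATree DOp.{u} S) :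
    weightedValue d.toLinearMap x t T =
      t ^ (T.leaves.length - 1 - T.deg) * derValue d.toLinearMap x T := by
  have hd : ∀ (n : ℕ) (y : R), d (t ^ n * y) = t ^ n * d y := fun n y => by
    rw [d.leibniz, d.leibniz_pow, ht]
    simp
  induction T with
  | var s =>
    simp [NATree.leaves, NATree.deg, weightedValue, derValue, OpAlg.evalTree]
  | op ω l r hl hr =>
    have h1 := l.deg_lt_length_leaves
    have h2 := r.deg_lt_length_leaves
    have key : ∀ y z : R,
        t ^ (l.leaves.length - 1 - l.deg) * y * (t ^ (r.leaves.length - 1 - r.deg) * z) =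
        t ^ (l.leaves.length - 1 - l.deg + (r.leaves.length - 1 - r.deg)) * (y * z) := by
      intro y z
      rw [pow_add]
      ring
    cases ω with
    | succ =>
      have e : (l.leaves ++ r.leaves).length - 1 - (l.deg + r.deg + 1) =
          l.leaves.length - 1 - l.deg + (r.leaves.length - 1 - r.deg) := by
        rw [List.length_append]; omega
      rw [weightedValue, hl, hr, NATree.leaves, NATree.deg, e]
      refine Eq.trans ?_ (key (d (derValue d.toLinearMap x l)) (derValue d.toLinearMap x r))
      exact congrArg (· * _) (hd _ _)
    | prec =>
      have e : (l.leaves ++ r.leaves).length - 1 - (l.deg + r.deg + 1) =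
          l.leaves.length - 1 - l.deg + (r.leaves.length - 1 - r.deg) := by
        rw [List.length_append]; omega
      rw [weightedValue, hl, hr, NATree.leaves, NATree.deg, e, mul_comm]
      refine Eq.trans ?_ (key _ _)
      exact congrArg (_ * ·) (hd _ _)
    | dot =>
      have e : (l.leaves ++ r.leaves).length - 1 - (l.deg + r.deg) =
          l.leaves.length - 1 - l.deg + (r.leaves.length - 1 - r.deg) + 1 := by
        rw [List.length_append]; omega
      rw [weightedValue, hl, hr, NATree.leaves, NATree.deg, e, pow_succ', mul_assoc t, key]
      rfl

/-- The right side applies one linear map, the same for all trees, to the word polynomial; hence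
linear relations between word polynomials pass to weighted values. -/
theorem weightedValue_eq_substDer {R : Type u} [CommRing R] [Algebra k R] (d : Derivation k R R)
    (x : S → R) {t : R} (ht : d t = 0) (T : MTree DOp.{u} S) :
    weightedValue d.toLinearMap x t T.1 = substDer d.toLinearMap x t (wordPoly k T.1) := by
  have h : T.1.leaves.length = Fintype.card S := by
    rw [← Multiset.coe_card, T.coe_leaves_eq]
    rfl
  rw [weightedValue_eq d x ht, substDer_wordPoly, h]

end Substitution

/-! ### Vanishing of the word polynomial implies an identity of `GD^!`. -/

namespace HullData

variable {k Λ B : Type u} [Field k] [CommRing Λ] [Algebra k Λ] [AddCommGroup B]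
  [Module k B] [Module Λ B] [IsScalarTower k Λ B] (H : HullData k Λ B) {S : Type}

/-- The algebra with operations `≻`, `≺`, `·` defined by hull data. -/
@[reducible]
def opAlg : OpAlg k DOp.{u} where
  carrier := B
  op
    | .succ => (Algebra.lsmul k k B).toLinearMap ∘ₗ H.L
    | .prec => ((Algebra.lsmul k k B).toLinearMap ∘ₗ H.L).flip
    | .dot => (Algebra.lsmul k k B).toLinearMap ∘ₗ H.M

/-- A single variable with coefficient `1` is balanced with value `a s`; each operation is then
covered by `lam_der_mul` or `lam_ast_mul`. Balancedness is carried along because those two lemmas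
require it. -/
theorem lam_weightedValue (a : S → B) (T : NATree DOp.{u} S) :
    weightedValue H.dHull.toLinearMap (fun s => MvPolynomial.X (a s)) (MvPolynomial.C H.ast) T ∈
        H.balanced ∧
      H.lam (weightedValue H.dHull.toLinearMap (fun s => MvPolynomial.X (a s))
        (MvPolynomial.C H.ast) T) = H.opAlg.evalTree a T := by
  induction T with
  | var s =>
    have e : (MvPolynomial.X (a s) : H.HullPoly) =
        MvPolynomial.C 1 * wordMonomial H.Hull [a s] := by simp [wordMonomial]
    have h1 : WordFun.IsHomog 0 (1 : H.Hull).1 := by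
      intro l hl
      cases l with
      | nil => simp at hl
      | cons => rfl
    rw [weightedValue, e]
    refine ⟨H.mem_balanced h1 rfl, ?_⟩
    rw [lam_word]
    exact one_smul _ _
  | op ω l r hl hr =>
    cases ω with
    | succ =>
      have h := H.lam_der_mul hl.1 hr.1
      rw [hl.2, hr.2] at h
      exact h
    | prec =>
      have h := H.lam_der_mul hr.1 hl.1
      rw [hl.2, hr.2] at h
      exact h
    | dot =>
      have h := H.lam_ast_mul hl.1 hr.1
      rw [hl.2, hr.2] at h
      exact h

/-- Evaluation in `B` factors as `lam ∘ substDer ∘ wordPolyMap`. -/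
theorem eval_opAlg_eq_zero [Finite S] {f : MPoly k DOp.{u} S} (hf : wordPolyMap k S f = 0)
    (a : S → B) : H.opAlg.eval a f = 0 := by
  have := Fintype.ofFinite S
  have ht : H.dHull (MvPolynomial.C H.ast) = 0 := by
    rw [dHull, polyDer_C, hullDer_ast, map_zero]
  have h : H.opAlg.eval a = H.lam ∘ₗ substDer H.dHull.toLinearMap
      (fun s => MvPolynomial.X (a s)) (MvPolynomial.C H.ast) ∘ₗ wordPolyMap k S := by
    refine Finsupp.lhom_ext' fun T => LinearMap.ext_ring ?_
    have e1 : H.opAlg.eval a (Finsupp.single T 1) = H.opAlg.evalTree a T.1 :=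
      (OpAlg.eval_single _ _ _ _).trans (one_smul _ _)
    simp only [LinearMap.comp_apply, Finsupp.lsingle_apply, one_smul,
      wordPolyMap, Finsupp.linearCombination_single]
    rw [e1, ← weightedValue_eq_substDer _ _ ht, (H.lam_weightedValue a T.1).2]
  rw [h, LinearMap.comp_apply, LinearMap.comp_apply, hf, map_zero, map_zero]

end HullData

/-- The change of operations from `≻`, `≺`, `·` to those of the dual operad. -/
def dualOp (k : Type u) [Field k] : DOp.{u} → Module.Dual k (GDGens k) × Bool
  | .succ => (gdProj k 1, false)
  | .prec => (gdProj k 1, true)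
  | .dot => (gdProj k 0, false)

/-! ### The identities of `GD^!` and the kernel of `wordPolyMap`. -/

section

variable {k : Type u} [Field k] {S : Type} [Finite S]

theorem eval_pull_dualOp_eq_zero {f : MPoly k DOp.{u} S} (hf : wordPolyMap k S f = 0)
    {A : OpAlg k (Module.Dual k (GDGens k))} (hA : A ∈ (gdData k).dual.algebras) :
    (A.pull (dualOp k)).Holds f := by
  obtain ⟨D, h1, h2⟩ := exists_gdDualStructure hA
  -- The operators `L` and `M` of the hull data are the left multiplications by `⋆` and `∗`, so the
  -- original operations are recovered.
  have e : A.pull (dualOp k) = D.hullData.opAlg := by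
    unfold OpAlg.pull HullData.opAlg
    congr 1
    funext ω
    cases ω with
    | succ => exact h2.symm
    | prec => exact congrArg LinearMap.flip h2.symm
    | dot => exact h1.symm
  rw [e]
  exact D.hullData.eval_opAlg_eq_zero hf

/-- The polynomial ring with the Euler derivation that multiplies each variable `x s` by a formal
weight. -/
def eulerDer (k : Type u) [Field k] (S : Type) :
    Derivation k (MvPolynomial S (MvPolynomial S k)) (MvPolynomial S (MvPolynomial S k)) :=
  (MvPolynomial.mkDerivation (MvPolynomial S k)
    fun s => MvPolynomial.C (MvPolynomial.X s) * MvPolynomial.X s).restrictScalars k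

omit [Finite S] in
theorem eulerDer_pow (s : S) (n : ℕ) :
    ((eulerDer k S).toLinearMap ^ n) (MvPolynomial.X s) =
      MvPolynomial.C (MvPolynomial.X s ^ n) * MvPolynomial.X s := by
  induction n with
  | zero => simp
  | succ n ih =>
    rw [pow_succ', Module.End.mul_apply, ih]
    change MvPolynomial.mkDerivation (MvPolynomial S k) _ _ = _
    rw [← MvPolynomial.smul_eq_C_mul, Derivation.map_smul, MvPolynomial.mkDerivation_X,
      MvPolynomial.smul_eq_C_mul, ← mul_assoc, ← map_mul, pow_succ]

omit [Finite S] in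
open Classical in
/-- The value of a monomial in the Euler algebra at the variables. -/
theorem derValue_eulerDer [Fintype S] (T : MTree DOp.{u} S) :
    derValue (eulerDer k S).toLinearMap MvPolynomial.X T.1 =
      MvPolynomial.C (wordPoly k T.1) * ∏ s, MvPolynomial.X s := by
  have h := substDer_wordPoly (eulerDer k S) MvPolynomial.X 1 T
  rw [one_pow, one_mul] at h
  rw [← h]
  have e : substDer (eulerDer k S).toLinearMap MvPolynomial.X 1 =
      (LinearMap.mulRight k (∏ s : S, MvPolynomial.X s)) ∘ₗ
        (Algebra.linearMap (MvPolynomial S k) (MvPolynomial S (MvPolynomial S k))).restrictScalars k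
        := by
    refine (MvPolynomial.basisMonomials S k).ext fun m => ?_
    rw [substDer, Module.Basis.constr_basis]
    simp only [eulerDer_pow, one_pow, one_mul, Finset.prod_mul_distrib, ← map_prod,
      MvPolynomial.coe_basisMonomials, LinearMap.comp_apply, LinearMap.mulRight_apply,
      LinearMap.restrictScalars_apply, Algebra.linearMap_apply, MvPolynomial.algebraMap_eq]
    rw [MvPolynomial.monomial_eq, MvPolynomial.C_1, one_mul, Finsupp.prod_fintype _ _ (by simp)]
  rw [e]
  rfl

omit [Finite S] in
theorem pull_gdDualAlg {R : Type u} [CommRing R] [Algebra k R] (d : R →ₗ[k] R) :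
    (gdDualAlg d).pull (dualOp k) = derivedAlg (mulAlg k R) d := by
  unfold OpAlg.pull derivedAlg
  congr 1
  funext ω
  refine LinearMap.ext fun (x : R) => LinearMap.ext fun (y : R) => ?_
  cases ω with
  | succ =>
    change gdDualMul d (gdProj k 1) x y = d x * y
    simp [gdDualMul_apply, gdProj]
  | prec =>
    change gdDualMul d (gdProj k 1) y x = x * d y
    simp [gdDualMul_apply, gdProj, mul_comm]
  | dot =>
    change gdDualMul d (gdProj k 0) x y = x * y
    simp [gdDualMul_apply, gdProj]

/-- In the Euler algebra the value at the variables is the word polynomial, written in the weights,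
times the product of all variables. That product is nonzero and the ring is a domain. -/
theorem wordPolyMap_eq_zero {f : MPoly k DOp.{u} S}
    (hf : ∀ A ∈ (gdData k).dual.algebras, (A.pull (dualOp k)).Holds f) :
    wordPolyMap k S f = 0 := by
  have := Fintype.ofFinite S
  have h0 := hf (gdDualAlg (eulerDer k S).toLinearMap)
    (gdDualAlg_mem _ (isDerivation_mulAlg (eulerDer k S)))
  rw [pull_gdDualAlg] at h0
  have h := h0 MvPolynomial.X
  have e : (derivedAlg (mulAlg k _) (eulerDer k S).toLinearMap).eval MvPolynomial.X =
      (LinearMap.mulRight k (∏ s, (MvPolynomial.X s : MvPolynomial S (MvPolynomial S k)))) ∘ₗ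
        (Algebra.linearMap (MvPolynomial S k)
          (MvPolynomial S (MvPolynomial S k))).restrictScalars k ∘ₗ wordPolyMap k S := by
    refine Finsupp.lhom_ext' fun T => LinearMap.ext_ring ?_
    refine ((OpAlg.eval_single _ _ _ _).trans (one_smul _ _)).trans ?_
    refine (derValue_eulerDer T).trans ?_
    change _ = MvPolynomial.C (wordPolyMap k S (Finsupp.single T 1)) * _
    rw [wordPolyMap, Finsupp.linearCombination_single, one_smul]
  replace h : MvPolynomial.C (wordPolyMap k S f) *
      ∏ s, (MvPolynomial.X s : MvPolynomial S (MvPolynomial S k)) = 0 :=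
    (LinearMap.congr_fun e f).symm.trans h
  refine MvPolynomial.C_injective S _ ?_
  rw [map_zero]
  refine (mul_eq_zero.1 h).resolve_right ?_
  exact Finset.prod_ne_zero_iff.2 fun s _ => MvPolynomial.X_ne_zero s

end

end
end WhiteGD

namespace WhiteGD

noncomputable section

/-! ### Tensor products with commutative algebras -/

section TensorAlg

variable {k : Type u} [Field k]

/-- The tensor product of an algebra with a commutative algebra. -/
@[reducible]
def tensorAlg (A : OpAlg k PUnit.{u + 1}) (R : Type u) [CommRing R] [Algebra k R] :
    OpAlg k PUnit.{u + 1} where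
  carrier := A.carrier ⊗[k] R
  op _ := TensorProduct.map₂ (A.op PUnit.unit) (LinearMap.mul k R)

variable (A : OpAlg k PUnit.{u + 1}) {R : Type u} [CommRing R] [Algebra k R] {S : Type}

theorem evalTree_tensorAlg (a : S → A.carrier) (r : S → R) (t : NATree PUnit.{u + 1} S) :
    (tensorAlg A R).evalTree (fun s => a s ⊗ₜ r s) t =
      A.evalTree a t ⊗ₜ[k] (mulAlg k R).evalTree r t := by
  induction t with
  | var s => rfl
  | op ω l r hl hr =>
    rw [OpAlg.evalTree, hl, hr]
    rfl

theorem evalTree_mulAlg_MTree [Fintype S] (r : S → R) (t : MTree PUnit.{u + 1} S) :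
    (mulAlg k R).evalTree r t.1 = ∏ s, r s := by
  rw [evalTree_mulAlg, ← Multiset.prod_coe, ← Multiset.map_coe, t.coe_leaves_eq]
  rfl

theorem eval_tensorAlg [Fintype S] (a : S → A.carrier) (r : S → R) (f : MPoly k PUnit.{u + 1} S) :
    (tensorAlg A R).eval (fun s => a s ⊗ₜ r s) f = A.eval a f ⊗ₜ[k] ∏ s, r s := by
  induction f using Finsupp.induction_linear with
  | zero => simp only [map_zero, TensorProduct.zero_tmul]
  | add f g hf hg => simp only [map_add, TensorProduct.add_tmul, hf, hg]
  | single t c =>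
    rw [OpAlg.eval_single, OpAlg.eval_single, evalTree_tensorAlg, evalTree_mulAlg_MTree,
      TensorProduct.smul_tmul']

/-- By multilinearity pure tensors suffice; on them every multilinear monomial yields the same
product in the commutative factor, so `f` acts on the first factor alone. -/
theorem holds_tensorAlg [Finite S] {f : MPoly k PUnit.{u + 1} S} (hf : A.Holds f) :
    (tensorAlg A R).Holds f := by
  have := Fintype.ofFinite S
  classical
  have h : (tensorAlg A R).polyMap S f = 0 := by
    refine MultilinearMap.ext_of_span_eq_top
      (g := fun (_ : S) (p : A.carrier × R) => (p.1 ⊗ₜ[k] p.2 : A.carrier ⊗[k] R)) ?_ ?_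
    · intro _
      rw [← TensorProduct.span_tmul_eq_top]
      congr 1
      ext x
      simp
    · intro p
      refine (OpAlg.polyMap_apply _ _ _).trans ?_
      refine (eval_tensorAlg A (fun s => (p s).1) (fun s => (p s).2) f).trans ?_
      rw [hf, TensorProduct.zero_tmul]
      rfl
  intro a
  rw [← OpAlg.polyMap_apply, h]
  rfl

theorem tensorAlg_mem {I : ∀ n : ℕ, Set (MPoly k PUnit.{u + 1} (Fin n))} (hA : A ∈ variety I) :
    tensorAlg A R ∈ variety I :=
  fun n f hf => holds_tensorAlg A (hA n f hf)

theorem isDerivation_tensorAlg (d : Derivation k R R) :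
    IsDerivation (tensorAlg A R) (d.toLinearMap.lTensor A.carrier) := by
  intro (x : A.carrier ⊗[k] R) (y : A.carrier ⊗[k] R)
  change d.toLinearMap.lTensor A.carrier
      (TensorProduct.map₂ (A.op PUnit.unit) (LinearMap.mul k R) x y) =
    TensorProduct.map₂ (A.op PUnit.unit) (LinearMap.mul k R) (d.toLinearMap.lTensor A.carrier x) y +
    TensorProduct.map₂ (A.op PUnit.unit) (LinearMap.mul k R) x (d.toLinearMap.lTensor A.carrier y)
  induction x using TensorProduct.induction_on with
  | zero => simp
  | add x x' hx hx' =>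
    simp only [map_add, LinearMap.add_apply, hx, hx']
    abel
  | tmul a r =>
    induction y using TensorProduct.induction_on with
    | zero => simp
    | add x x' hx hx' =>
      simp only [map_add, hx, hx']
      abel
    | tmul b r' =>
      simp only [TensorProduct.map₂_apply_tmul, TensorProduct.map_tmul, LinearMap.lTensor_tmul,
        LinearMap.mul_apply', ← TensorProduct.tmul_add]
      exact congrArg (A.op PUnit.unit a b ⊗ₜ[k] ·) (isDerivation_mulAlg d r r')

open Classical in
theorem evalTree_derivedAlg_tensorAlg (d : Derivation k R R) (a : S → A.carrier) (r : S → R)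
    {t : NATree DOp.{u} S} (ht : t.leaves.Nodup) :
    (derivedAlg (tensorAlg A R) (d.toLinearMap.lTensor A.carrier)).evalTree
        (fun s => a s ⊗ₜ[k] r s) t =
      A.evalTree a (t.translate forgetOp) ⊗ₜ[k] derValue d.toLinearMap r t := by
  have h := NATree.map_wordSum
    (TensorProduct.mk k A.carrier R (A.evalTree a (t.translate forgetOp))).toAddMonoidHom t
    fun w => (mulAlg k R).evalTree (fun s => (d.toLinearMap ^ w.count s) (r s))
      (t.translate forgetOp)
  rw [evalTree_derivedAlg _ (isDerivation_tensorAlg A d) _ ht, derValue,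
    evalTree_derivedAlg _ (isDerivation_mulAlg d) _ ht]
  refine Eq.trans (NATree.wordSum_congr t fun w _ _ => ?_) h.symm
  refine Eq.trans ?_ (evalTree_tensorAlg A a _ _)
  congr 1
  funext s
  -- The derivation acts on the second factor only, so each term of the Leibniz expansion has the
  -- same first tensor factor.
  have e : ∀ (n : ℕ) (y : R), ((d.toLinearMap.lTensor A.carrier) ^ n) (a s ⊗ₜ[k] y) =
      a s ⊗ₜ[k] (d.toLinearMap ^ n) y := fun n y => by
    induction n generalizing y with
    | zero => rfl
    | succ n ih =>
      rw [pow_succ, pow_succ, Module.End.mul_apply, Module.End.mul_apply, LinearMap.lTensor_tmul, ih]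
  exact e _ _

end TensorAlg

/-! ### The kernel of the map to the Hadamard product -/

section Kernel

variable {k : Type u} [Field k]

theorem exists_comp_eq_of_ker_le {U V W : Type u} [AddCommGroup U] [Module k U] [AddCommGroup V]
    [Module k V] [AddCommGroup W] [Module k W] (p : U →ₗ[k] V) (q : U →ₗ[k] W)
    (h : LinearMap.ker p ≤ LinearMap.ker q) : ∃ g : V →ₗ[k] W, g ∘ₗ p = q := by
  obtain ⟨g, hg⟩ := LinearMap.exists_extend
    (((LinearMap.ker p).liftQ q h) ∘ₗ p.quotKerEquivRange.symm.toLinearMap)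
  refine ⟨g, LinearMap.ext fun x => ?_⟩
  have h1 := LinearMap.congr_fun hg (p.quotKerEquivRange ((LinearMap.ker p).mkQ x))
  simpa using h1

variable {S : Type} [Finite S] (I : ∀ n : ℕ, Set (MPoly k PUnit.{u + 1} (Fin n)))

/-- The tensor product of the change of operations `forgetOp` with a linear map on polynomials. -/
def forgetTensor {W : Type u} [AddCommGroup W] [Module k W] (q : MPoly k DOp.{u} S →ₗ[k] W) :
    MPoly k DOp.{u} S →ₗ[k] (operadOf (variety I)).obj S ⊗[k] W :=
  Finsupp.linearCombination k fun t =>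
    operadOf.mk (variety I) S (Finsupp.single (t.translate forgetOp) 1) ⊗ₜ[k]
      q (Finsupp.single t 1)

theorem forgetTensor_wordPolyMap_single (t : MTree DOp.{u} S) :
    forgetTensor I (wordPolyMap k S) (Finsupp.single t 1) =
      operadOf.mk (variety I) S (Finsupp.single (t.translate forgetOp) 1) ⊗ₜ[k]
        wordPoly k t.1 := by
  rw [forgetTensor, Finsupp.linearCombination_single, one_smul, wordPolyMap,
    Finsupp.linearCombination_single, one_smul]

/-- If the kernel of `p` lies in that of `q`, then over a field `q` factors through `p`, and
tensoring the factor transfers the vanishing. This lets `GD^!(S)` and the polynomial ring be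
interchanged. -/
theorem forgetTensor_eq_zero {V W : Type u} [AddCommGroup V] [Module k V] [AddCommGroup W]
    [Module k W] {p : MPoly k DOp.{u} S →ₗ[k] V} {q : MPoly k DOp.{u} S →ₗ[k] W}
    (h : ∀ f, p f = 0 → q f = 0) {f : MPoly k DOp.{u} S} (hf : forgetTensor I p f = 0) :
    forgetTensor I q f = 0 := by
  obtain ⟨g, rfl⟩ := exists_comp_eq_of_ker_le p q h
  have e : forgetTensor I (g ∘ₗ p) = g.lTensor _ ∘ₗ forgetTensor I p := by
    refine Finsupp.lhom_ext' fun T => LinearMap.ext_ring ?_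
    simp [forgetTensor]
  rw [e, LinearMap.comp_apply, hf, map_zero]

/-- The change of operations `dualOp` with values in the dual operad. -/
def dualMk (k : Type u) [Field k] (S : Type) [Finite S] :
    MPoly k DOp.{u} S →ₗ[k] (operadOf (gdData k).dual.algebras).obj S :=
  Finsupp.linearCombination k fun t : MTree DOp.{u} S =>
    operadOf.mk (gdData k).dual.algebras S (Finsupp.single (t.translate (dualOp k)) 1)

theorem hadamardEval_eq_forgetTensor (f : MPoly k DOp.{u} S) :
    hadamardEval forgetOp (dualOp k) (variety I) (gdData k).dual.algebras S f =
      forgetTensor I (dualMk k S) f := by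
  have h : ∀ t : MTree DOp.{u} S, dualMk k S (Finsupp.single t 1) =
      operadOf.mk (gdData k).dual.algebras S (Finsupp.single (t.translate (dualOp k)) 1) := fun t =>
    (Finsupp.linearCombination_single k _ _).trans (one_smul _ _)
  unfold forgetTensor
  simp only [h]
  rfl

/-- One direction is the hull construction for an arbitrary `GD^!`-algebra; the other is the
evaluation in the Euler algebra. -/
theorem dualMk_eq_zero_iff (f : MPoly k DOp.{u} S) :
    dualMk k S f = 0 ↔ wordPolyMap k S f = 0 := by
  have e1 : dualMk k S f =
      operadOf.mk (gdData k).dual.algebras S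
        (Finsupp.linearCombination k
          (fun t : MTree DOp.{u} S => Finsupp.single (t.translate (dualOp k)) (1 : k)) f) := by
    rw [dualMk, Finsupp.linearCombination_apply, Finsupp.linearCombination_apply, map_finsuppSum]
    simp only [map_smul]
  have e2 : ∀ (A : OpAlg k (Module.Dual k (GDGens k))) (a : S → A.carrier),
      A.eval a (Finsupp.linearCombination k
          (fun t : MTree DOp.{u} S => Finsupp.single (t.translate (dualOp k)) (1 : k)) f) =
        (A.pull (dualOp k)).eval a f := by
    intro A a
    clear e1
    induction f using Finsupp.induction_linear with
    | zero => simp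
    | add f g hf hg => simp only [map_add, hf, hg]
    | single t c =>
      rw [Finsupp.linearCombination_single, map_smul, OpAlg.eval_single, one_smul]
      refine Eq.trans ?_ (OpAlg.eval_single (A.pull (dualOp k)) a t c).symm
      exact congrArg (c • ·) (OpAlg.evalTree_pull _ _ _ _).symm
  rw [e1, operadOf.mk_eq_zero_iff]
  constructor
  · exact fun h => wordPolyMap_eq_zero fun A hA a => (e2 A a).symm.trans (h A hA a)
  · exact fun h A hA a => (e2 A a).trans (eval_pull_dualOp_eq_zero h hA a)

theorem hadamardEval_eq_zero_iff_forgetTensor (f : MPoly k DOp.{u} S) :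
    hadamardEval forgetOp (dualOp k) (variety I) (gdData k).dual.algebras S f = 0 ↔
      forgetTensor I (wordPolyMap k S) f = 0 := by
  rw [hadamardEval_eq_forgetTensor]
  exact ⟨forgetTensor_eq_zero I fun f => (dualMk_eq_zero_iff f).1,
    forgetTensor_eq_zero I fun f => (dualMk_eq_zero_iff f).2⟩

/-- The value of an element of the operad of the variety. -/
def evalAt {A : OpAlg k PUnit.{u + 1}} (hA : A ∈ variety I) (a : S → A.carrier) :
    (operadOf (variety I)).obj S →ₗ[k] A.carrier where
  toFun q := (A.toOperadAlgebra hA).act q a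
  map_add' p q := by simp
  map_smul' c q := by simp

theorem evalAt_mk {A : OpAlg k PUnit.{u + 1}} (hA : A ∈ variety I) (a : S → A.carrier)
    (f : MPoly k PUnit.{u + 1} S) : evalAt I hA a (operadOf.mk (variety I) S f) = A.eval a f :=
  A.toOperadAlgebra_act_mk hA f a

theorem evalAt_mk_single {A : OpAlg k PUnit.{u + 1}} (hA : A ∈ variety I) (a : S → A.carrier)
    (t : MTree PUnit.{u + 1} S) :
    evalAt I hA a (operadOf.mk (variety I) S (Finsupp.single t 1)) = A.evalTree a t.1 := by
  rw [evalAt_mk, OpAlg.eval_single, one_smul]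

/-- The values of monomials at derivatives of elements, collected along polynomials. -/
def derivativeValues {A : OpAlg k PUnit.{u + 1}} (hA : A ∈ variety I)
    (d : A.carrier →ₗ[k] A.carrier) (a : S → A.carrier) :
    MvPolynomial S k →ₗ[k] (operadOf (variety I)).obj S →ₗ[k] A.carrier :=
  (MvPolynomial.basisMonomials S k).constr k fun m => evalAt I hA fun s => (d ^ m s) (a s)

open Classical in
theorem derivativeValues_wordMonomial {A : OpAlg k PUnit.{u + 1}} (hA : A ∈ variety I)
    (d : A.carrier →ₗ[k] A.carrier) (a : S → A.carrier) (w : List S) :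
    derivativeValues I hA d a (wordMonomial k w) =
      evalAt I hA fun s => (d ^ w.count s) (a s) := by
  have h := (MvPolynomial.basisMonomials S k).constr_basis k
    (fun m => evalAt I hA fun s => (d ^ m s) (a s)) (Multiset.toFinsupp (w : Multiset S))
  rw [MvPolynomial.coe_basisMonomials] at h
  rw [wordMonomial_eq, derivativeValues, h]
  simp

/-- For fixed `a`, evaluation factors through `Var(S) ⊗ k[S]`: the exponents of a monomial in `k[S]`
say how many times to differentiate each `a s` before substituting into the element of `Var(S)`. -/
theorem holds_derivedAlg_of_forgetTensor {f : MPoly k DOp.{u} S}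
    (hf : forgetTensor I (wordPolyMap k S) f = 0) {A : OpAlg k PUnit.{u + 1}}
    (hA : A ∈ variety I) {d : A.carrier →ₗ[k] A.carrier} (hd : IsDerivation A d) :
    (derivedAlg A d).Holds f := by
  classical
  intro (a : S → A.carrier)
  have h : (derivedAlg A d).eval a = TensorProduct.lift (derivativeValues I hA d a).flip ∘ₗ
      forgetTensor I (wordPolyMap k S) := by
    refine Finsupp.lhom_ext' fun T => LinearMap.ext_ring ?_
    refine ((OpAlg.eval_single _ _ _ _).trans (one_smul _ _)).trans ?_
    rw [evalTree_derivedAlg A hd a T.nodup_leaves]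
    have h1 := NATree.map_wordSum ((derivativeValues I hA d a).flip
      (operadOf.mk (variety I) S (Finsupp.single (T.translate forgetOp) 1))).toAddMonoidHom T.1
      fun w => wordMonomial k w
    change _ = TensorProduct.lift (derivativeValues I hA d a).flip
      (forgetTensor I (wordPolyMap k S) (Finsupp.single T 1))
    rw [forgetTensor_wordPolyMap_single, TensorProduct.lift.tmul]
    refine Eq.trans (NATree.wordSum_congr _ fun w _ _ => ?_) h1.symm
    refine (evalAt_mk_single I hA (fun s => (d ^ w.count s) (a s))
      (T.translate forgetOp)).symm.trans ?_
    rw [← derivativeValues_wordMonomial]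
    rfl
  exact (LinearMap.congr_fun h f).trans ((congrArg _ hf).trans (map_zero _))

/-- The identity is evaluated in `A ⊗ k[w][X]` at `a s ⊗ X s` with the Euler derivation. The result
is the tensor in question after the embedding `j`, which stays injective when tensored with
`A.carrier`. -/
theorem rTensor_evalAt_forgetTensor {f : MPoly k DOp.{u} S}
    (hf : f ∈ identities (derivedClass I) S) {A : OpAlg k PUnit.{u + 1}} (hA : A ∈ variety I)
    (a : S → A.carrier) :
    (evalAt I hA a).rTensor _ (forgetTensor I (wordPolyMap k S) f) = 0 := by
  have := Fintype.ofFinite S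
  classical
  let j : MvPolynomial S k →ₗ[k] MvPolynomial S (MvPolynomial S k) :=
    (LinearMap.mulRight k (∏ s, (MvPolynomial.X s : MvPolynomial S (MvPolynomial S k)))) ∘ₗ
      (Algebra.linearMap (MvPolynomial S k) (MvPolynomial S (MvPolynomial S k))).restrictScalars k
  have hj : ∀ p, j p = MvPolynomial.C p * ∏ s, MvPolynomial.X s := fun p => rfl
  have hinj : Function.Injective j := by
    refine (injective_iff_map_eq_zero j).2 fun p hp => MvPolynomial.C_injective S _ ?_
    rw [hj] at hp
    rw [map_zero]
    exact (mul_eq_zero.1 hp).resolve_right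
      (Finset.prod_ne_zero_iff.2 fun s _ => MvPolynomial.X_ne_zero s)
  refine (injective_iff_map_eq_zero (j.lTensor A.carrier)).1
    (Module.Flat.lTensor_preserves_injective_linearMap j hinj) _ ?_
  have h := hf _ ⟨_, tensorAlg_mem A hA, _, isDerivation_tensorAlg A (eulerDer k S), rfl⟩
    fun s => a s ⊗ₜ[k] MvPolynomial.X s
  have e : (derivedAlg (tensorAlg A (MvPolynomial S (MvPolynomial S k)))
      ((eulerDer k S).toLinearMap.lTensor A.carrier)).eval
        (fun s => a s ⊗ₜ[k] MvPolynomial.X s) =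
      j.lTensor A.carrier ∘ₗ (evalAt I hA a).rTensor _ ∘ₗ forgetTensor I (wordPolyMap k S) := by
    refine Finsupp.lhom_ext' fun T => LinearMap.ext_ring ?_
    refine ((OpAlg.eval_single _ _ _ _).trans (one_smul _ _)).trans ?_
    refine (evalTree_derivedAlg_tensorAlg A (eulerDer k S) a MvPolynomial.X T.nodup_leaves).trans ?_
    change _ = j.lTensor A.carrier ((evalAt I hA a).rTensor _
      (forgetTensor I (wordPolyMap k S) (Finsupp.single T 1)))
    rw [forgetTensor_wordPolyMap_single, LinearMap.rTensor_tmul, LinearMap.lTensor_tmul,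
      evalAt_mk_single, hj, derValue_eulerDer]
    rfl
  exact (LinearMap.congr_fun e f).symm.trans h

/-- Each coefficient with respect to the monomial basis is an element of `Var(S)` that all
evaluations in algebras of the variety annihilate. Such an element is zero by the definition of the
operad. -/
theorem forgetTensor_eq_zero_of_holds {f : MPoly k DOp.{u} S}
    (hf : f ∈ identities (derivedClass I) S) : forgetTensor I (wordPolyMap k S) f = 0 := by
  classical
  let b := MvPolynomial.basisMonomials S k
  refine (TensorProduct.equivFinsuppOfBasisRight b).map_eq_zero_iff.1 (Finsupp.ext fun m => ?_)
  obtain ⟨v, hv⟩ := operadOf.mk_surjective (variety I) S (TensorProduct.equivFinsuppOfBasisRight b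
    (forgetTensor I (wordPolyMap k S) f) m)
  rw [Finsupp.zero_apply, ← hv, operadOf.mk_eq_zero_iff]
  intro A hA a
  have h : ∀ x : (operadOf (variety I)).obj S ⊗[k] MvPolynomial S k,
      TensorProduct.equivFinsuppOfBasisRight b ((evalAt I hA a).rTensor _ x) m =
        evalAt I hA a (TensorProduct.equivFinsuppOfBasisRight b x m) := by
    intro x
    induction x using TensorProduct.induction_on with
    | zero => simp
    | add x y hx hy => simp only [map_add, Finsupp.add_apply, hx, hy]
    | tmul x y =>
      rw [LinearMap.rTensor_tmul, TensorProduct.equivFinsuppOfBasisRight_apply_tmul_apply,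
        TensorProduct.equivFinsuppOfBasisRight_apply_tmul_apply, map_smul]
  rw [← evalAt_mk I hA, hv, ← h, rTensor_evalAt_forgetTensor I hf, map_zero, Finsupp.zero_apply]

theorem hadamardEval_eq_zero_iff (f : MPoly k DOp.{u} S) :
    hadamardEval forgetOp (dualOp k) (variety I) (gdData k).dual.algebras S f = 0 ↔
      f ∈ identities (derivedClass I) S := by
  rw [hadamardEval_eq_zero_iff_forgetTensor]
  refine ⟨fun h => ?_, forgetTensor_eq_zero_of_holds I⟩
  rintro _ ⟨A, hA, d, hd, rfl⟩
  exact holds_derivedAlg_of_forgetTensor I h hA hd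

end Kernel

end
end WhiteGD

namespace WhiteGD

noncomputable section

/-! ### Binary elements -/

theorem NATree.length_leaves_pos {Ω : Type u} {S : Type} (t : NATree Ω S) :
    0 < t.leaves.length := by
  cases t with
  | var x => simp [leaves]
  | op ω l r =>
    have := l.length_leaves_pos
    rw [leaves, List.length_append]
    omega

theorem NATree.exists_eq_var {Ω : Type u} {S : Type} {t : NATree Ω S} (h : t.leaves.length = 1) :
    ∃ x, t = var x := by
  cases t with
  | var x => exact ⟨x, rfl⟩
  | op ω l r =>
    have := l.length_leaves_pos
    have := r.length_leaves_pos
    rw [leaves, List.length_append] at h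
    omega

theorem MTree.eq_bin_or {Ω : Type u} (t : MTree Ω (Fin 2)) :
    ∃ ω, t = bin ω ∨ t = (bin ω).rename (Equiv.swap 0 1) := by
  have hl : t.1.leaves.length = 2 := by
    rw [← Multiset.coe_card, t.coe_leaves_eq]
    rfl
  have hn := t.nodup_leaves
  obtain ⟨_ | ⟨ω, l, r⟩, ht⟩ := t
  · simp [NATree.leaves] at hl
  have h1 := l.length_leaves_pos
  have h2 := r.length_leaves_pos
  simp only [NATree.leaves, List.length_append] at hl
  obtain ⟨x, rfl⟩ := NATree.exists_eq_var (t := l) (by omega)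
  obtain ⟨y, rfl⟩ := NATree.exists_eq_var (t := r) (by omega)
  refine ⟨ω, ?_⟩
  have hxy : x ≠ y := by simpa [NATree.leaves] using hn
  fin_cases x <;> fin_cases y
  · exact absurd rfl hxy
  · exact Or.inl (ext' rfl)
  · exact Or.inr (ext' rfl)
  · exact absurd rfl hxy

section

variable {k : Type u} [Field k]

theorem operadOf.mk_eq_mk_iff {Ω : Type u} {C : Set (OpAlg k Ω)} {S : Type} [Finite S]
    {f g : MPoly k Ω S} :
    operadOf.mk C S f = operadOf.mk C S g ↔ ∀ A ∈ C, ∀ a : S → A.carrier, A.eval a f = A.eval a g := by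
  rw [← sub_eq_zero, ← map_sub, mk_eq_zero_iff]
  refine forall₂_congr fun A _ => forall_congr' fun a => ?_
  rw [map_sub, sub_eq_zero]

/-- The operad of a class of systems with operations from the dual of the space of generators of
`GD`, with the relations of `GD^!`. -/
abbrev dualOperad (k : Type u) [Field k] : SymmOperad k := operadOf (gdData k).dual.algebras

/-- The binary element of the dual operad defined by an element of the space of generators. -/
abbrev dualBin (e : Module.Dual k (GDGens k)) : (dualOperad k).obj (Fin 2) :=
  operadOf.gen (gdData k).dual.algebras e

theorem dualBin_swap (e : Module.Dual k (GDGens k)) :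
    (dualOperad k).map (Equiv.swap 0 1) (dualBin e) = dualBin ((gdData k).dual.swap e) := by
  rw [dualBin, operadOf.gen_eq_mk, operadOf.map_mk, dualBin, operadOf.gen_eq_mk,
    operadOf.mk_eq_mk_iff]
  rintro A ⟨m, h1, h2, -⟩ a
  rw [Finsupp.lmapDomain_apply, Finsupp.mapDomain_single, OpAlg.eval_single, OpAlg.eval_single]
  congr 1
  change A.op e (a (Equiv.swap 0 1 0)) (a (Equiv.swap 0 1 1)) =
    A.op ((gdData k).dual.swap e) (a 0) (a 1)
  rw [h1, h1, h2]
  simp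

/-- Elements of the generator space are mere labels in the free operad; linear dependence on the
label is one of the identities of the class. -/
theorem dualBin_eq (e : Module.Dual k (GDGens k)) :
    dualBin e = e (Pi.single 0 1) • dualBin (gdProj k 0) + e (Pi.single 1 1) • dualBin (gdProj k 1) +
      e (Pi.single 2 1) • dualBin (gdProj k 2) := by
  simp only [dualBin, operadOf.gen_eq_mk]
  rw [← map_smul, ← map_smul, ← map_smul, ← map_add, ← map_add, operadOf.mk_eq_mk_iff]
  rintro A ⟨m, h1, h2, -⟩ a
  have h : ∀ e, A.eval a (Finsupp.single (MTree.bin e) 1) = m e (a 0) (a 1) := fun e => by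
    rw [OpAlg.eval_single, one_smul, ← h1]
    rfl
  simp only [map_add, map_smul, h]
  conv_lhs => rw [dual_eq_sum e]
  simp [Fin.sum_univ_three]

theorem dualBin_neg (e : Module.Dual k (GDGens k)) : dualBin (-e) = -dualBin e := by
  rw [dualBin_eq (-e), dualBin_eq e]
  simp only [LinearMap.neg_apply]
  module

theorem dualBin_two : dualBin (gdProj k 2) =
    -(dualOperad k).map (Equiv.swap 0 1) (dualBin (gdProj k 1)) := by
  rw [dualBin_swap, dual_swap_one, dualBin_neg, neg_neg]

/-- The span of the operations of the dual operad. -/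
def dualSpan (k : Type u) [Field k] : Submodule k ((dualOperad k).obj (Fin 2)) :=
  Submodule.span k {dualBin (gdProj k 0), dualBin (gdProj k 1),
    (dualOperad k).map (Equiv.swap 0 1) (dualBin (gdProj k 1))}

theorem dualBin_mem (e : Module.Dual k (GDGens k)) : dualBin e ∈ dualSpan k := by
  rw [dualBin_eq, dualBin_two]
  refine Submodule.add_mem _ (Submodule.add_mem _ (Submodule.smul_mem _ _ ?_)
    (Submodule.smul_mem _ _ ?_)) (Submodule.smul_mem _ _ (Submodule.neg_mem _ ?_)) <;>
  exact Submodule.subset_span (by simp)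

theorem mem_dualSpan (q : (dualOperad k).obj (Fin 2)) : q ∈ dualSpan k := by
  obtain ⟨f, rfl⟩ := operadOf.mk_surjective _ _ q
  induction f using Finsupp.induction_linear with
  | zero => rw [map_zero]; exact Submodule.zero_mem _
  | add f g hf hg => rw [map_add]; exact Submodule.add_mem _ hf hg
  | single t c =>
    rw [← mul_one c, ← smul_eq_mul, ← Finsupp.smul_single, map_smul]
    refine Submodule.smul_mem _ _ ?_
    obtain ⟨e, rfl | rfl⟩ := t.eq_bin_or
    · exact dualBin_mem e
    · have h := dualBin_swap e
      rw [dualBin, operadOf.gen_eq_mk, operadOf.map_mk, Finsupp.lmapDomain_apply,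
        Finsupp.mapDomain_single] at h
      rw [h]
      exact dualBin_mem _

variable (I : ∀ n : ℕ, Set (MPoly k PUnit.{u + 1} (Fin n)))

theorem translate_bin_prec :
    (MTree.bin DOp.prec).translate (dualOp k) =
      (MTree.bin (gdProj k 1)).rename (Equiv.swap 0 1) := by
  refine MTree.ext' ?_
  change NATree.op (gdProj k 1) (NATree.var 1) (NATree.var 0) =
    NATree.op (gdProj k 1) (NATree.var (Equiv.swap 0 1 0)) (NATree.var (Equiv.swap 0 1 1))
  simp

theorem mk_single_rename {Ω : Type u} (C : Set (OpAlg k Ω)) (e : Fin 2 ≃ Fin 2)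
    (t : MTree Ω (Fin 2)) :
    operadOf.mk C (Fin 2) (Finsupp.single (t.rename e) 1) =
      (operadOf C).map e (operadOf.mk C (Fin 2) (Finsupp.single t 1)) := by
  rw [operadOf.map_mk, Finsupp.lmapDomain_apply, Finsupp.mapDomain_single]

section HadamardTmul

variable {P Q : SymmOperad.{u} k} {S : Type} [Finite S]

theorem SymmOperad.hadamardTmul_zero (v : P.obj S) :
    SymmOperad.hadamardTmul v (0 : Q.obj S) = 0 :=
  TensorProduct.tmul_zero _ v

theorem SymmOperad.zero_hadamardTmul (w : Q.obj S) :
    SymmOperad.hadamardTmul (0 : P.obj S) w = 0 :=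
  TensorProduct.zero_tmul _ w

theorem SymmOperad.hadamardTmul_add (v : P.obj S) (x y : Q.obj S) :
    SymmOperad.hadamardTmul v (x + y) =
      SymmOperad.hadamardTmul v x + SymmOperad.hadamardTmul v y :=
  TensorProduct.tmul_add v x y

theorem SymmOperad.add_hadamardTmul (x y : P.obj S) (w : Q.obj S) :
    SymmOperad.hadamardTmul (x + y) w =
      SymmOperad.hadamardTmul x w + SymmOperad.hadamardTmul y w :=
  TensorProduct.add_tmul x y w

theorem SymmOperad.hadamardTmul_smul (v : P.obj S) (c : k) (x : Q.obj S) :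
    SymmOperad.hadamardTmul v (c • x) = c • SymmOperad.hadamardTmul v x :=
  TensorProduct.tmul_smul c v x

end HadamardTmul

/-- `Var(2)` is spanned by `x₀x₁` and `x₁x₀`, and `GD^!(2)` by `x₀ ∗ x₁`, `x₀ ⋆ x₁`, `x₁ ⋆ x₀`. The
six tensors are the three operations and their renamings. -/
theorem hadamardTmul_mem_range (v : (operadOf (variety I)).obj (Fin 2))
    (w : (dualOperad k).obj (Fin 2)) :
    SymmOperad.hadamardTmul v w ∈ LinearMap.range
      (hadamardEval forgetOp (dualOp k) (variety I) (gdData k).dual.algebras (Fin 2)) := by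
  set N := LinearMap.range
    (hadamardEval forgetOp (dualOp k) (variety I) (gdData k).dual.algebras (Fin 2))
  have hzero : ∀ v, SymmOperad.hadamardTmul v (0 : (dualOperad k).obj (Fin 2)) ∈ N := fun v => by
    have h := Submodule.zero_mem N
    rwa [← SymmOperad.hadamardTmul_zero v] at h
  have hadd : ∀ v (x y : (dualOperad k).obj (Fin 2)), SymmOperad.hadamardTmul v x ∈ N →
      SymmOperad.hadamardTmul v y ∈ N → SymmOperad.hadamardTmul v (x + y) ∈ N :=
    fun v x y hx hy => by
      have h := Submodule.add_mem N hx hy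
      rwa [← SymmOperad.hadamardTmul_add] at h
  have hsmul : ∀ v (c : k) (x : (dualOperad k).obj (Fin 2)), SymmOperad.hadamardTmul v x ∈ N →
      SymmOperad.hadamardTmul v (c • x) ∈ N := fun v c x hx => by
    have h := Submodule.smul_mem N c hx
    rwa [← SymmOperad.hadamardTmul_smul] at h
  have key : ∀ t : MTree DOp.{u} (Fin 2), SymmOperad.hadamardTmul
      (operadOf.mk (variety I) (Fin 2) (Finsupp.single (t.translate forgetOp) 1))
      (operadOf.mk (gdData k).dual.algebras (Fin 2)
        (Finsupp.single (t.translate (dualOp k)) 1)) ∈ N := fun t =>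
    ⟨Finsupp.single t 1, (hadamardEval_single _ _ _ _ _ _).trans (one_smul _ _)⟩
  have hswap : ∀ q : (dualOperad k).obj (Fin 2),
      (dualOperad k).map (Equiv.swap 0 1) ((dualOperad k).map (Equiv.swap 0 1) q) = q := fun q => by
    rw [(dualOperad k).map_map, ← Equiv.Perm.mul_def, Equiv.swap_mul_self]
    exact (dualOperad k).map_refl q
  have hprec := mk_single_rename (gdData k).dual.algebras (Equiv.swap 0 1)
    (MTree.bin (gdProj k 1))
  rw [← translate_bin_prec] at hprec
  have key' : ∀ ω : DOp.{u}, SymmOperad.hadamardTmul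
      ((operadOf (variety I)).map (Equiv.swap 0 1) (operadOf.gen (variety I) PUnit.unit))
      ((dualOperad k).map (Equiv.swap 0 1) (operadOf.mk (gdData k).dual.algebras (Fin 2)
        (Finsupp.single ((MTree.bin ω).translate (dualOp k)) 1))) ∈ N := fun ω => by
    have h := key ((MTree.bin ω).rename (Equiv.swap 0 1))
    rw [MTree.translate_rename, MTree.translate_rename, mk_single_rename, mk_single_rename] at h
    exact h
  have h1 : ∀ w ∈ dualSpan k, SymmOperad.hadamardTmul (operadOf.gen (variety I) PUnit.unit) w ∈ N := by
    intro w hw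
    induction hw using Submodule.span_induction with
    | zero => exact hzero _
    | add x y _ _ hx hy => exact hadd _ x y hx hy
    | smul c x _ hx => exact hsmul _ c x hx
    | mem x hx =>
      obtain rfl | rfl | rfl := hx
      · exact key (MTree.bin DOp.dot)
      · exact key (MTree.bin DOp.succ)
      · have h := key (MTree.bin DOp.prec)
        rw [hprec] at h
        exact h
  have h2 : ∀ w ∈ dualSpan k, SymmOperad.hadamardTmul ((operadOf (variety I)).map (Equiv.swap 0 1)
      (operadOf.gen (variety I) PUnit.unit)) w ∈ N := by
    intro w hw
    induction hw using Submodule.span_induction with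
    | zero => exact hzero _
    | add x y _ _ hx hy => exact hadd _ x y hx hy
    | smul c x _ hx => exact hsmul _ c x hx
    | mem x hx =>
      -- With `x₁x₀` in the first factor, commutativity of `∗` makes the first tensor the renamed
      -- `·`; the second is the renamed `≺` and the third the renamed `≻`.
      obtain rfl | rfl | rfl := hx
      · have h := dualBin_swap (gdProj k 0)
        rw [dual_swap_zero] at h
        rw [← h]
        exact key' DOp.dot
      · have h := key' DOp.prec
        rw [hprec, hswap] at h
        exact h
      · exact key' DOp.succ
  obtain ⟨f, rfl⟩ := operadOf.mk_surjective _ _ v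
  induction f using Finsupp.induction_linear with
  | zero =>
    rw [map_zero]
    have h := Submodule.zero_mem N
    rwa [← SymmOperad.zero_hadamardTmul w] at h
  | add f g hf hg =>
    rw [map_add]
    have h := Submodule.add_mem N hf hg
    rwa [← SymmOperad.add_hadamardTmul] at h
  | single t c =>
    rw [← mul_one c, ← smul_eq_mul, ← Finsupp.smul_single, map_smul]
    have hc : ∀ v : (operadOf (variety I)).obj (Fin 2), SymmOperad.hadamardTmul v w ∈ N →
        SymmOperad.hadamardTmul (c • v) w ∈ N := fun v hv =>
      Submodule.smul_mem N c hv
    refine hc _ ?_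
    obtain ⟨ω, rfl | rfl⟩ := t.eq_bin_or
    · exact h1 w (mem_dualSpan w)
    · rw [mk_single_rename]
      exact h2 w (mem_dualSpan w)

theorem range_hadamardEval_eq_top :
    LinearMap.range (hadamardEval forgetOp (dualOp k) (variety I) (gdData k).dual.algebras
      (Fin 2)) = ⊤ := by
  refine Submodule.eq_top_iff'.2 fun x => ?_
  change (operadOf (variety I)).obj (Fin 2) ⊗[k] (dualOperad k).obj (Fin 2) at x
  induction x using TensorProduct.induction_on with
  | zero => exact Submodule.zero_mem _
  | tmul v w => exact hadamardTmul_mem_range I v w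
  | add x y hx hy => exact Submodule.add_mem _ hx hy

/-- The isomorphism of `D*Var` and the white product. -/
def derivedIso : OperadIso (dStar I) (whiteGD I) :=
  whiteIso (f := forgetOp) (g := dualOp k) (derivedClass I) (range_hadamardEval_eq_top I)
    fun _ _ f => hadamardEval_eq_zero_iff I f

theorem derivedIso_gen (ω : DOp.{u}) :
    (derivedIso I).equiv (Fin 2) (operadOf.gen (derivedClass I) ω) = whiteGDOp I ω := by
  refine Subtype.ext ?_
  refine ((hadamardEval_single forgetOp (dualOp k) (variety I) (gdData k).dual.algebras
    (MTree.bin ω) 1).trans (one_smul _ _)).trans ?_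
  cases ω with
  | succ => rfl
  | prec =>
    rw [translate_bin_prec]
    refine congrArg (SymmOperad.hadamardTmul _) ?_
    exact congrArg (operadOf.mk (gdData k).dual.algebras (Fin 2)) Finsupp.mapDomain_single.symm
  | dot => rfl

/-! ### Comparison of the identities on the two sides. -/

theorem isGeneralizedDerivedIdentity_of_holds {n : ℕ} {f : MPoly k DOp.{u} (Fin n)}
    (hf : ∀ B ∈ whiteVariety I, B.Holds f) : IsGeneralizedDerivedIdentity I f := by
  intro A hA d hd a
  have hD : derivedAlg A d ∈ derivedClass I := ⟨A, hA, d, hd, rfl⟩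
  let ρ : OperadAlgebra (dStar I) (derivedAlg A d).carrier := (derivedAlg A d).toOperadAlgebra hD
  -- The derived system is an algebra over `D*Var`, hence over the white product with the same three
  -- operations; the hypothesis on `whiteVariety` applies to it.
  have e : (ρ.pull (derivedIso I).symm).toOpAlg =
      ⟨(derivedAlg A d).carrier, fun ω => ρ.binOp (operadOf.gen (derivedClass I) ω)⟩ := by
    unfold OperadAlgebra.toOpAlg
    congr 1
    funext ω
    rw [OperadAlgebra.binOp_pull, ← derivedIso_gen]
    exact congrArg ρ.binOp (((derivedIso I).equiv (Fin 2)).symm_apply_apply _)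
  rw [← (derivedAlg A d).toOperadAlgebra_act_mk hD]
  refine (OperadAlgebra.eval_eq_act ρ f a).symm.trans ?_
  have h' : OpAlg.Holds (ρ.pull (derivedIso I).symm).toOpAlg f := hf _ ⟨_, _, _, _, rfl⟩
  rw [e] at h'
  exact h' a

theorem holds_of_isGeneralizedDerivedIdentity {n : ℕ} {f : MPoly k DOp.{u} (Fin n)}
    (hf : IsGeneralizedDerivedIdentity I f) : ∀ B ∈ whiteVariety I, B.Holds f := by
  rintro _ ⟨A, _, _, ρ, rfl⟩
  -- In the opposite direction, a white product algebra becomes a `D*Var`-algebra, where `f` acts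
  -- through its class, which is zero.
  have e : ρ.toOpAlg =
      ⟨A, fun ω => (ρ.pull (derivedIso I)).binOp (operadOf.gen (derivedClass I) ω)⟩ := by
    unfold OperadAlgebra.toOpAlg
    congr 1
    funext ω
    rw [← derivedIso_gen]
    rfl
  rw [e]
  intro a
  refine (OperadAlgebra.eval_eq_act (ρ.pull (derivedIso I)) f a).trans ?_
  have h : operadOf.mk (derivedClass I) (Fin n) f = 0 := by
    rw [operadOf.mk_eq_zero_iff]
    rintro _ ⟨A, hA, d, hd, rfl⟩
    exact hf A hA d hd
  rw [h]
  exact congrArg (fun φ : MultilinearMap k (fun _ : Fin n => A) A => φ a) (map_zero _)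

end

end
end WhiteGD

theorem mainTheorem2 {k : Type u} [Field k]
    (I : ∀ n : ℕ, Set (WhiteGD.MPoly k PUnit.{u + 1} (Fin n))) :
    -- a multilinear identity of the variety governed by `Var ∘ GD^!` is generalized derived
    (∀ (n : ℕ) (f : WhiteGD.MPoly k WhiteGD.DOp.{u} (Fin n)),
      (∀ B ∈ WhiteGD.whiteVariety I, B.Holds f) → WhiteGD.IsGeneralizedDerivedIdentity I f) ∧
    -- and conversely
    (∀ (n : ℕ) (f : WhiteGD.MPoly k WhiteGD.DOp.{u} (Fin n)),
      WhiteGD.IsGeneralizedDerivedIdentity I f → ∀ B ∈ WhiteGD.whiteVariety I, B.Holds f) ∧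
    -- `D*Var = Var ∘ GD^!`, with the operations `≻`, `≺`, `·` on both sides identified
    ∃ e : WhiteGD.OperadIso (WhiteGD.dStar I) (WhiteGD.whiteGD I),
      ∀ ω : WhiteGD.DOp.{u},
        e.equiv (Fin 2) (WhiteGD.operadOf.gen (WhiteGD.derivedClass I) ω) =
          WhiteGD.whiteGDOp I ω
 :=
  ⟨fun _ _ => WhiteGD.isGeneralizedDerivedIdentity_of_holds I,
    fun _ _ => WhiteGD.holds_of_isGeneralizedDerivedIdentity I,
    WhiteGD.derivedIso I, WhiteGD.derivedIso_gen I⟩
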